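/- Setting. Let $n\ge 1$, $m\ge 0$. Consider the linear Gaussian system $x_{t+1}=Ax_t+w_t$, $y_t=Cx_t+v_t$ with $x_t\in\mathbb R^n$, $y_t\in\mathbb R^m$, independent $w_t\sim\mathcal N(0,W)$, $v_t\sim\mathcal N(0,V)$, $x_0\sim\mathcal N(\bar x_0,X_0)$, and an independent injected noise $\theta\sim\mathcal N(0,\Theta)$, where $W,V,X_0,\Theta$ are positive definite. A policy is a matrix $\pi=[A_L\mid B_L]\in\mathbb R^{n\times(n+m)}$; $\|\cdot\|$ is the spectral norm. For a stage $h\ge 0$ and fixed earlier filters $\pi_0,\dots,\pi_{h-1}$, let $\hat x_0=\bar x_0$, $\hat x_{t+1}=A_{L_t}\hat x_t+B_{L_t}y_t$, where the same $\theta$ is added to both $x_h$ and $\hat x_h$. Let $J_h(\pi_h)=\sum_{t=0}^{h+1}(x_t-\hat x_t)^\top(x_t-\hat x_t)$ be the empirical objective of one simulated trajectory as a function of the filter $\pi_h$ at time $h$, and $\mathcal J_h=\mathbb E[J_h]$. The two-point zeroth-order policy gradient iteration with smoothing radius $r_h$ and stepsize $\eta_h$ draws, at every iteration, a fresh trajectory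 and an independent $U$ uniform on the unit Frobenius sphere of $\mathbb R^{n\times(n+m)}$, and sets $$\pi\leftarrow\pi-\eta_h\,\frac{n(m+n)}{2r_h}\big[J_h(\pi+r_hU)-J_h(\pi-r_hU)\big]U,$$ both values being computed on the same trajectory. (a) One stage. For all $h$, $R>0$, $\rho>0$ there is $c_0>0$ such that for every $c\in(0,c_0]$ there is $K>0$ (all depending only on $h,R,\rho$, $c$ and the system) with the following property. For all earlier filters with $\|\pi_0\|,\dots,\|\pi_{h-1}\|\le R$, the random variable $J_h(\pi)$ is integrable for every $\pi$, $\mathcal J_h$ has a unique minimizer $\tilde\pi_h^*$, and for every initialization $\pi_h^0$ with $\|\pi_h^0\|\le R$, all $\epsilon\in(0,1/2]$, $\delta\in(0,1)$, every smoothing radius $0<r_h\le\rho\epsilon$, the stepsize $\eta_h=c\,\epsilon^2/\log\frac1{\delta\epsilon^2}=O(\epsilon^2)$, and every number of iterations $$T\ \ge\ K\,\epsilon^{-2}\log\tfrac{1}{\delta\epsilon^2}\,\log\tfrac1\epsilon=\tilde O\big(\epsilon^{-2}\log\tfrac1{\delta\epsilon^2}\big),$$ one has $\|\pi_h^{T}-\tilde\pi_h^*\|\le\epsilon$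 with probability at least $1-\delta$. Every iteration uses one sampled trajectory. (b) All stages. Run stages $h=0,\dots,N-1$ successively with fresh independent samples, with $T$ iterations each, stage $0$ started at $\pi=0$ and each later stage started at the filter returned by the previous one, the filters returned by the earlier stages being used as the fixed earlier filters. For all $N$ and $\rho>0$ there is $c_0>0$ such that for every $c\in(0,c_0]$ there is $K>0$ (depending only on $N,\rho,c$ and the system) such that for all $\epsilon\in(0,1/2]$, $\delta\in(0,1)$, with smoothing radius $0<r\le\rho\epsilon$ and stepsize $\eta=c\,\epsilon^2/\log\frac{1}{\delta\epsilon^2}$ in every stage, as soon as the total number $NT$ of samples is at least $K\epsilon^{-2}\log\frac1{\delta\epsilon^2}\log\frac1\epsilon=\tilde O(\epsilon^{-2})$, then with probability at least $1-N\delta$ the filters $\pi_0,\dots,\pi_{N-1}$ returned by the run satisfy, for all $h<N$ simultaneously, $\|\pi_h-\tilde\pi_h^*\|\le\epsilon$ (with $\tilde\pi_h^*$ the minimizer of $\mathcal J_h$ given the computed earlier filters) and $\|\pi_h-[A-L_h^*C\mid L_h^*]\|\le\epsilon$, where $L_t^*=A\Sigma_t^*C^\top(V+C\Sigma_t^*C^\top)^{-1}$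 is the time-varying Kalman gain, $\Sigma_0^*=X_0$ and $\Sigma_{t+1}^*=A\Sigma_t^*A^\top-A\Sigma_t^*C^\top(V+C\Sigma_t^*C^\top)^{-1}C\Sigma_t^*A^\top+W$. -/

import Mathlib

open MeasureTheory ProbabilityTheory
open scoped Matrix Matrix.Norms.L2Operator

/-- Data of a linear Gaussian estimation problem with `n` states and `m` outputs:
`x_{t+1} = A x_t + w_t`, `y_t = C x_t + v_t`, with `w_t ∼ N(0, W)`, `v_t ∼ N(0, V)` and
`x_0 ∼ N(xbar, X₀)`, together with the covariance `Θ` of the additional noise `θ ∼ N(0, Θ)` that is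
injected by the learning algorithm. -/
structure KFSystem (n m : ℕ) where
  A : Matrix (Fin n) (Fin n) ℝ
  C : Matrix (Fin m) (Fin n) ℝ
  W : Matrix (Fin n) (Fin n) ℝ
  V : Matrix (Fin m) (Fin m) ℝ
  X₀ : Matrix (Fin n) (Fin n) ℝ
  Θ : Matrix (Fin n) (Fin n) ℝ
  xbar : Fin n → ℝ

/-- One-step filter parameters `π = [A_L | B_L]`, an `n × (n + m)` real matrix.  Norms of policies
are spectral norms (operator norms for the Euclidean norms). -/
abbrev Policy (n m : ℕ) : Type := Matrix (Fin n) (Fin n ⊕ Fin m) ℝ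

/-- `A_L x̂ + B_L y` for `π = [A_L | B_L]`. -/
def Policy.predict {n m : ℕ} (π : Policy n m) (xhat : Fin n → ℝ) (y : Fin m → ℝ) : Fin n → ℝ :=
  π *ᵥ Sum.elim xhat y

/-- The law `N(μ, S)` on coordinate vectors. -/
noncomputable def gaussianVec {k : ℕ} (μ : Fin k → ℝ) (S : Matrix (Fin k) (Fin k) ℝ) :
    Measure (Fin k → ℝ) :=
  (multivariateGaussian (WithLp.toLp 2 μ) S).map WithLp.ofLp

/-- `n × (n + m)` matrices as a Euclidean space (Frobenius norm). -/
abbrev DirectionSpace (n m : ℕ) : Type := EuclideanSpace ℝ (Fin n × (Fin n ⊕ Fin m))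

/-- The matrix of a direction. -/
def directionMatrix {n m : ℕ} (u : DirectionSpace n m) : Policy n m :=
  Matrix.of fun i j => u (i, j)

/-- The uniform probability law on the (surface of the) unit sphere of `DirectionSpace n m`. -/
noncomputable def unitSphereLaw (n m : ℕ) : Measure (DirectionSpace n m) :=
  (((volume : Measure (DirectionSpace n m)).toSphere Set.univ)⁻¹ •
    (volume : Measure (DirectionSpace n m)).toSphere).map Subtype.val

/-- The randomness of one call of the zeroth-order oracle: a direction `U` and one simulated
trajectory, given by `x_0`, `(w_t)`, `(v_t)` and the injected noise `θ`. -/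
abbrev Sample (n m : ℕ) : Type :=
  DirectionSpace n m × (Fin n → ℝ) × (ℕ → Fin n → ℝ) × (ℕ → Fin m → ℝ) × (Fin n → ℝ)

namespace Sample

variable {n m : ℕ}

/-- The random direction. -/
def dir (s : Sample n m) : Policy n m := directionMatrix s.1
/-- The initial state. -/
def init (s : Sample n m) : Fin n → ℝ := s.2.1
/-- The process noise. -/
def process (s : Sample n m) : ℕ → Fin n → ℝ := s.2.2.1
/-- The measurement noise. -/
def meas (s : Sample n m) : ℕ → Fin m → ℝ := s.2.2.2.1
/-- The injected noise. -/
def inject (s : Sample n m) : Fin n → ℝ := s.2.2.2.2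

end Sample

namespace KFSystem

variable {n m : ℕ}

/-- The law of a sample: all components are independent, `U` is uniform on the unit sphere,
`x_0 ∼ N(xbar, X₀)`, the `w_t ∼ N(0, W)` and `v_t ∼ N(0, V)` are i.i.d., and `θ ∼ N(0, Θ)`. -/
noncomputable def sampleLaw (S : KFSystem n m) : Measure (Sample n m) :=
  (unitSphereLaw n m).prod <|
    (gaussianVec S.xbar S.X₀).prod <|
      (Measure.infinitePi fun _ : ℕ => gaussianVec 0 S.W).prod <|
        (Measure.infinitePi fun _ : ℕ => gaussianVec 0 S.V).prod (gaussianVec 0 S.Θ)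

/-- The state trajectory, with `θ` injected into the state at time `h`. -/
def state (S : KFSystem n m) (h : ℕ) (s : Sample n m) : ℕ → Fin n → ℝ
  | 0 => s.init + if h = 0 then s.inject else 0
  | t + 1 => S.A *ᵥ state S h s t + s.process t + if h = t + 1 then s.inject else 0

/-- The measured output `y_t = C x_t + v_t`. -/
def output (S : KFSystem n m) (h : ℕ) (s : Sample n m) (t : ℕ) : Fin m → ℝ :=
  S.C *ᵥ S.state h s t + s.meas t

/-- The state estimates `x̂_t` produced by the time-varying filters `F 0, F 1, …` started at
`x̂_0 = xbar`, with the same `θ` injected into the estimate at time `h`. -/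
def estimate (S : KFSystem n m) (h : ℕ) (F : ℕ → Policy n m) (s : Sample n m) : ℕ → Fin n → ℝ
  | 0 => S.xbar + if h = 0 then s.inject else 0
  | t + 1 => (F t).predict (estimate S h F s t) (S.output h s t) +
      if h = t + 1 then s.inject else 0

/-- The empirical objective at stage `h` on one sampled trajectory,
`∑_{t=0}^{h+1} (x_t - x̂_t)ᵀ (x_t - x̂_t)`, where the filters at times `t < h` are the fixed `F t`
and the filter at time `h` is the candidate `π`. -/
def sampleCost (S : KFSystem n m) (h : ℕ) (F : ℕ → Policy n m) (π : Policy n m)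
    (s : Sample n m) : ℝ :=
  ∑ t ∈ Finset.range (h + 2),
    (S.state h s t - S.estimate h (Function.update F h π) s t) ⬝ᵥ
      (S.state h s t - S.estimate h (Function.update F h π) s t)

/-- The stage objective, the expectation of the empirical objective. -/
noncomputable def cost (S : KFSystem n m) (h : ℕ) (F : ℕ → Policy n m) (π : Policy n m) : ℝ :=
  ∫ s, S.sampleCost h F π s ∂S.sampleLaw

/-- The two-point zeroth-order oracle with smoothing radius `r`: both empirical objective values are
computed on the same sampled trajectory. -/
noncomputable def twoPointOracle (S : KFSystem n m) (h : ℕ) (F : ℕ → Policy n m) (r : ℝ)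
    (π : Policy n m) (s : Sample n m) : Policy n m :=
  (((n * (m + n) : ℕ) : ℝ) / (2 * r) *
    (S.sampleCost h F (π + r • s.dir) s - S.sampleCost h F (π - r • s.dir) s)) • s.dir

/-- The iterates of zeroth-order policy gradient at stage `h` with stepsize `η`, started at `π₀`.
Iteration `k` uses the fresh sample `s k`. -/
noncomputable def zerothOrderPG (S : KFSystem n m) (h : ℕ) (F : ℕ → Policy n m) (r η : ℝ)
    (π₀ : Policy n m) (s : ℕ → Sample n m) : ℕ → Policy n m
  | 0 => π₀
  | k + 1 => zerothOrderPG S h F r η π₀ s k -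
      η • S.twoPointOracle h F r (zerothOrderPG S h F r η π₀ s k) (s k)

/-- The law of the i.i.d. samples used during one stage. -/
noncomputable def stageLaw (S : KFSystem n m) : Measure (ℕ → Sample n m) :=
  Measure.infinitePi fun _ : ℕ => S.sampleLaw

/-- The initial policy of stage `h`: zero in the first stage, and afterwards the policy returned by
the previous stage. -/
def warmStart (F : ℕ → Policy n m) : ℕ → Policy n m
  | 0 => 0
  | h + 1 => F h

/-- Receding-horizon policy gradient: `rhpg S r η T s N` is the sequence of filters after `N` stages
(`0` at the times `t ≥ N` that have not been reached).  Every stage performs `T` iterations of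
zeroth-order policy gradient; iteration `k` of stage `h` consumes the sample `s h k`, so that the
filters of the first `N` stages use exactly `N * T` samples. -/
noncomputable def rhpg (S : KFSystem n m) (r η : ℝ) (T : ℕ) (s : ℕ → ℕ → Sample n m) :
    ℕ → ℕ → Policy n m
  | 0 => fun _ => 0
  | h + 1 => Function.update (rhpg S r η T s h) h
      (S.zerothOrderPG h (rhpg S r η T s h) r η (warmStart (rhpg S r η T s h) h) (s h) T)

/-- The law of the independent samples used by all stages. -/
noncomputable def runLaw (S : KFSystem n m) : Measure (ℕ → ℕ → Sample n m) :=
  Measure.infinitePi fun _ : ℕ => S.stageLaw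

/-- The Riccati difference equation of the Kalman filter, started at `X₀`. -/
noncomputable def riccati (S : KFSystem n m) : ℕ → Matrix (Fin n) (Fin n) ℝ
  | 0 => S.X₀
  | t + 1 => S.A * riccati S t * S.Aᵀ -
      S.A * riccati S t * S.Cᵀ * (S.V + S.C * riccati S t * S.Cᵀ)⁻¹ *
        S.C * riccati S t * S.Aᵀ + S.W

/-- The time-varying Kalman gain `L_t = A Σ_t Cᵀ (V + C Σ_t Cᵀ)⁻¹`. -/
noncomputable def kalmanGain (S : KFSystem n m) (t : ℕ) : Matrix (Fin n) (Fin m) ℝ :=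
  S.A * S.riccati t * S.Cᵀ * (S.V + S.C * S.riccati t * S.Cᵀ)⁻¹

/-- The time-varying Kalman filter `[A - L_t C | L_t]`. -/
noncomputable def kalmanFilter (S : KFSystem n m) (t : ℕ) : Policy n m :=
  Matrix.fromCols (S.A - S.kalmanGain t * S.C) (S.kalmanGain t)

end KFSystem

/-! The candidate filter `π` enters the stage objective only through the last prediction `π z`,
where `z = (x̂_h, y_h)`, so the empirical objective is a quadratic polynomial in `π`. A symmetric
difference of a quadratic is exact: with `d = n(m+n)` and `G = (π z - x_{h+1}) zᵀ` the oracle equals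
`2d⟨G, U⟩U` for every smoothing radius (`directionOf_twoPointOracle`). Since `U` is independent of
the trajectory and has covariance `I/d`, the mean of the oracle is the gradient `2(π - π*)M`, with
`M = E[z zᵀ]`. The injected noise and the last measurement noise contribute to `M` a fixed positive
definite matrix that does not depend on the earlier filters (`dotProduct_excitation_le`). The
iteration is therefore stochastic gradient descent with a uniform strong monotonicity constant, and
its minimizer is unique (`cost_eq`).

The oracle is unbounded: it is quadratic in Gaussian variables and grows linearly in `‖π - π*‖`. A
second-moment bound with Chebyshev's inequality would cost a factor `1/δ`. Instead, the `p`-th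
moment of `τ + ‖π - π*‖²` is followed, with `p ≈ log(1/(δε²))` and `τ` proportional to `pη`, hence
at most of order `ε²`. The regularization `τ` keeps the step small relative to `√(τ + ‖π - π*‖²)`.
The second-order terms then have the order `pη` of the drift, with a small constant, and only an
exponential moment of the noise is needed (`lintegral_step_le`). The moment contracts down to the
order of `(2τ)^p`, and Markov's inequality gives a failure probability of order `exp(-p) ≤ δε²`
(`exists_constants`).

For the whole run, sign symmetries of the Gaussian noises show that the errors of the Kalman filters
are orthogonal to their estimates. Hence the Kalman filter solves the normal equations of stage `h`
when the earlier filters are the Kalman filters (`crossMoment_kalman_residual`). The regressor is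
Lipschitz in the earlier filters, so filters within `a` of the Kalman filters move the stage
minimizer by at most `C a`. Errors thus grow at most geometrically over the stages, and each stage
is run to a smaller accuracy `βε` that absorbs this growth. The failure probabilities add up by a
union bound, the conditioning on earlier stages being done by resampling one coordinate of the
product measure (`measure_rhpg_le`). -/

/-! ### Resampling one coordinate of an infinite product -/

/-- Replacing one coordinate of a family of independent variables by an independent copy does not
change the law of the family. -/
theorem measurePreserving_update_infinitePi {Ω : Type*} [MeasurableSpace Ω] (μ : Measure Ω)
    [IsProbabilityMeasure μ] (k : ℕ) :
    MeasurePreserving (fun q : (ℕ → Ω) × Ω => Function.update q.1 k q.2)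
      ((Measure.infinitePi fun _ : ℕ => μ).prod μ) (Measure.infinitePi fun _ : ℕ => μ) := by
  have hmeas : Measurable (fun q : (ℕ → Ω) × Ω => Function.update q.1 k q.2) := by
    refine measurable_pi_iff.2 fun i => ?_
    by_cases hi : i = k
    · subst hi; simpa using measurable_snd
    · simp only [Function.update_of_ne hi]; fun_prop
  refine ⟨hmeas, Measure.eq_infinitePi _ fun s t ht => ?_⟩
  rw [Measure.map_apply hmeas (.pi s.countable_toSet fun i _ => ht i)]
  by_cases hk : k ∈ s
  · have : (fun q : (ℕ → Ω) × Ω => Function.update q.1 k q.2) ⁻¹' ((s : Set ℕ).pi t) =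
        (((s.erase k : Finset ℕ) : Set ℕ).pi t) ×ˢ t k := by
      ext q
      simp only [Set.mem_preimage, Set.mem_pi, Set.mem_prod, Finset.mem_coe, Finset.mem_erase]
      constructor
      · intro h
        refine ⟨fun i hi => ?_, ?_⟩
        · simpa [Function.update_of_ne hi.1] using h i hi.2
        · simpa using h k hk
      · rintro ⟨h1, h2⟩ i hi
        by_cases hik : i = k
        · subst hik; simpa using h2
        · simpa [Function.update_of_ne hik] using h1 i ⟨hik, hi⟩
    rw [this, Measure.prod_prod, Measure.infinitePi_pi _ (fun i _ => ht i),
      Finset.prod_erase_mul _ _ hk]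
  · have : (fun q : (ℕ → Ω) × Ω => Function.update q.1 k q.2) ⁻¹' ((s : Set ℕ).pi t) =
        ((s : Set ℕ).pi t) ×ˢ Set.univ := by
      ext q
      simp only [Set.mem_preimage, Set.mem_pi, Set.mem_prod, Finset.mem_coe, Set.mem_univ, and_true]
      refine forall₂_congr fun i hi => ?_
      rw [Function.update_of_ne (by rintro rfl; exact hk hi)]
    rw [this, Measure.prod_prod, Measure.infinitePi_pi _ (fun i _ => ht i), measure_univ, mul_one]

/-- Fubini for a function of one coordinate and of a variable not depending on it. -/
theorem lintegral_infinitePi_resample {Ω α : Type*} [MeasurableSpace Ω] [MeasurableSpace α]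
    (μ : Measure Ω) [IsProbabilityMeasure μ] (k : ℕ) {X : (ℕ → Ω) → α} (hX : Measurable X)
    (hXk : ∀ s y, X (Function.update s k y) = X s) {f : α → Ω → ENNReal}
    (hf : Measurable (Function.uncurry f)) :
    ∫⁻ s, f (X s) (s k) ∂(Measure.infinitePi fun _ : ℕ => μ) =
      ∫⁻ s, ∫⁻ y, f (X s) y ∂μ ∂(Measure.infinitePi fun _ : ℕ => μ) := by
  have hm : Measurable fun s : ℕ → Ω => f (X s) (s k) :=
    hf.comp (hX.prodMk (measurable_pi_apply k))
  -- Under the resampling map, `X s` stays unchanged by `hXk` and `s k` becomes the independent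
  -- copy, so Tonelli separates the two.
  rw [← (measurePreserving_update_infinitePi μ k).lintegral_comp hm,
    lintegral_prod _ (by
      exact (hm.comp (measurePreserving_update_infinitePi μ k).measurable).aemeasurable)]
  simp [hXk]

/-! ### High moments of the one-step error -/

/-- A Taylor bound that keeps the linear term exact, because that term carries the drift. In the
induction, multiplication by `t` creates the extra term `p (t - 1)²`, which fits into the gap `(p +
1)² - p² = 2p + 1`. -/
theorem pow_le_one_add_mul_add_sq {t : ℝ} (ht : 0 ≤ t) (p : ℕ) :
    t ^ p ≤ 1 + p * (t - 1) + p ^ 2 * (t - 1) ^ 2 * (max 1 t) ^ p := by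
  induction p with
  | zero => simp
  | succ p ih =>
    have hM : 1 ≤ max 1 t := le_max_left _ _
    have htM : t ≤ max 1 t := le_max_right _ _
    set M := max 1 t
    have hMp : 1 ≤ M ^ p := one_le_pow₀ hM
    have hMp1 : 1 ≤ M ^ (p + 1) := one_le_pow₀ hM
    have h1 : t ^ (p + 1) ≤ t * (1 + p * (t - 1) + p ^ 2 * (t - 1) ^ 2 * M ^ p) := by
      rw [pow_succ, mul_comm]
      exact mul_le_mul_of_nonneg_left ih ht
    have h2 : t * (p ^ 2 * (t - 1) ^ 2 * M ^ p) ≤ p ^ 2 * (t - 1) ^ 2 * M ^ (p + 1) := by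
      calc t * ((p : ℝ) ^ 2 * (t - 1) ^ 2 * M ^ p) = p ^ 2 * (t - 1) ^ 2 * (M ^ p * t) := by ring
        _ ≤ p ^ 2 * (t - 1) ^ 2 * (M ^ p * M) := by gcongr
        _ = _ := by ring
    have h3 : (p : ℝ) * (t - 1) ^ 2 ≤ (2 * p + 1) * (t - 1) ^ 2 * M ^ (p + 1) := by
      have : 0 ≤ (t - 1) ^ 2 := sq_nonneg _
      have hp : (0 : ℝ) ≤ p := Nat.cast_nonneg p
      calc (p : ℝ) * (t - 1) ^ 2 ≤ (2 * p + 1) * (t - 1) ^ 2 * 1 := by nlinarith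
        _ ≤ _ := by gcongr
    push_cast
    nlinarith

/-- A second-order expansion of `‖·‖ ^ (2 * p)` for the regularized norm, in scalar form: `N` is the
regularized norm, `b` the inner product with the step and `G` the length of the step. -/
theorem ratio_pow_le {N b G D w : ℝ} (hN : 0 < N) (hDN : D ≤ N) (hG : 0 ≤ G)
    (hb : |b| ≤ D * G) (hw : G / N ≤ w)
    {p : ℕ} (hp : 1 ≤ p) (hnn : 0 ≤ N ^ 2 - 2 * b + G ^ 2) :
    ((N ^ 2 - 2 * b + G ^ 2) / N ^ 2) ^ p ≤
      1 - 2 * p * b / N ^ 2 + p * w ^ 2 + 4 * p ^ 2 * w ^ 2 * Real.exp (4 * p * w) := by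
  have hN2 : 0 < N ^ 2 := by positivity
  have hw0 : 0 ≤ w := le_trans (by positivity) hw
  have hGw : G ≤ w * N := by rwa [div_le_iff₀ hN] at hw
  set t := (N ^ 2 - 2 * b + G ^ 2) / N ^ 2 with ht
  have ht0 : 0 ≤ t := by positivity
  have hbN : |b| ≤ w * N ^ 2 := by
    calc |b| ≤ D * G := hb
      _ ≤ N * (w * N) := by gcongr
      _ = _ := by ring
  have hG2 : G ^ 2 ≤ w ^ 2 * N ^ 2 := by rw [← mul_pow]; gcongr
  have ht1 : t - 1 = -2 * b / N ^ 2 + G ^ 2 / N ^ 2 := by rw [ht]; field_simp; ring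
  have hbN' : |b / N ^ 2| ≤ w := by
    rw [abs_div, abs_of_pos hN2, div_le_iff₀ hN2]; exact hbN
  have hGN' : G ^ 2 / N ^ 2 ≤ w ^ 2 := by rw [div_le_iff₀ hN2]; exact hG2
  have hGN0 : 0 ≤ G ^ 2 / N ^ 2 := by positivity
  have habs : |t - 1| ≤ 2 * w * (1 + w) := by
    rw [ht1, show -2 * b / N ^ 2 = -2 * (b / N ^ 2) by ring]
    rw [abs_le] at hbN' ⊢
    constructor <;> nlinarith
  have hsq : (t - 1) ^ 2 ≤ 4 * w ^ 2 * (1 + w) ^ 2 := by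
    have := pow_le_pow_left₀ (abs_nonneg _) habs 2
    rw [sq_abs] at this
    nlinarith
  have htw : max 1 t ≤ (1 + w) ^ 2 := by
    refine max_le (by nlinarith) ?_
    have := (abs_le.1 hbN').1
    have h5 : t = 1 + (-2 * (b / N ^ 2) + G ^ 2 / N ^ 2) := by linear_combination ht1
    nlinarith
  -- One factor `(1 + w)²` comes from `(t - 1)²`, the other power from `(max 1 t)^p`. The exponents
  -- combine through `2 + 2p ≤ 4p`, which uses `1 ≤ p`.
  have hexp : (1 + w) ^ 2 * ((1 + w) ^ 2) ^ p ≤ Real.exp (4 * p * w) := by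
    have h1 : 1 + w ≤ Real.exp w := by linarith [Real.add_one_le_exp w]
    calc (1 + w) ^ 2 * ((1 + w) ^ 2) ^ p = (1 + w) ^ (2 + 2 * p) := by
          rw [← pow_mul, ← pow_add]
      _ ≤ (1 + w) ^ (4 * p) := by
          apply pow_le_pow_right₀ (by linarith); omega
      _ ≤ (Real.exp w) ^ (4 * p) := by gcongr
      _ = _ := by rw [← Real.exp_nat_mul]; push_cast; ring_nf
  calc t ^ p ≤ 1 + p * (t - 1) + p ^ 2 * (t - 1) ^ 2 * (max 1 t) ^ p :=
        pow_le_one_add_mul_add_sq ht0 p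
    _ ≤ 1 + p * (-2 * b / N ^ 2 + w ^ 2) +
        p ^ 2 * (4 * w ^ 2 * (1 + w) ^ 2) * ((1 + w) ^ 2) ^ p := by
        rw [ht1] at hsq ⊢
        gcongr
    _ = 1 - 2 * p * b / N ^ 2 + p * w ^ 2 +
        4 * p ^ 2 * w ^ 2 * ((1 + w) ^ 2 * ((1 + w) ^ 2) ^ p) := by ring
    _ ≤ _ := by gcongr

/-- The assumptions on a stochastic gradient oracle `g` for a target `xs`: a linear growth bound with
a random constant `Y` having some exponential moment, and strong monotonicity of its mean. -/
structure IsGradientOracle {E Ω : Type*} [NormedAddCommGroup E] [InnerProductSpace ℝ E]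
    [MeasurableSpace E] [MeasurableSpace Ω] (P : Measure Ω) (g : E → Ω → E) (xs : E)
    (Y : Ω → ℝ) (s B μ : ℝ) : Prop where
  measurable : Measurable (Function.uncurry g)
  measurable_bound : Measurable Y
  bound_nonneg : ∀ ω, 0 ≤ Y ω
  norm_le : ∀ x ω, ‖g x ω‖ ≤ (1 + ‖x - xs‖) * Y ω
  integrable_exp : Integrable (fun ω => Y ω ^ 2 * Real.exp (s * Y ω)) P
  integral_exp_le : ∫ ω, Y ω ^ 2 * Real.exp (s * Y ω) ∂P ≤ B
  monotone : ∀ x, μ * ‖x - xs‖ ^ 2 ≤ ∫ ω, inner ℝ (x - xs) (g x ω) ∂P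

/-! ### Stochastic gradient descent: moment recursion and tail bound. -/

namespace IsGradientOracle

variable {E Ω : Type*} [NormedAddCommGroup E] [InnerProductSpace ℝ E]
    [MeasurableSpace E] [MeasurableSpace Ω]
    {P : Measure Ω} {g : E → Ω → E} {xs : E} {Y : Ω → ℝ} {s B μ : ℝ}

theorem integrable_sq (h : IsGradientOracle P g xs Y s B μ) (hs : 0 ≤ s) :
    Integrable (fun ω => Y ω ^ 2) P := by
  refine h.integrable_exp.mono (h.measurable_bound.pow_const 2).aestronglyMeasurable
    (.of_forall fun ω => ?_)
  rw [Real.norm_of_nonneg (sq_nonneg _),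
    Real.norm_of_nonneg (mul_nonneg (sq_nonneg _) (Real.exp_pos _).le)]
  exact le_mul_of_one_le_right (sq_nonneg _)
    (Real.one_le_exp (mul_nonneg hs (h.bound_nonneg ω)))

theorem measurable_right (h : IsGradientOracle P g xs Y s B μ) (x : E) : Measurable (g x) :=
  h.measurable.comp measurable_prodMk_left

variable [BorelSpace E] [SecondCountableTopology E] [IsProbabilityMeasure P]

theorem integrable_inner (h : IsGradientOracle P g xs Y s B μ) (hs : 0 ≤ s) (x : E) :
    Integrable (fun ω => (inner ℝ (x - xs) (g x ω) : ℝ)) P := by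
  have hY : Integrable Y P := by
    refine Integrable.mono' ((integrable_const (1 : ℝ)).add (h.integrable_sq hs))
      h.measurable_bound.aestronglyMeasurable (.of_forall fun ω => ?_)
    rw [Real.norm_of_nonneg (h.bound_nonneg ω)]
    simp only [Pi.add_apply]
    nlinarith [sq_nonneg (Y ω - 1), h.bound_nonneg ω]
  refine Integrable.mono' (hY.const_mul (‖x - xs‖ * (1 + ‖x - xs‖)))
    ((h.measurable_right x).const_inner).aestronglyMeasurable (.of_forall fun ω => ?_)
  calc ‖(inner ℝ (x - xs) (g x ω) : ℝ)‖ ≤ ‖x - xs‖ * ‖g x ω‖ := norm_inner_le_norm _ _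
    _ ≤ ‖x - xs‖ * ((1 + ‖x - xs‖) * Y ω) := by gcongr; exact h.norm_le x ω
    _ = _ := by ring

/-- One step of stochastic gradient descent contracts the `p`-th moment of the regularized squared
distance, up to a term of the order of the regularization. -/
theorem lintegral_step_le (h : IsGradientOracle P g xs Y s B μ) (hs : 0 < s) (hμ : 0 < μ)
    {κ η : ℝ} {p : ℕ} (hκ1 : 1 ≤ κ) (hκ : 40 * B ≤ κ * μ) (hp : 1 ≤ p) (hη : 0 < η)
    (hτ : κ * (p * η) ≤ 1) (hsmall : 64 * (p * η) ≤ s ^ 2) (hμp : p * η * μ ≤ 2) (x : E) :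
    ∫⁻ ω, ENNReal.ofReal ((κ * (p * η) + ‖x - η • g x ω - xs‖ ^ 2) ^ p) ∂P ≤
      ENNReal.ofReal (1 - p * η * μ / 2) *
        ENNReal.ofReal ((κ * (p * η) + ‖x - xs‖ ^ 2) ^ p) +
      ENNReal.ofReal (p * η * μ * (2 * (κ * (p * η))) ^ p) := by
  have hp' : (1 : ℝ) ≤ p := by exact_mod_cast hp
  have hpη : 0 < p * η := by positivity
  set τ := κ * (p * η) with hτdef
  have hκ0 : 0 < κ := by linarith
  have hτ0 : 0 < τ := by positivity
  set V := ‖x - xs‖ ^ 2 with hV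
  set N := Real.sqrt (τ + V) with hN
  have hV0 : 0 ≤ V := sq_nonneg _
  have hNsq : N ^ 2 = τ + V := Real.sq_sqrt (by positivity)
  have hN0 : 0 < N := Real.sqrt_pos.2 (by positivity)
  have hDN : ‖x - xs‖ ≤ N := Real.le_sqrt_of_sq_le (by linarith)
  have hτN : Real.sqrt τ ≤ N := Real.sqrt_le_sqrt (by linarith)
  have hsτ : 0 < Real.sqrt τ := Real.sqrt_pos.2 hτ0
  have hsτ1 : Real.sqrt τ ≤ 1 := Real.sqrt_le_one.2 hτ
  have hsτsq : Real.sqrt τ ^ 2 = τ := Real.sq_sqrt hτ0.le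
  -- A bound on the step length relative to `N` that is free of `x`: since `√τ ≤ N` and `√τ ≤ 1`,
  -- one has `(1 + ‖x - xs‖) √τ ≤ 2N`, so the linear growth of the oracle is absorbed.
  set w : Ω → ℝ := fun ω => 2 * η * Y ω / Real.sqrt τ with hw
  have hwpt : ∀ ω, η * ‖g x ω‖ / N ≤ w ω := by
    intro ω
    rw [div_le_div_iff₀ hN0 hsτ]
    have h1 : (1 + ‖x - xs‖) * Real.sqrt τ ≤ 2 * N := by
      nlinarith [norm_nonneg (x - xs)]
    calc η * ‖g x ω‖ * Real.sqrt τ ≤ η * ((1 + ‖x - xs‖) * Y ω) * Real.sqrt τ := by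
          gcongr; exact h.norm_le x ω
      _ = η * Y ω * ((1 + ‖x - xs‖) * Real.sqrt τ) := by ring
      _ ≤ η * Y ω * (2 * N) := by
          have := h.bound_nonneg ω
          gcongr
      _ = _ := by ring
  have hnorm : ∀ ω, τ + ‖x - η • g x ω - xs‖ ^ 2 =
      N ^ 2 - 2 * (η * inner ℝ (x - xs) (g x ω)) + (η * ‖g x ω‖) ^ 2 := by
    intro ω
    rw [show x - η • g x ω - xs = (x - xs) - η • g x ω by abel, norm_sub_sq_real, hNsq,
      inner_smul_right, norm_smul, Real.norm_of_nonneg hη.le]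
    ring
  -- As `τ` is proportional to `p * η`, the second-order term `p² w²` is of order `pη Y²/κ`. This is
  -- the order of the drift `pημ`, and a large `κ` makes it smaller.
  have hw2 : ∀ ω, w ω ^ 2 = 4 * η / (κ * p) * Y ω ^ 2 := by
    intro ω
    simp only [hw]
    rw [div_pow, hsτsq, hτdef]
    field_simp
    ring
  -- Here `κ ≥ 1` gives `τ ≥ pη`, so `4 p w ≤ 8 √(pη) Y`, and `hsmall` says `8 √(pη) ≤ s`.
  have hexpw : ∀ ω, 4 * p * w ω ≤ s * Y ω := by
    intro ω
    have h1 : 8 * (p * η) ≤ s * Real.sqrt τ := by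
      apply le_of_sq_le_sq _ (by positivity)
      calc (8 * (p * η)) ^ 2 = 64 * (p * η) * (1 * (p * η)) := by ring
        _ ≤ s ^ 2 * (κ * (p * η)) := by gcongr
        _ = (s * Real.sqrt τ) ^ 2 := by rw [mul_pow s, hsτsq, hτdef]
    simp only [hw]
    rw [← mul_div_assoc, div_le_iff₀ hsτ]
    nlinarith [h.bound_nonneg ω]
  -- The constant 20 is 4 from `p w²` plus 16 from `4 p² w² exp(4 p w)`.
  have hpt : ∀ ω, (τ + ‖x - η • g x ω - xs‖ ^ 2) ^ p ≤
      (τ + V) ^ p * (1 - 2 * (p * η) / N ^ 2 * inner ℝ (x - xs) (g x ω) +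
        20 * (p * η) / κ * (Y ω ^ 2 * Real.exp (s * Y ω))) := by
    intro ω
    have hr := ratio_pow_le (N := N) (b := η * inner ℝ (x - xs) (g x ω)) (G := η * ‖g x ω‖)
      (D := ‖x - xs‖) (w := w ω) hN0 hDN (by positivity)
      (by rw [abs_mul, abs_of_pos hη]
          calc η * |inner ℝ (x - xs) (g x ω)| ≤ η * (‖x - xs‖ * ‖g x ω‖) := by
                gcongr; exact abs_real_inner_le_norm _ _
            _ = _ := by ring) (hwpt ω) hp (by rw [← hnorm]; positivity)
    rw [← hnorm, div_pow, div_le_iff₀ (by positivity), hNsq] at hr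
    refine hr.trans ?_
    rw [mul_comm]
    rw [hNsq]
    refine mul_le_mul_of_nonneg_left ?_ (by positivity)
    have he1 : 1 ≤ Real.exp (s * Y ω) :=
      Real.one_le_exp (mul_nonneg hs.le (h.bound_nonneg ω))
    have he2 : Real.exp (4 * p * w ω) ≤ Real.exp (s * Y ω) := Real.exp_le_exp.2 (hexpw ω)
    have hY2 := sq_nonneg (Y ω)
    have e1 : (p : ℝ) * w ω ^ 2 ≤ 4 * (p * η) / κ * (Y ω ^ 2 * Real.exp (s * Y ω)) := by
      rw [hw2]
      calc (p : ℝ) * (4 * η / (κ * p) * Y ω ^ 2) = 4 * (1 * η) / κ * (Y ω ^ 2 * 1) := by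
            field_simp
        _ ≤ _ := by gcongr
    have e2 : 4 * (p : ℝ) ^ 2 * w ω ^ 2 * Real.exp (4 * p * w ω) ≤
        16 * (p * η) / κ * (Y ω ^ 2 * Real.exp (s * Y ω)) := by
      rw [hw2]
      calc 4 * (p : ℝ) ^ 2 * (4 * η / (κ * p) * Y ω ^ 2) * Real.exp (4 * p * w ω) =
            16 * (p * η) / κ * (Y ω ^ 2 * Real.exp (4 * p * w ω)) := by
            field_simp; ring
        _ ≤ _ := by gcongr
    have e3 : 2 * (p : ℝ) * (η * inner ℝ (x - xs) (g x ω)) / (τ + V) =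
        2 * (p * η) / (τ + V) * inner ℝ (x - xs) (g x ω) := by ring
    rw [e3]
    have e4 : 20 * (p * η) / κ * (Y ω ^ 2 * Real.exp (s * Y ω)) =
      4 * (p * η) / κ * (Y ω ^ 2 * Real.exp (s * Y ω)) +
      16 * (p * η) / κ * (Y ω ^ 2 * Real.exp (s * Y ω)) := by ring
    linarith
  have hint1 : Integrable (fun ω => 1 - 2 * (p * η) / N ^ 2 * inner ℝ (x - xs) (g x ω)) P :=
    (integrable_const 1).sub ((h.integrable_inner hs.le x).const_mul _)
  have hint2 : Integrable (fun ω => 20 * (p * η) / κ * (Y ω ^ 2 * Real.exp (s * Y ω))) P :=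
    h.integrable_exp.const_mul _
  have hint := (hint1.add hint2).const_mul ((τ + V) ^ p)
  calc ∫⁻ ω, ENNReal.ofReal ((τ + ‖x - η • g x ω - xs‖ ^ 2) ^ p) ∂P
      ≤ ∫⁻ ω, ENNReal.ofReal ((τ + V) ^ p *
          (1 - 2 * (p * η) / N ^ 2 * inner ℝ (x - xs) (g x ω) +
        20 * (p * η) / κ * (Y ω ^ 2 * Real.exp (s * Y ω)))) ∂P :=
        lintegral_mono fun ω => ENNReal.ofReal_le_ofReal (hpt ω)
    _ = ENNReal.ofReal (∫ ω, (τ + V) ^ p *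
          (1 - 2 * (p * η) / N ^ 2 * inner ℝ (x - xs) (g x ω) +
        20 * (p * η) / κ * (Y ω ^ 2 * Real.exp (s * Y ω))) ∂P) :=
        (ofReal_integral_eq_lintegral_ofReal hint
          (.of_forall fun ω => le_trans (by positivity) (hpt ω))).symm
    _ ≤ ENNReal.ofReal ((1 - p * η * μ / 2) * (τ + V) ^ p + p * η * μ * (2 * τ) ^ p) := by
        apply ENNReal.ofReal_le_ofReal
        rw [integral_const_mul, integral_add hint1 hint2, integral_sub (integrable_const 1)
          ((h.integrable_inner hs.le x).const_mul _), integral_const_mul, integral_const_mul]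
        simp only [integral_const, probReal_univ, smul_eq_mul, one_mul]
        have hA : 0 ≤ (τ + V) ^ p := by positivity
        -- The condition `40 * B ≤ κ * μ` limits the noise to a quarter of the full drift `2pημ`.
        have i1 : 20 * (p * η) / κ * ∫ ω, Y ω ^ 2 * Real.exp (s * Y ω) ∂P ≤ p * η * μ / 2 := by
          calc 20 * (p * η) / κ * ∫ ω, Y ω ^ 2 * Real.exp (s * Y ω) ∂P
              ≤ 20 * (p * η) / κ * B := by gcongr; exact h.integral_exp_le
            _ ≤ p * η * μ / 2 := by
              rw [div_mul_eq_mul_div, div_le_iff₀ hκ0]; nlinarith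
        have i2 : 2 * (p * η) / N ^ 2 * (μ * V) ≤
            2 * (p * η) / N ^ 2 * ∫ ω, inner ℝ (x - xs) (g x ω) ∂P := by
          gcongr; exact h.monotone x
        rw [hNsq] at i2 ⊢
        have hq0 : 0 ≤ V / (τ + V) := by positivity
        have i3 : 2 * (p * η) / (τ + V) * (μ * V) = 2 * (p * η * μ) * (V / (τ + V)) := by ring
        rw [i3] at i2
        have ha : 0 < p * η * μ := by positivity
        -- Far from the target, `V/(τ + V) ≥ 1/2`: the drift is at least `pημ` and beats the noise
        -- `pημ/2`. Near the target, the moment is at most `(2τ)^p` and its possible growth is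
        -- charged to the additive term.
        by_cases hVτ : τ ≤ V
        · have hq : 1 / 2 ≤ V / (τ + V) := by
            rw [div_le_div_iff₀ (by norm_num) (by positivity)]; linarith
          have h2 : 0 ≤ p * η * μ * (2 * τ) ^ p := by positivity
          have h3 : (1 - 2 * (p * η) / (τ + V) * ∫ ω, inner ℝ (x - xs) (g x ω) ∂P +
              20 * (p * η) / κ * ∫ ω, Y ω ^ 2 * Real.exp (s * Y ω) ∂P) ≤ 1 - p * η * μ / 2 := by
            nlinarith
          calc _ ≤ (τ + V) ^ p * (1 - p * η * μ / 2) := mul_le_mul_of_nonneg_left h3 hA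
            _ ≤ _ := by linarith
        · have h1 : (τ + V) ^ p ≤ (2 * τ) ^ p := by
            apply pow_le_pow_left₀ (by positivity); linarith
          have h3 : (1 - 2 * (p * η) / (τ + V) * ∫ ω, inner ℝ (x - xs) (g x ω) ∂P +
              20 * (p * η) / κ * ∫ ω, Y ω ^ 2 * Real.exp (s * Y ω) ∂P) ≤ 1 + p * η * μ / 2 := by
            nlinarith
          calc _ ≤ (τ + V) ^ p * (1 + p * η * μ / 2) := mul_le_mul_of_nonneg_left h3 hA
            _ = (1 - p * η * μ / 2) * (τ + V) ^ p + p * η * μ * (τ + V) ^ p := by ring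
            _ ≤ _ := by gcongr
    _ = _ := by
        rw [ENNReal.ofReal_add (mul_nonneg (by linarith) (by positivity)) (by positivity),
          ENNReal.ofReal_mul (by linarith)]

/-- Moment bound for the iterates of stochastic gradient descent. -/
theorem lintegral_iterate_le (h : IsGradientOracle P g xs Y s B μ) (hs : 0 < s) (hμ : 0 < μ)
    {κ η : ℝ} {p : ℕ} (hκ1 : 1 ≤ κ) (hκ : 40 * B ≤ κ * μ) (hp : 1 ≤ p) (hη : 0 < η)
    (hτ : κ * (p * η) ≤ 1) (hsmall : 64 * (p * η) ≤ s ^ 2) (hμp : p * η * μ ≤ 2)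
    {x₀ : E} {X : ℕ → (ℕ → Ω) → E} (hX0 : ∀ ω, X 0 ω = x₀)
    (hX : ∀ k ω, X (k + 1) ω = X k ω - η • g (X k ω) (ω k)) (T : ℕ) :
    ∫⁻ ω, ENNReal.ofReal ((κ * (p * η) + ‖X T ω - xs‖ ^ 2) ^ p)
        ∂(Measure.infinitePi fun _ : ℕ => P) ≤
      ENNReal.ofReal ((1 - p * η * μ / 2) ^ T * (κ * (p * η) + ‖x₀ - xs‖ ^ 2) ^ p +
        2 * (2 * (κ * (p * η))) ^ p) := by
  have hmeas : ∀ k, Measurable (X k) := by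
    intro k
    induction k with
    | zero => rw [show X 0 = fun _ => x₀ from funext hX0]; exact measurable_const
    | succ k ih =>
      rw [show X (k + 1) = fun ω => X k ω - η • g (X k ω) (ω k) from funext (hX k)]
      exact ih.sub ((h.measurable.comp (ih.prodMk (measurable_pi_apply k))).const_smul η)
  -- The iterate `X k` uses only the samples with index below `k`, so sample `k` may be resampled
  -- independently of it.
  have hdep : ∀ k j, k ≤ j → ∀ ω y, X k (Function.update ω j y) = X k ω := by
    intro k
    induction k with
    | zero => intro j _ ω y; rw [hX0, hX0]
    | succ k ih =>
      intro j hj ω y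
      rw [hX, hX, ih j (by omega), Function.update_of_ne (by omega)]
  have hpη : 0 < p * η := by positivity
  set τ := κ * (p * η) with hτdef
  have hκ0 : 0 < κ := by linarith
  have hτ0 : 0 < τ := by positivity
  induction T with
  | zero =>
    simp only [hX0, lintegral_const, measure_univ, mul_one, pow_zero, one_mul]
    apply ENNReal.ofReal_le_ofReal
    have : 0 ≤ 2 * (2 * τ) ^ p := by positivity
    linarith
  | succ k ih =>
    have ha : 0 ≤ 1 - p * η * μ / 2 := by linarith
    simp only [hX]
    rw [lintegral_infinitePi_resample P k (hmeas k) (hdep k k le_rfl)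
      (f := fun x y => ENNReal.ofReal ((τ + ‖x - η • g x y - xs‖ ^ 2) ^ p)) (by
        have hg := h.measurable
        have : Measurable fun q : E × Ω => g q.1 q.2 := hg
        refine ENNReal.measurable_ofReal.comp ?_
        exact (measurable_const.add ((((measurable_fst.sub (this.const_smul η)).sub_const
          xs).norm).pow_const 2)).pow_const p)]
    calc _ ≤ ∫⁻ ω, (ENNReal.ofReal (1 - p * η * μ / 2) *
          ENNReal.ofReal ((τ + ‖X k ω - xs‖ ^ 2) ^ p) +
          ENNReal.ofReal (p * η * μ * (2 * τ) ^ p)) ∂(Measure.infinitePi fun _ : ℕ => P) :=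
          lintegral_mono fun ω =>
            h.lintegral_step_le hs hμ hκ1 hκ hp hη hτ hsmall hμp (X k ω)
      _ = ENNReal.ofReal (1 - p * η * μ / 2) *
          (∫⁻ ω, ENNReal.ofReal ((τ + ‖X k ω - xs‖ ^ 2) ^ p)
            ∂(Measure.infinitePi fun _ : ℕ => P)) +
          ENNReal.ofReal (p * η * μ * (2 * τ) ^ p) := by
          rw [lintegral_add_right _ measurable_const, lintegral_const_mul' _ _ (by simp),
            lintegral_const, measure_univ, mul_one]
      _ ≤ ENNReal.ofReal (1 - p * η * μ / 2) * ENNReal.ofReal ((1 - p * η * μ / 2) ^ k *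
          (τ + ‖x₀ - xs‖ ^ 2) ^ p + 2 * (2 * τ) ^ p) +
          ENNReal.ofReal (p * η * μ * (2 * τ) ^ p) := by gcongr
      -- The constant `2 (2τ)^p` is the fixed point of the recursion: with `a = pημ/2`, `(1 - a) ·
      -- 2(2τ)^p + 2a (2τ)^p = 2(2τ)^p`.
      _ = _ := by
          rw [← ENNReal.ofReal_mul ha, ← ENNReal.ofReal_add
            (mul_nonneg ha (by positivity)) (by positivity)]
          congr 1
          ring

/-- Markov's inequality for the last iterate of stochastic gradient descent. -/
theorem measureReal_norm_gt_le (h : IsGradientOracle P g xs Y s B μ) (hs : 0 < s) (hμ : 0 < μ)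
    {κ η : ℝ} {p : ℕ} (hκ1 : 1 ≤ κ) (hκ : 40 * B ≤ κ * μ) (hp : 1 ≤ p) (hη : 0 < η)
    (hτ : κ * (p * η) ≤ 1) (hsmall : 64 * (p * η) ≤ s ^ 2) (hμp : p * η * μ ≤ 2)
    {x₀ : E} {X : ℕ → (ℕ → Ω) → E} (hX0 : ∀ ω, X 0 ω = x₀)
    (hX : ∀ k ω, X (k + 1) ω = X k ω - η • g (X k ω) (ω k)) (T : ℕ) {ε : ℝ} (hε : 0 < ε) :
    (Measure.infinitePi fun _ : ℕ => P).real {ω | ε < ‖X T ω - xs‖} ≤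
      ((1 - p * η * μ / 2) ^ T * (κ * (p * η) + ‖x₀ - xs‖ ^ 2) ^ p +
        2 * (2 * (κ * (p * η))) ^ p) / (ε ^ 2) ^ p := by
  have hτ0 : 0 ≤ κ * (p * η) := by positivity
  have hA : 0 ≤ (1 - p * η * μ / 2) ^ T * (κ * (p * η) + ‖x₀ - xs‖ ^ 2) ^ p +
        2 * (2 * (κ * (p * η))) ^ p := by
    have : 0 ≤ 1 - p * η * μ / 2 := by linarith
    positivity
  have hε2 : 0 < (ε ^ 2) ^ p := by positivity
  refine ENNReal.toReal_le_of_le_ofReal (by positivity) ?_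
  rw [ENNReal.ofReal_div_of_pos hε2, ENNReal.le_div_iff_mul_le (by simp [hε2])
    (by simp), mul_comm]
  refine le_trans ?_ (h.lintegral_iterate_le hs hμ hκ1 hκ hp hη hτ hsmall hμp hX0 hX T)
  refine le_trans (mul_le_mul_right (measure_mono ?_) _) (mul_meas_ge_le_lintegral₀ ?_ _)
  · intro ω hω
    simp only [Set.mem_ofPred_eq] at hω ⊢
    apply ENNReal.ofReal_le_ofReal
    apply pow_le_pow_left₀ (by positivity)
    have := pow_le_pow_left₀ hε.le hω.le 2
    linarith
  · have hmeas : ∀ k, Measurable (X k) := by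
      intro k
      induction k with
      | zero => rw [show X 0 = fun _ => x₀ from funext hX0]; exact measurable_const
      | succ k ih =>
        rw [show X (k + 1) = fun ω => X k ω - η • g (X k ω) (ω k) from funext (hX k)]
        exact ih.sub ((h.measurable.comp (ih.prodMk (measurable_pi_apply k))).const_smul η)
    exact (ENNReal.measurable_ofReal.comp ((measurable_const.add
      (((hmeas T).sub_const xs).norm.pow_const 2)).pow_const p)).aemeasurable

end IsGradientOracle

/-! ### Choice of stepsize, moment order and number of iterations. -/

namespace IsGradientOracle

set_option maxHeartbeats 1000000 in
/-- Stochastic gradient descent with stepsize `c * ε ^ 2 / log (1 / (δ * ε ^ 2))` reaches accuracy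
`β * ε` with probability `1 - δ`, with constants that are uniform over all oracles. -/
theorem exists_constants {E Ω : Type*} [NormedAddCommGroup E] [InnerProductSpace ℝ E]
    [MeasurableSpace E] [BorelSpace E] [SecondCountableTopology E] [MeasurableSpace Ω]
    (P : Measure Ω) [IsProbabilityMeasure P] {s B μ D β : ℝ} (hs : 0 < s) (hμ : 0 < μ)
    (hB : 0 ≤ B) (hD : 0 ≤ D) (hβ : 0 < β) (hβ1 : β ≤ 1) :
    ∃ c₀ : ℝ, 0 < c₀ ∧ ∀ c : ℝ, 0 < c → c ≤ c₀ → ∃ K : ℝ, 0 < K ∧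
      ∀ (g : E → Ω → E) (xs x₀ : E) (Y : Ω → ℝ), IsGradientOracle P g xs Y s B μ →
      ‖x₀ - xs‖ ^ 2 ≤ D → ∀ X : ℕ → (ℕ → Ω) → E, (∀ ω, X 0 ω = x₀) → ∀ ε δ : ℝ,
      (∀ k ω, X (k + 1) ω =
        X k ω - (c * ε ^ 2 / Real.log (1 / (δ * ε ^ 2))) • g (X k ω) (ω k)) →
      0 < ε → ε ≤ 1 / 2 → 0 < δ → δ < 1 →
      ∀ T : ℕ, K / ε ^ 2 * Real.log (1 / (δ * ε ^ 2)) * Real.log (1 / ε) ≤ (T : ℝ) →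
        (Measure.infinitePi fun _ : ℕ => P).real {ω | β * ε < ‖X T ω - xs‖} ≤ δ := by
  set κ : ℝ := 1 + 40 * B / μ with hκ
  have hκ1 : 1 ≤ κ := by
    have : 0 ≤ 40 * B / μ := by positivity
    linarith
  have hκB : 40 * B ≤ κ * μ := by
    rw [hκ, add_mul, div_mul_cancel₀ _ hμ.ne']; linarith
  -- Chosen so that `exp(-x) (1 + D) = e⁻¹ β²`: a contraction by `exp(-(x + 2 log(1/ε)))` brings the
  -- initial error to the target level.
  set x : ℝ := 1 + Real.log ((1 + D) / β ^ 2) with hx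
  have hx1 : 1 ≤ x := by
    have : 0 ≤ Real.log ((1 + D) / β ^ 2) := by
      apply Real.log_nonneg
      rw [le_div_iff₀ (by positivity)]
      nlinarith
    linarith
  -- The three bounds on `c` yield, in this order, `64pη ≤ s²`, `pημ ≤ 2` and `2κpη ≤ e⁻¹ (βε)²`,
  -- all through `pη ≤ 2cε²`.
  refine ⟨min (s ^ 2 / 128) (min (1 / μ) (β ^ 2 * Real.exp (-1) / (4 * κ))), by positivity,
    fun c hc hcle => ⟨2 / (μ * c) * (2 * x + 2), by positivity, ?_⟩⟩
  have hc1 : c ≤ s ^ 2 / 128 := hcle.trans (min_le_left _ _)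
  have hc2 : c ≤ 1 / μ := hcle.trans ((min_le_right _ _).trans (min_le_left _ _))
  have hc3 : c ≤ β ^ 2 * Real.exp (-1) / (4 * κ) :=
    hcle.trans ((min_le_right _ _).trans (min_le_right _ _))
  intro g xs x₀ Y h hx₀ X hX0 ε δ hX hε hε2 hδ hδ1 T hT
  set l := Real.log (1 / (δ * ε ^ 2)) with hl
  set η := c * ε ^ 2 / l with hη
  have hεsq : ε ^ 2 ≤ 1 / 4 := by nlinarith
  have hεsq0 : 0 < ε ^ 2 := by positivity
  have hδε : δ * ε ^ 2 ≤ δ / 4 := by nlinarith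
  have hδε0 : 0 < δ * ε ^ 2 := by positivity
  have hexpl : Real.exp (-l) = δ * ε ^ 2 := by
    rw [hl, one_div, Real.log_inv, neg_neg, Real.exp_log hδε0]
  -- Since `δε² < 1/4 < e⁻¹`, the logarithm is at least 1, so rounding it up at most doubles it.
  have hl1 : 1 ≤ l := by
    rw [hl, Real.le_log_iff_exp_le (by positivity), le_div_iff₀ hδε0]
    have := Real.exp_one_lt_d9
    nlinarith
  -- The order of the moment: large enough for `exp(-p) ≤ δε²`, yet `pη` remains at most `2cε²`
  -- because `η` contains the factor `1/l`.
  set p := ⌈l⌉₊ with hp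
  have hlp : l ≤ p := Nat.le_ceil l
  have hpl : (p : ℝ) ≤ 2 * l := by
    have := Nat.ceil_lt_add_one (by linarith : 0 ≤ l)
    linarith
  have hp1 : 1 ≤ p := by
    have : (1 : ℝ) ≤ p := hl1.trans hlp
    exact_mod_cast this
  have hl0 : 0 < l := by linarith
  have hη0 : 0 < η := by positivity
  have hpη : p * η ≤ 2 * (c * ε ^ 2) := by
    calc p * η ≤ 2 * l * η := by gcongr
      _ = _ := by rw [hη]; field_simp
  have hpηc : p * η ≤ 2 * c := by nlinarith
  have hκ0 : 0 < κ := by linarith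
  have he1 : Real.exp (-1) ≤ 1 := Real.exp_le_one_iff.2 (by norm_num)
  have hτ2 : 2 * (κ * (p * η)) ≤ Real.exp (-1) * (β * ε) ^ 2 := by
    rw [le_div_iff₀ (by positivity)] at hc3
    calc 2 * (κ * (p * η)) ≤ 2 * (κ * (2 * (c * ε ^ 2))) := by gcongr
      _ = c * (4 * κ) * ε ^ 2 := by ring
      _ ≤ β ^ 2 * Real.exp (-1) * ε ^ 2 := by gcongr
      _ = _ := by ring
  have hβε : 0 < (β * ε) ^ 2 := by positivity
  have hβε1 : (β * ε) ^ 2 ≤ 1 := by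
    apply pow_le_one₀ (by positivity); nlinarith
  have hτ : κ * (p * η) ≤ 1 := by nlinarith [Real.exp_pos (-1)]
  have hμc : μ * c ≤ 1 := by
    rw [le_div_iff₀ hμ] at hc2; linarith
  have hμp : p * η * μ ≤ 2 := by nlinarith
  have hmain := h.measureReal_norm_gt_le hs hμ hκ1 hκB hp1 hη0 hτ (by linarith) hμp hX0 hX T
    (mul_pos hβ hε)
  refine hmain.trans ?_
  have hL : 1 / 2 ≤ Real.log (1 / ε) := by
    have h2 : Real.log 2 ≤ Real.log (1 / ε) := by
      apply Real.log_le_log (by norm_num)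
      rw [le_div_iff₀ hε]; linarith
    have := Real.log_two_gt_d9
    linarith
  set L := Real.log (1 / ε) with hLdef
  -- The choice of `K` gives the lower bound `(2x + 2) L`, and `L ≥ 1/2` turns `2xL` into at least
  -- `x`.
  have hηT : x + 2 * L ≤ η * μ * T / 2 := by
    have h1 : η * μ / 2 * (2 / (μ * c) * (2 * x + 2) / ε ^ 2 * l * L) ≤ η * μ / 2 * T := by
      gcongr
    have h2 : η * μ / 2 * (2 / (μ * c) * (2 * x + 2) / ε ^ 2 * l * L) = (2 * x + 2) * L := by
      rw [hη]; field_simp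
    rw [h2] at h1
    nlinarith
  have hfirst : Real.exp (-(η * μ * T / 2)) * (1 + D) ≤ Real.exp (-1) * (β * ε) ^ 2 := by
    have h1 : Real.exp (-(x + 2 * L)) = Real.exp (-1) * (β ^ 2 / (1 + D)) * ε ^ 2 := by
      have e1 : Real.exp (-L) = ε := by
        rw [hLdef, one_div, Real.log_inv, neg_neg, Real.exp_log hε]
      have e2 : Real.exp (-Real.log ((1 + D) / β ^ 2)) = β ^ 2 / (1 + D) := by
        rw [Real.exp_neg, Real.exp_log (by positivity), inv_div]
      rw [hx, show -(1 + Real.log ((1 + D) / β ^ 2) + 2 * L) =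
        -1 + -Real.log ((1 + D) / β ^ 2) + (-L + -L) by ring, Real.exp_add, Real.exp_add,
        Real.exp_add, e1, e2, sq ε]
    calc Real.exp (-(η * μ * T / 2)) * (1 + D) ≤ Real.exp (-(x + 2 * L)) * (1 + D) := by
          gcongr
      _ = _ := by rw [h1]; field_simp
  -- The `p`-th moment contracts `p` times as fast, so the rate is independent of `p` after taking
  -- `p`-th roots.
  have hpow : (1 - p * η * μ / 2) ^ T ≤ Real.exp (-(η * μ * T / 2)) ^ p := by
    calc (1 - p * η * μ / 2) ^ T ≤ Real.exp (-(p * η * μ / 2)) ^ T := by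
          apply pow_le_pow_left₀ (by linarith)
          linarith [Real.add_one_le_exp (-(p * η * μ / 2))]
      _ = _ := by
          rw [← Real.exp_nat_mul, ← Real.exp_nat_mul]; ring_nf
  rw [div_le_iff₀ (by positivity)]
  have hexpp : Real.exp (-1) ^ p ≤ δ * ε ^ 2 := by
    rw [← hexpl, ← Real.exp_nat_mul]
    apply Real.exp_le_exp.2
    linarith
  calc (1 - p * η * μ / 2) ^ T * (κ * (p * η) + ‖x₀ - xs‖ ^ 2) ^ p + 2 * (2 * (κ * (p * η))) ^ p
      ≤ Real.exp (-(η * μ * T / 2)) ^ p * (1 + D) ^ p +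
        2 * (Real.exp (-1) * (β * ε) ^ 2) ^ p := by gcongr
    _ = (Real.exp (-(η * μ * T / 2)) * (1 + D)) ^ p +
        2 * (Real.exp (-1) * (β * ε) ^ 2) ^ p := by
        rw [mul_pow (Real.exp (-(η * μ * T / 2)))]
    _ ≤ (Real.exp (-1) * (β * ε) ^ 2) ^ p + 2 * (Real.exp (-1) * (β * ε) ^ 2) ^ p := by
        gcongr
    _ = 3 * Real.exp (-1) ^ p * ((β * ε) ^ 2) ^ p := by rw [mul_pow]; ring
    -- The factor `ε²` inside the logarithm pays for the constant: `3 exp(-p) ≤ 3δε² ≤ (3/4) δ`.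
    _ ≤ δ * ((β * ε) ^ 2) ^ p := by
        gcongr
        nlinarith

end IsGradientOracle

/-! ### The uniform law on the sphere -/

section UnitSphere

open scoped Pointwise

variable {n m : ℕ}

theorem isProbabilityMeasure_unitSphereLaw (hn : 0 < n) :
    IsProbabilityMeasure (unitSphereLaw n m) := by
  have : Nonempty (Fin n × (Fin n ⊕ Fin m)) := ⟨(⟨0, hn⟩, Sum.inl ⟨0, hn⟩)⟩
  have hne : (volume : Measure (DirectionSpace n m)).toSphere Set.univ ≠ 0 := by
    rw [Measure.measure_univ_ne_zero]
    exact Measure.toSphere_ne_zero _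
  have : IsProbabilityMeasure
      (((volume : Measure (DirectionSpace n m)).toSphere Set.univ)⁻¹ •
        (volume : Measure (DirectionSpace n m)).toSphere) := by
    constructor
    rw [Measure.smul_apply, smul_eq_mul, ENNReal.inv_mul_cancel hne (measure_ne_top _ _)]
  exact Measure.isProbabilityMeasure_map measurable_subtype_coe.aemeasurable

theorem unitSphereLaw_apply {s : Set (DirectionSpace n m)} (hs : MeasurableSet s) :
    unitSphereLaw n m s = ((volume : Measure (DirectionSpace n m)).toSphere Set.univ)⁻¹ *
      (Module.finrank ℝ (DirectionSpace n m) *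
        volume (Set.Ioo (0 : ℝ) 1 • (s ∩ Metric.sphere (0 : DirectionSpace n m) 1))) := by
  rw [unitSphereLaw, Measure.map_apply measurable_subtype_coe hs, Measure.smul_apply, smul_eq_mul,
    Measure.toSphere_apply' _ (measurable_subtype_coe hs), Subtype.image_preimage_coe,
    Set.inter_comm]

/-- The measure of a set on the sphere is, up to a constant, the volume of the cone over it. A
linear isometry commutes with forming cones and preserves volume. -/
theorem measurePreserving_unitSphereLaw (L : DirectionSpace n m ≃ₗᵢ[ℝ] DirectionSpace n m) :
    MeasurePreserving L (unitSphereLaw n m) (unitSphereLaw n m) := by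
  refine ⟨L.continuous.measurable, ?_⟩
  ext s hs
  rw [Measure.map_apply L.continuous.measurable hs, unitSphereLaw_apply hs,
    unitSphereLaw_apply (L.continuous.measurable hs)]
  have : Set.Ioo (0 : ℝ) 1 • (L ⁻¹' s ∩ Metric.sphere (0 : DirectionSpace n m) 1) =
      L ⁻¹' (Set.Ioo (0 : ℝ) 1 • (s ∩ Metric.sphere (0 : DirectionSpace n m) 1)) := by
    ext x
    simp only [Set.mem_smul, Set.mem_inter_iff, Set.mem_preimage, mem_sphere_zero_iff_norm]
    constructor
    · rintro ⟨c, hc, y, ⟨h1, h2⟩, rfl⟩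
      exact ⟨c, hc, L y, ⟨h1, by simpa using h2⟩, by simp⟩
    · rintro ⟨c, hc, y, ⟨h1, h2⟩, h⟩
      refine ⟨c, hc, L.symm y, ⟨by simpa using h1, by simpa using h2⟩, ?_⟩
      apply L.injective
      simpa using h
  rw [this]
  have := (L.measurePreserving).measure_preimage_equiv (f := L.toHomeomorph.toMeasurableEquiv)
    (Set.Ioo (0 : ℝ) 1 • (s ∩ Metric.sphere (0 : DirectionSpace n m) 1))
  congr 2

theorem ae_unitSphereLaw_norm : ∀ᵐ u ∂(unitSphereLaw n m), ‖u‖ = 1 := by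
  rw [unitSphereLaw, ae_map_iff measurable_subtype_coe.aemeasurable
    (measurableSet_eq_fun measurable_norm measurable_const)]
  exact .of_forall fun u => by simp

theorem integrable_unitSphereLaw_mul (hn : 0 < n) (i j : Fin n × (Fin n ⊕ Fin m)) :
    Integrable (fun u : DirectionSpace n m => u i * u j) (unitSphereLaw n m) := by
  have := isProbabilityMeasure_unitSphereLaw (m := m) hn
  refine Integrable.of_bound (C := 1) (by fun_prop) ?_
  filter_upwards [ae_unitSphereLaw_norm] with u hu
  rw [norm_mul]
  have h1 := PiLp.norm_apply_le u i
  have h2 := PiLp.norm_apply_le u j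
  rw [hu] at h1 h2
  exact mul_le_one₀ h1 (norm_nonneg _) h2

/-- The reflection of coordinate `i` preserves the law and changes the sign of the integrand. -/
theorem integral_unitSphereLaw_mul_of_ne {i j : Fin n × (Fin n ⊕ Fin m)} (hij : i ≠ j) :
    ∫ u : DirectionSpace n m, u i * u j ∂(unitSphereLaw n m) = 0 := by
  let L : DirectionSpace n m ≃ₗᵢ[ℝ] DirectionSpace n m :=
    LinearIsometryEquiv.piLpCongrRight 2 fun k =>
      if k = i then LinearIsometryEquiv.neg ℝ else LinearIsometryEquiv.refl ℝ ℝ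
  have h := (measurePreserving_unitSphereLaw L).integral_comp
    L.toHomeomorph.measurableEmbedding (fun u => u i * u j)
  have hL : ∀ u : DirectionSpace n m, (L u) i * (L u) j = -(u i * u j) := by
    intro u
    simp [L, hij.symm]
  simp only [hL, integral_neg] at h
  linarith

/-- Transpositions of coordinates make all these integrals equal, and they sum to `E‖u‖² = 1`. -/
theorem integral_unitSphereLaw_sq (hn : 0 < n) (i : Fin n × (Fin n ⊕ Fin m)) :
    ∫ u : DirectionSpace n m, u i * u i ∂(unitSphereLaw n m) = ((n * (m + n) : ℕ) : ℝ)⁻¹ := by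
  have := isProbabilityMeasure_unitSphereLaw (m := m) hn
  have hswap : ∀ j, ∫ u : DirectionSpace n m, u j * u j ∂(unitSphereLaw n m) =
      ∫ u : DirectionSpace n m, u i * u i ∂(unitSphereLaw n m) := by
    intro j
    let L : DirectionSpace n m ≃ₗᵢ[ℝ] DirectionSpace n m :=
      LinearIsometryEquiv.piLpCongrLeft 2 ℝ ℝ (Equiv.swap i j)
    have h := (measurePreserving_unitSphereLaw L).integral_comp
      L.toHomeomorph.measurableEmbedding (fun u => u i * u i)
    rw [← h]
    congr 1
    ext u
    simp [L, LinearIsometryEquiv.piLpCongrLeft_apply, Equiv.piCongrLeft'_apply]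
  have hsum : ∑ j, ∫ u : DirectionSpace n m, u j * u j ∂(unitSphereLaw n m) = 1 := by
    rw [← integral_finsetSum _ fun j _ => integrable_unitSphereLaw_mul hn j j]
    have : (fun u : DirectionSpace n m => ∑ j, u j * u j) =ᵐ[unitSphereLaw n m] fun _ => 1 := by
      filter_upwards [ae_unitSphereLaw_norm] with u hu
      have h2 := EuclideanSpace.real_norm_sq_eq u
      rw [hu] at h2
      simp only [← sq]
      linarith
    rw [integral_congr_ae this]
    simp
  simp only [hswap, Finset.sum_const, Finset.card_univ, Fintype.card_prod, Fintype.card_fin,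
    Fintype.card_sum, nsmul_eq_mul] at hsum
  rw [eq_comm, inv_eq_of_mul_eq_one_right]
  rw [← hsum, add_comm m n]

/-- A uniform unit vector has covariance `1 / d` times the identity. -/
theorem integral_unitSphereLaw_inner_mul_inner (hn : 0 < n) (a b : DirectionSpace n m) :
    ∫ u : DirectionSpace n m, inner ℝ a u * inner ℝ b u ∂(unitSphereLaw n m) =
      ((n * (m + n) : ℕ) : ℝ)⁻¹ * inner ℝ a b := by
  have hexp : ∀ u : DirectionSpace n m, (inner ℝ a u * inner ℝ b u : ℝ) =
      ∑ i, ∑ j, (a i * b j) * (u i * u j) := by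
    intro u
    simp only [PiLp.inner_apply, RCLike.inner_apply, conj_trivial, Finset.sum_mul_sum]
    exact Finset.sum_congr rfl fun i _ => Finset.sum_congr rfl fun j _ => by ring
  simp only [hexp]
  rw [integral_finsetSum _ fun i _ => integrable_finsetSum _ fun j _ =>
    (integrable_unitSphereLaw_mul hn i j).const_mul _]
  simp only [PiLp.inner_apply, RCLike.inner_apply, conj_trivial, Finset.mul_sum]
  refine Finset.sum_congr rfl fun i _ => ?_
  rw [integral_finsetSum _ fun j _ => (integrable_unitSphereLaw_mul hn i j).const_mul _,
    Finset.sum_eq_single i]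
  · rw [integral_const_mul, integral_unitSphereLaw_sq hn]; ring
  · intro j _ hj
    rw [integral_const_mul, integral_unitSphereLaw_mul_of_ne hj.symm, mul_zero]
  · simp

end UnitSphere

/-! ### Gaussian vectors -/

section GaussianVec

variable {k : ℕ} (μ : Fin k → ℝ) (Q : Matrix (Fin k) (Fin k) ℝ)

theorem measurable_ofLp_two {ι : Type*} [Fintype ι] :
    Measurable (WithLp.ofLp : EuclideanSpace ℝ ι → ι → ℝ) := by fun_prop

instance isProbabilityMeasure_gaussianVec : IsProbabilityMeasure (gaussianVec μ Q) :=
  Measure.isProbabilityMeasure_map measurable_ofLp_two.aemeasurable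

theorem memLp_eval_gaussianVec (i : Fin k) : MemLp (fun x => x i) 2 (gaussianVec μ Q) := by
  rw [gaussianVec, memLp_map_measure_iff (measurable_pi_apply i).aestronglyMeasurable
    measurable_ofLp_two.aemeasurable]
  have h : MemLp id 2 (multivariateGaussian (WithLp.toLp 2 μ) Q) := IsGaussian.memLp_two_id
  exact h.mono (by fun_prop) (.of_forall fun x => PiLp.norm_apply_le x i)

theorem integral_gaussianVec (i : Fin k) : ∫ x, x i ∂(gaussianVec μ Q) = μ i := by
  rw [gaussianVec, integral_map measurable_ofLp_two.aemeasurable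
    (measurable_pi_apply i).aestronglyMeasurable]
  have h := (EuclideanSpace.proj i : EuclideanSpace ℝ (Fin k) →L[ℝ] ℝ).integral_comp_id_comm
    (μ := multivariateGaussian (WithLp.toLp 2 μ) Q) IsGaussian.integrable_id
  simpa using h

theorem integral_mul_gaussianVec (hQ : Q.PosSemidef) (i j : Fin k) :
    ∫ x, (x i - μ i) * (x j - μ j) ∂(gaussianVec μ Q) = Q i j := by
  have hm : ∀ i, ∫ x : EuclideanSpace ℝ (Fin k), x i
      ∂(multivariateGaussian (WithLp.toLp 2 μ) Q) = μ i := by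
    intro i
    rw [← integral_gaussianVec μ Q i, gaussianVec,
      integral_map measurable_ofLp_two.aemeasurable (measurable_pi_apply i).aestronglyMeasurable]
  rw [gaussianVec, integral_map measurable_ofLp_two.aemeasurable (by fun_prop),
    ← covariance_eval_multivariateGaussian (μ := WithLp.toLp 2 μ) hQ i j, covariance, hm, hm]

/-- Fernique's theorem, transferred from the Euclidean norm to the smaller sup norm. -/
theorem exists_integrable_exp_sq_gaussianVec :
    ∃ C : ℝ, 0 < C ∧ Integrable (fun x => Real.exp (C * ‖x‖ ^ 2)) (gaussianVec μ Q) := by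
  obtain ⟨C, hC, h⟩ := IsGaussian.exists_integrable_exp_sq
    (multivariateGaussian (WithLp.toLp 2 μ) Q)
  refine ⟨C, hC, ?_⟩
  rw [gaussianVec, integrable_map_measure (by fun_prop) measurable_ofLp_two.aemeasurable]
  refine h.mono' (by fun_prop) (.of_forall fun x => ?_)
  simp only [Function.comp_apply]
  rw [Real.norm_of_nonneg (Real.exp_pos _).le]
  gcongr
  exact (pi_norm_le_iff_of_nonneg (norm_nonneg x)).2 fun i => PiLp.norm_apply_le x i

/-- The law is an affine image of the standard Gaussian, which is symmetric. Admitting `a = 1` as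
well lets one family of maps describe every pattern of sign changes. -/
theorem measurePreserving_reflect_gaussianVec {a : ℝ} (ha : a = 1 ∨ a = -1) :
    MeasurePreserving (fun x i => μ i + a * (x i - μ i)) (gaussianVec μ Q) (gaussianVec μ Q) := by
  refine ⟨by fun_prop, ?_⟩
  rcases ha with rfl | rfl
  · simp
  rw [gaussianVec, Measure.map_map (by fun_prop) measurable_ofLp_two]
  rw [multivariateGaussian, Measure.map_map (by fun_prop) (by fun_prop),
    Measure.map_map (by fun_prop) (by fun_prop)]
  conv_lhs => rw [← stdGaussian_map (LinearIsometryEquiv.neg ℝ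
    (E := EuclideanSpace ℝ (Fin k)))]
  rw [Measure.map_map (by fun_prop) (by fun_prop)]
  congr 1
  ext x i
  simp

end GaussianVec

/-! ### Random variables with Gaussian tails -/

/-- A nonnegative random variable whose square has an exponential moment. -/
def HasSquareExpMoment {Ω : Type*} [MeasurableSpace Ω] (P : Measure Ω) (q : Ω → ℝ) : Prop :=
  Measurable q ∧ (∀ ω, 0 ≤ q ω) ∧ ∃ C : ℝ, 0 < C ∧ Integrable (fun ω => Real.exp (C * q ω ^ 2)) P

namespace HasSquareExpMoment

variable {Ω : Type*} [MeasurableSpace Ω] {P : Measure Ω} {q q' : Ω → ℝ}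

theorem of_const [IsFiniteMeasure P] {c : ℝ} (hc : 0 ≤ c) : HasSquareExpMoment P fun _ => c :=
  ⟨measurable_const, fun _ => hc, 1, one_pos, integrable_const _⟩

/-- No independence is needed: `(q + q')² ≤ 4 max(q, q')²`, so a quarter of the smaller constant
works, and the exponential of a maximum is at most the sum of the exponentials. -/
theorem add (h : HasSquareExpMoment P q) (h' : HasSquareExpMoment P q') :
    HasSquareExpMoment P fun ω => q ω + q' ω := by
  obtain ⟨hm, h0, C, hC, hi⟩ := h
  obtain ⟨hm', h0', C', hC', hi'⟩ := h'
  refine ⟨hm.add hm', fun ω => add_nonneg (h0 ω) (h0' ω), min C C' / 4, by positivity, ?_⟩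
  refine (hi.add hi').mono' (by fun_prop) (.of_forall fun ω => ?_)
  rw [Real.norm_of_nonneg (Real.exp_pos _).le]
  simp only [Pi.add_apply]
  have hmin : 0 < min C C' := by positivity
  have h1 : min C C' / 4 * (q ω + q' ω) ^ 2 ≤ max (C * q ω ^ 2) (C' * q' ω ^ 2) := by
    have hl := min_le_left C C'
    have hr := min_le_right C C'
    rcases le_total (q ω) (q' ω) with hqq | hqq
    · refine le_trans ?_ (le_max_right _ _)
      calc min C C' / 4 * (q ω + q' ω) ^ 2 ≤ min C C' / 4 * (q' ω + q' ω) ^ 2 := by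
            have := h0 ω
            have := h0' ω
            gcongr
        _ = min C C' * q' ω ^ 2 := by ring
        _ ≤ _ := by gcongr
    · refine le_trans ?_ (le_max_left _ _)
      calc min C C' / 4 * (q ω + q' ω) ^ 2 ≤ min C C' / 4 * (q ω + q ω) ^ 2 := by
            have := h0' ω
            have := h0 ω
            have := h0' ω
            gcongr
        _ = min C C' * q ω ^ 2 := by ring
        _ ≤ _ := by gcongr
  calc Real.exp (min C C' / 4 * (q ω + q' ω) ^ 2)
      ≤ Real.exp (max (C * q ω ^ 2) (C' * q' ω ^ 2)) := Real.exp_le_exp.2 h1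
    _ ≤ _ := by
      rcases max_choice (C * q ω ^ 2) (C' * q' ω ^ 2) with h | h <;> rw [h]
      · linarith [Real.exp_pos (C' * q' ω ^ 2)]
      · linarith [Real.exp_pos (C * q ω ^ 2)]

theorem sum [IsFiniteMeasure P] {ι : Type*} (s : Finset ι) {f : ι → Ω → ℝ}
    (h : ∀ i, HasSquareExpMoment P (f i)) : HasSquareExpMoment P fun ω => ∑ i ∈ s, f i ω := by
  classical
  induction s using Finset.induction_on with
  | empty => simpa using of_const (P := P) le_rfl
  | insert i s hi ih => simpa [Finset.sum_insert hi] using (h i).add ih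

theorem comp {Ω' : Type*} [MeasurableSpace Ω'] {P' : Measure Ω'} {T : Ω' → Ω}
    (hT : MeasurePreserving T P' P) (h : HasSquareExpMoment P q) :
    HasSquareExpMoment P' fun ω => q (T ω) := by
  obtain ⟨hm, h0, C, hC, hi⟩ := h
  exact ⟨hm.comp hT.measurable, fun ω => h0 _, C, hC, hT.integrable_comp_of_integrable hi⟩

theorem memLp_two [IsFiniteMeasure P] (h : HasSquareExpMoment P q) : MemLp q 2 P := by
  obtain ⟨hm, h0, C, hC, hi⟩ := h
  rw [memLp_two_iff_integrable_sq hm.aestronglyMeasurable]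
  refine (hi.const_mul C⁻¹).mono' (by fun_prop) (.of_forall fun ω => ?_)
  rw [Real.norm_of_nonneg (sq_nonneg _), ← div_eq_inv_mul, le_div_iff₀ hC]
  linarith [Real.add_one_le_exp (C * q ω ^ 2)]

end HasSquareExpMoment

/-! ### Second moments of random vectors -/

/-- A random vector with square integrable coordinates. -/
def CoordL2 {Ω ι : Type*} [MeasurableSpace Ω] (P : Measure Ω) (X : Ω → ι → ℝ) : Prop :=
  ∀ i, MemLp (fun ω => X ω i) 2 P

/-- The matrix of mixed second moments of two random vectors. -/
noncomputable def crossMoment {Ω ι κ : Type*} [MeasurableSpace Ω] (P : Measure Ω)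
    (X : Ω → ι → ℝ) (Z : Ω → κ → ℝ) : Matrix ι κ ℝ :=
  Matrix.of fun i j => ∫ ω, X ω i * Z ω j ∂P

section SecondMoments

variable {Ω ι κ l : Type*} [MeasurableSpace Ω] {P : Measure Ω}
  {X X' : Ω → ι → ℝ} {Z Z' : Ω → κ → ℝ}

theorem CoordL2.add (h : CoordL2 P X) (h' : CoordL2 P X') : CoordL2 P fun ω => X ω + X' ω :=
  fun i => (h i).add (h' i)

theorem CoordL2.sub (h : CoordL2 P X) (h' : CoordL2 P X') : CoordL2 P fun ω => X ω - X' ω :=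
  fun i => (h i).sub (h' i)

theorem CoordL2.of_const [IsFiniteMeasure P] (x : ι → ℝ) : CoordL2 P fun _ => x :=
  fun _ => memLp_const _

theorem CoordL2.mulVec [Fintype ι] (M : Matrix l ι ℝ) (h : CoordL2 P X) :
    CoordL2 P fun ω => M *ᵥ X ω := by
  intro i
  simp only [Matrix.mulVec, dotProduct]
  exact memLp_finsetSum _ fun j _ => (h j).const_mul _

theorem CoordL2.sumElim (h : CoordL2 P X) (h' : CoordL2 P Z) :
    CoordL2 P fun ω => Sum.elim (X ω) (Z ω) := by
  rintro (i | i)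
  · exact h i
  · exact h' i

theorem CoordL2.integrable_mul (h : CoordL2 P X) (h' : CoordL2 P Z) (i : ι) (j : κ) :
    Integrable (fun ω => X ω i * Z ω j) P := (h i).integrable_mul (h' j)

theorem CoordL2.comp {Ω' : Type*} [MeasurableSpace Ω'] {P' : Measure Ω'} {T : Ω' → Ω}
    (hT : MeasurePreserving T P' P) (h : CoordL2 P X) : CoordL2 P' fun ω => X (T ω) :=
  fun i => (h i).comp_measurePreserving hT

theorem crossMoment_transpose : (crossMoment P X Z)ᵀ = crossMoment P Z X := by
  ext i j
  simp [crossMoment, mul_comm]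

theorem crossMoment_add_left (h : CoordL2 P X) (h' : CoordL2 P X') (hZ : CoordL2 P Z) :
    crossMoment P (fun ω => X ω + X' ω) Z = crossMoment P X Z + crossMoment P X' Z := by
  ext i j
  simp only [crossMoment, Matrix.of_apply, Matrix.add_apply, Pi.add_apply, add_mul]
  exact integral_add (h.integrable_mul hZ i j) (h'.integrable_mul hZ i j)

theorem crossMoment_sub_left (h : CoordL2 P X) (h' : CoordL2 P X') (hZ : CoordL2 P Z) :
    crossMoment P (fun ω => X ω - X' ω) Z = crossMoment P X Z - crossMoment P X' Z := by
  ext i j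
  simp only [crossMoment, Matrix.of_apply, Matrix.sub_apply, Pi.sub_apply, sub_mul]
  exact integral_sub (h.integrable_mul hZ i j) (h'.integrable_mul hZ i j)

theorem crossMoment_mulVec_left [Fintype ι] (M : Matrix l ι ℝ) (h : CoordL2 P X)
    (hZ : CoordL2 P Z) :
    crossMoment P (fun ω => M *ᵥ X ω) Z = M * crossMoment P X Z := by
  ext i j
  simp only [crossMoment, Matrix.of_apply, Matrix.mul_apply, Matrix.mulVec, dotProduct,
    Finset.sum_mul]
  rw [integral_finsetSum]
  · refine Finset.sum_congr rfl fun k _ => ?_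
    simp only [mul_assoc]
    exact integral_const_mul _ _
  · intro k _
    simp only [mul_assoc]
    exact (h.integrable_mul hZ k j).const_mul _

theorem crossMoment_add_right (h : CoordL2 P X) (hZ : CoordL2 P Z) (hZ' : CoordL2 P Z') :
    crossMoment P X (fun ω => Z ω + Z' ω) = crossMoment P X Z + crossMoment P X Z' := by
  rw [← crossMoment_transpose, crossMoment_add_left hZ hZ' h, Matrix.transpose_add,
    crossMoment_transpose, crossMoment_transpose]

theorem crossMoment_sub_right (h : CoordL2 P X) (hZ : CoordL2 P Z) (hZ' : CoordL2 P Z') :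
    crossMoment P X (fun ω => Z ω - Z' ω) = crossMoment P X Z - crossMoment P X Z' := by
  rw [← crossMoment_transpose, crossMoment_sub_left hZ hZ' h, Matrix.transpose_sub,
    crossMoment_transpose, crossMoment_transpose]

theorem crossMoment_mulVec_right [Fintype κ] (M : Matrix l κ ℝ) (h : CoordL2 P X)
    (hZ : CoordL2 P Z) :
    crossMoment P X (fun ω => M *ᵥ Z ω) = crossMoment P X Z * Mᵀ := by
  rw [← crossMoment_transpose, crossMoment_mulVec_left M hZ h, Matrix.transpose_mul,
    crossMoment_transpose]

/-- Second moments vanish if a symmetry of the law changes the sign of one factor only. -/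
theorem crossMoment_eq_zero {T : Ω → Ω} (hT : MeasurePreserving T P P) (h : CoordL2 P X)
    (hZ : CoordL2 P Z) (hX : ∀ ω, X (T ω) = -X ω) (hZT : ∀ ω, Z (T ω) = Z ω) :
    crossMoment P X Z = 0 := by
  ext i j
  simp only [crossMoment, Matrix.of_apply, Matrix.zero_apply]
  have hi := h.integrable_mul hZ i j
  have := integral_map hT.aemeasurable (f := fun ω => X ω i * Z ω j)
    (by rw [hT.map_eq]; exact hi.aestronglyMeasurable)
  rw [hT.map_eq] at this
  simp only [hX, hZT, Pi.neg_apply, neg_mul, integral_neg] at this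
  linarith

theorem crossMoment_eq_zero' {T : Ω → Ω} (hT : MeasurePreserving T P P) (h : CoordL2 P X)
    (hZ : CoordL2 P Z) (hX : ∀ ω, X (T ω) = X ω) (hZT : ∀ ω, Z (T ω) = -Z ω) :
    crossMoment P X Z = 0 := by
  rw [← crossMoment_transpose, crossMoment_eq_zero hT hZ h hZT hX, Matrix.transpose_zero]

theorem dotProduct_crossMoment_mulVec [Fintype ι] (h : CoordL2 P X) (a : ι → ℝ) :
    a ⬝ᵥ crossMoment P X X *ᵥ a = ∫ ω, (a ⬝ᵥ X ω) ^ 2 ∂P := by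
  have hexp : ∀ ω, (a ⬝ᵥ X ω) ^ 2 = ∑ i, ∑ j, a i * a j * (X ω i * X ω j) := by
    intro ω
    simp only [dotProduct, sq, Finset.sum_mul_sum]
    exact Finset.sum_congr rfl fun i _ => Finset.sum_congr rfl fun j _ => by ring
  simp only [hexp]
  rw [integral_finsetSum _ fun i _ => integrable_finsetSum _ fun j _ =>
    (h.integrable_mul h i j).const_mul _]
  simp only [dotProduct, Matrix.mulVec, crossMoment, Matrix.of_apply, Finset.mul_sum]
  refine Finset.sum_congr rfl fun i _ => ?_
  rw [integral_finsetSum _ fun j _ => (h.integrable_mul h i j).const_mul _]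
  refine Finset.sum_congr rfl fun j _ => ?_
  rw [integral_const_mul]; ring

theorem posSemidef_crossMoment [Fintype ι] (h : CoordL2 P X) :
    (crossMoment P X X).PosSemidef := by
  refine Matrix.PosSemidef.of_dotProduct_mulVec_nonneg ?_ fun a => ?_
  · rw [Matrix.IsHermitian, Matrix.conjTranspose_eq_transpose_of_trivial, crossMoment_transpose]
  · rw [star_trivial, dotProduct_crossMoment_mulVec h]
    exact integral_nonneg fun ω => sq_nonneg _

end SecondMoments

/-! ### Matrices, directions and norms -/

section Norms

theorem Matrix.abs_apply_le_l2_opNorm {ι κ : Type*} [Fintype ι] [Fintype κ] [DecidableEq κ]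
    (M : Matrix ι κ ℝ) (i : ι) (j : κ) : |M i j| ≤ ‖M‖ := by
  have h := Matrix.l2_opNorm_mulVec M (EuclideanSpace.single j (1 : ℝ))
  rw [PiLp.norm_single, norm_one, mul_one] at h
  refine le_trans ?_ h
  have h2 := PiLp.norm_apply_le (WithLp.toLp 2 (M *ᵥ (EuclideanSpace.single j (1 : ℝ)).ofLp)) i
  simpa using h2

/-- Vectors carry the sup norm and matrices the spectral norm, whence the dimensional factor. It
only enters constants. -/
theorem norm_mulVec_le_card_mul {ι κ : Type*} [Fintype ι] [Fintype κ] [DecidableEq κ]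
    (M : Matrix ι κ ℝ) (v : κ → ℝ) : ‖M *ᵥ v‖ ≤ Fintype.card κ * ‖M‖ * ‖v‖ := by
  refine (pi_norm_le_iff_of_nonneg (by positivity)).2 fun i => ?_
  simp only [Matrix.mulVec, dotProduct]
  refine (norm_sum_le _ _).trans ?_
  calc ∑ j, ‖M i j * v j‖ ≤ ∑ _j : κ, ‖M‖ * ‖v‖ := by
        refine Finset.sum_le_sum fun j _ => ?_
        rw [norm_mul]
        exact mul_le_mul (M.abs_apply_le_l2_opNorm i j) (norm_le_pi_norm v j) (norm_nonneg _)
          (norm_nonneg _)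
    _ = _ := by simp [mul_assoc]

variable {n m : ℕ}

/-- A policy as a vector of the Euclidean space of directions. -/
def directionOf (π : Policy n m) : DirectionSpace n m := WithLp.toLp 2 fun q => π q.1 q.2

@[simp] theorem directionOf_apply (π : Policy n m) (q : Fin n × (Fin n ⊕ Fin m)) :
    directionOf π q = π q.1 q.2 := rfl

@[simp] theorem directionMatrix_apply (u : DirectionSpace n m) (i : Fin n) (j : Fin n ⊕ Fin m) :
    directionMatrix u i j = u (i, j) := rfl

@[simp] theorem directionMatrix_directionOf (π : Policy n m) :
    directionMatrix (directionOf π) = π := rfl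

@[simp] theorem directionOf_directionMatrix (u : DirectionSpace n m) :
    directionOf (directionMatrix u) = u := rfl

theorem directionOf_sub (π π' : Policy n m) :
    directionOf (π - π') = directionOf π - directionOf π' := rfl

theorem directionOf_smul (c : ℝ) (π : Policy n m) :
    directionOf (c • π) = c • directionOf π := rfl

theorem norm_directionMatrix_le (u : DirectionSpace n m) : ‖directionMatrix u‖ ≤ ‖u‖ := by
  rw [Matrix.l2_opNorm_def]
  refine ContinuousLinearMap.opNorm_le_bound _ (norm_nonneg _) fun x => ?_
  apply le_of_sq_le_sq _ (by positivity)
  rw [mul_pow, EuclideanSpace.real_norm_sq_eq, EuclideanSpace.real_norm_sq_eq u,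
    EuclideanSpace.real_norm_sq_eq x, Fintype.sum_prod_type, Finset.sum_mul]
  refine Finset.sum_le_sum fun i _ => ?_
  exact Finset.sum_mul_sq_le_sq_mul_sq Finset.univ (fun j => u (i, j)) fun j => x j

theorem norm_le_norm_directionOf (π : Policy n m) : ‖π‖ ≤ ‖directionOf π‖ :=
  norm_directionMatrix_le (directionOf π)

theorem norm_directionOf_le_of_abs_le {π : Policy n m} {c : ℝ} (hc : 0 ≤ c)
    (h : ∀ i j, |π i j| ≤ c) : ‖directionOf π‖ ≤ (n * (m + n) : ℕ) * c := by
  apply le_of_sq_le_sq _ (by positivity)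
  rw [EuclideanSpace.real_norm_sq_eq]
  calc ∑ q, directionOf π q ^ 2 ≤ ∑ _q : Fin n × (Fin n ⊕ Fin m), c ^ 2 := by
        refine Finset.sum_le_sum fun q _ => ?_
        rw [← sq_abs]
        exact pow_le_pow_left₀ (abs_nonneg _) (h q.1 q.2) 2
    _ = ((n * (m + n) : ℕ) : ℝ) * c ^ 2 := by simp [add_comm (n : ℝ) m]
    _ ≤ ((n * (m + n) : ℕ) : ℝ) ^ 2 * c ^ 2 := by
        gcongr
        exact_mod_cast Nat.le_self_pow two_ne_zero _
    _ = _ := by ring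

theorem norm_directionOf_le (π : Policy n m) : ‖directionOf π‖ ≤ (n * (m + n) : ℕ) * ‖π‖ :=
  norm_directionOf_le_of_abs_le (norm_nonneg _) fun i j => π.abs_apply_le_l2_opNorm i j

end Norms

/-! ### The law of a sample -/

namespace KFSystem

variable {n m : ℕ} (S : KFSystem n m)

theorem isProbabilityMeasure_sampleLaw (hn : 0 < n) : IsProbabilityMeasure S.sampleLaw := by
  have := isProbabilityMeasure_unitSphereLaw (m := m) hn
  unfold sampleLaw
  infer_instance

/-- Change the signs of the centered noises. -/
def reflect (a : ℝ) (b c : ℕ → ℝ) (d : ℝ) (s : Sample n m) : Sample n m :=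
  (s.1, fun i => S.xbar i + a * (s.2.1 i - S.xbar i), fun t i => 0 + b t * (s.2.2.1 t i - 0),
    fun t i => 0 + c t * (s.2.2.2.1 t i - 0), fun i => 0 + d * (s.2.2.2.2 i - 0))

theorem measurePreserving_reflect (hn : 0 < n) {a : ℝ} {b c : ℕ → ℝ} {d : ℝ}
    (ha : a = 1 ∨ a = -1) (hb : ∀ t, b t = 1 ∨ b t = -1) (hc : ∀ t, c t = 1 ∨ c t = -1)
    (hd : d = 1 ∨ d = -1) :
    MeasurePreserving (S.reflect a b c d) S.sampleLaw S.sampleLaw := by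
  have := isProbabilityMeasure_unitSphereLaw (m := m) hn
  have hpi : ∀ {k : ℕ} (Q : Matrix (Fin k) (Fin k) ℝ) {b : ℕ → ℝ} (_ : ∀ t, b t = 1 ∨ b t = -1),
      MeasurePreserving (fun (w : ℕ → Fin k → ℝ) t i => 0 + b t * (w t i - 0))
        (Measure.infinitePi fun _ : ℕ => gaussianVec 0 Q)
        (Measure.infinitePi fun _ : ℕ => gaussianVec 0 Q) := by
    intro k Q b hb
    refine ⟨by fun_prop, ?_⟩
    have h := Measure.infinitePi_map_pi (fun _ : ℕ => gaussianVec (0 : Fin k → ℝ) Q)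
      (f := fun t x i => 0 + b t * (x i - 0)) (fun t => by fun_prop)
    rw [h]
    congr 1
    ext1 t
    exact (measurePreserving_reflect_gaussianVec 0 Q (hb t)).map_eq
  exact (MeasurePreserving.id _).prod <|
    (measurePreserving_reflect_gaussianVec S.xbar S.X₀ ha).prod <|
    (hpi S.W hb).prod <| (hpi S.V hc).prod (measurePreserving_reflect_gaussianVec 0 S.Θ hd)

theorem measurePreserving_init (hn : 0 < n) :
    MeasurePreserving Sample.init S.sampleLaw (gaussianVec S.xbar S.X₀) := by
  have := isProbabilityMeasure_unitSphereLaw (m := m) hn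
  exact measurePreserving_fst.comp measurePreserving_snd

theorem measurePreserving_process (hn : 0 < n) (t : ℕ) :
    MeasurePreserving (fun s : Sample n m => s.process t) S.sampleLaw (gaussianVec 0 S.W) := by
  have := isProbabilityMeasure_unitSphereLaw (m := m) hn
  exact (measurePreserving_eval_infinitePi (fun _ : ℕ => gaussianVec 0 S.W) t).comp
    (measurePreserving_fst.comp (measurePreserving_snd.comp measurePreserving_snd))

theorem measurePreserving_meas (hn : 0 < n) (t : ℕ) :
    MeasurePreserving (fun s : Sample n m => s.meas t) S.sampleLaw (gaussianVec 0 S.V) := by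
  have := isProbabilityMeasure_unitSphereLaw (m := m) hn
  exact (measurePreserving_eval_infinitePi (fun _ : ℕ => gaussianVec 0 S.V) t).comp
    (measurePreserving_fst.comp (measurePreserving_snd.comp
      (measurePreserving_snd.comp measurePreserving_snd)))

theorem measurePreserving_inject (hn : 0 < n) :
    MeasurePreserving Sample.inject S.sampleLaw (gaussianVec 0 S.Θ) := by
  have := isProbabilityMeasure_unitSphereLaw (m := m) hn
  exact measurePreserving_snd.comp (measurePreserving_snd.comp
      (measurePreserving_snd.comp measurePreserving_snd))

end KFSystem

namespace KFSystem

variable {n m : ℕ} (S : KFSystem n m)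

/-! ### The regression problem of a stage -/

/-- The regressor `(x̂_h, y_h)` of stage `h`. -/
def regressor (h : ℕ) (F : ℕ → Policy n m) (s : Sample n m) : Fin n ⊕ Fin m → ℝ :=
  Sum.elim (S.estimate h F s h) (S.output h s h)

/-- The quantity `x_{h+1}` to be predicted at stage `h`. -/
def target (h : ℕ) (s : Sample n m) : Fin n → ℝ := S.state h s (h + 1)

theorem estimate_congr {h : ℕ} {F G : ℕ → Policy n m} (s : Sample n m) {t : ℕ}
    (hFG : ∀ j < t, F j = G j) : S.estimate h F s t = S.estimate h G s t := by
  induction t with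
  | zero => rfl
  | succ t ih =>
    simp only [estimate]
    rw [ih fun j hj => hFG j (by omega), hFG t (by omega)]

/-- The part of the empirical objective that does not depend on the candidate filter. -/
def earlierCost (h : ℕ) (F : ℕ → Policy n m) (s : Sample n m) : ℝ :=
  ∑ t ∈ Finset.range (h + 1),
    (S.state h s t - S.estimate h F s t) ⬝ᵥ (S.state h s t - S.estimate h F s t)

/-- The estimates up to time `h` use only filters with index below `h`, and nothing is injected at
time `h + 1`. The candidate thus appears only in the last summand, as the error of a linear
regression. -/
theorem sampleCost_eq (h : ℕ) (F : ℕ → Policy n m) (π : Policy n m) (s : Sample n m) :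
    S.sampleCost h F π s = S.earlierCost h F s +
      (S.target h s - π *ᵥ S.regressor h F s) ⬝ᵥ (S.target h s - π *ᵥ S.regressor h F s) := by
  have hcongr : ∀ t ≤ h, S.estimate h (Function.update F h π) s t = S.estimate h F s t :=
    fun t ht => S.estimate_congr s fun j hj => Function.update_of_ne (by omega) _ _
  rw [sampleCost, Finset.sum_range_succ, earlierCost]
  congr 1
  · refine Finset.sum_congr rfl fun t ht => ?_
    rw [hcongr t (by simpa [Nat.lt_succ_iff] using ht)]
  · have : S.estimate h (Function.update F h π) s (h + 1) = π *ᵥ S.regressor h F s := by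
      simp [estimate, Policy.predict, regressor, hcongr h le_rfl]
    rw [this, target]

/-- The gradient of the squared prediction error with respect to the filter, up to a factor. -/
def residualProduct (h : ℕ) (F : ℕ → Policy n m) (π : Policy n m) (s : Sample n m) :
    DirectionSpace n m :=
  directionOf (Matrix.vecMulVec (π *ᵥ S.regressor h F s - S.target h s) (S.regressor h F s))

theorem inner_directionOf_vecMulVec (e : Fin n → ℝ) (z : Fin n ⊕ Fin m → ℝ)
    (u : DirectionSpace n m) :
    inner ℝ (directionOf (Matrix.vecMulVec e z)) u = e ⬝ᵥ (directionMatrix u *ᵥ z) := by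
  simp only [PiLp.inner_apply, RCLike.inner_apply, conj_trivial, Fintype.sum_prod_type,
    dotProduct, Matrix.mulVec, Finset.mul_sum, directionOf_apply, Matrix.vecMulVec_apply,
    directionMatrix_apply]
  exact Finset.sum_congr rfl fun i _ => Finset.sum_congr rfl fun j _ => by ring

/-- In the symmetric difference the terms even in `r` cancel. What remains is `4r⟨G, U⟩`, so
dividing by `2r` removes the radius altogether. -/
theorem directionOf_twoPointOracle (h : ℕ) (F : ℕ → Policy n m) {r : ℝ} (hr : r ≠ 0)
    (π : Policy n m) (s : Sample n m) :
    directionOf (S.twoPointOracle h F r π s) =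
      (2 * ((n * (m + n) : ℕ) : ℝ) * inner ℝ (S.residualProduct h F π s) s.1) • s.1 := by
  rw [twoPointOracle, directionOf_smul, Sample.dir, directionOf_directionMatrix]
  congr 1
  rw [sampleCost_eq, sampleCost_eq, residualProduct, inner_directionOf_vecMulVec]
  set z := S.regressor h F s
  set x := S.target h s
  set u := directionMatrix s.1
  have h1 : x - (π + r • u) *ᵥ z = (x - π *ᵥ z) - r • (u *ᵥ z) := by
    rw [Matrix.add_mulVec, Matrix.smul_mulVec]; abel
  have h2 : x - (π - r • u) *ᵥ z = (x - π *ᵥ z) + r • (u *ᵥ z) := by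
    rw [Matrix.sub_mulVec, Matrix.smul_mulVec]; abel
  have h3 : π *ᵥ z - x = -(x - π *ᵥ z) := by abel
  rw [h1, h2, h3]
  set e := x - π *ᵥ z
  set v := u *ᵥ z
  simp only [dotProduct_add, add_dotProduct, dotProduct_sub, sub_dotProduct, smul_dotProduct,
    dotProduct_smul, smul_eq_mul, neg_dotProduct]
  rw [dotProduct_comm v e]
  field_simp
  ring

/-! ### Pathwise bounds -/

/-- A random variable dominating the trajectory up to time `h + 1`. -/
def _root_.Sample.size (h : ℕ) (s : Sample n m) : ℝ :=
  1 + ‖s.init‖ + ‖s.inject‖ + ∑ t ∈ Finset.range (h + 1), (‖s.process t‖ + ‖s.meas t‖)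

/-- The summand 1 in `Sample.size` serves to absorb deterministic terms such as `xbar`. -/
theorem _root_.Sample.one_le_size (h : ℕ) (s : Sample n m) : 1 ≤ s.size h := by
  have : 0 ≤ ∑ t ∈ Finset.range (h + 1), (‖s.process t‖ + ‖s.meas t‖) :=
    Finset.sum_nonneg fun _ _ => by positivity
  have h1 := norm_nonneg s.init
  have h2 := norm_nonneg s.inject
  unfold Sample.size
  linarith

theorem _root_.Sample.norms_le_size {h : ℕ} (s : Sample n m) :
    ‖s.init‖ + ‖s.inject‖ ≤ s.size h ∧ ∀ t ≤ h, ‖s.process t‖ + ‖s.inject‖ ≤ s.size h ∧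
      ‖s.meas t‖ ≤ s.size h := by
  have h0 : 0 ≤ ∑ t ∈ Finset.range (h + 1), (‖s.process t‖ + ‖s.meas t‖) :=
    Finset.sum_nonneg fun _ _ => by positivity
  have h1 := norm_nonneg s.init
  have h2 := norm_nonneg s.inject
  refine ⟨by unfold Sample.size; linarith, fun t ht => ?_⟩
  have h3 : ‖s.process t‖ + ‖s.meas t‖ ≤
      ∑ t ∈ Finset.range (h + 1), (‖s.process t‖ + ‖s.meas t‖) :=
    Finset.single_le_sum (f := fun t => ‖s.process t‖ + ‖s.meas t‖)
      (fun _ _ => by positivity) (by simpa [Nat.lt_succ_iff] using ht)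
  have h4 := norm_nonneg (s.process t)
  have h5 := norm_nonneg (s.meas t)
  constructor <;> unfold Sample.size <;> linarith

theorem norm_ite_inject_le (p : Prop) [Decidable p] (s : Sample n m) :
    ‖if p then s.inject else 0‖ ≤ ‖s.inject‖ := by
  split_ifs <;> simp

theorem exists_norm_state_le (h t : ℕ) (ht : t ≤ h + 1) :
    ∃ C : ℝ, 0 ≤ C ∧ ∀ s : Sample n m, ‖S.state h s t‖ ≤ C * s.size h := by
  induction t with
  | zero =>
    refine ⟨1, zero_le_one, fun s => ?_⟩
    rw [one_mul]
    exact (norm_add_le _ _).trans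
      ((add_le_add le_rfl (norm_ite_inject_le _ s)).trans s.norms_le_size.1)
  | succ t ih =>
    obtain ⟨C, hC, hb⟩ := ih (by omega)
    refine ⟨Fintype.card (Fin n) * ‖S.A‖ * C + 1, by positivity, fun s => ?_⟩
    simp only [state]
    calc _ ≤ ‖S.A *ᵥ S.state h s t‖ + ‖s.process t‖ + ‖s.inject‖ :=
          (norm_add_le _ _).trans (add_le_add (norm_add_le _ _) (norm_ite_inject_le _ s))
      _ ≤ Fintype.card (Fin n) * ‖S.A‖ * (C * s.size h) + s.size h := by
          rw [add_assoc]
          refine add_le_add ((norm_mulVec_le_card_mul _ _).trans ?_)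
            (s.norms_le_size.2 t (by omega)).1
          gcongr
          exact hb s
      _ = _ := by ring

theorem exists_norm_output_le (h t : ℕ) (ht : t ≤ h) :
    ∃ C : ℝ, 0 ≤ C ∧ ∀ s : Sample n m, ‖S.output h s t‖ ≤ C * s.size h := by
  obtain ⟨C, hC, hb⟩ := S.exists_norm_state_le h t (by omega)
  refine ⟨Fintype.card (Fin n) * ‖S.C‖ * C + 1, by positivity, fun s => ?_⟩
  calc _ ≤ ‖S.C *ᵥ S.state h s t‖ + ‖s.meas t‖ := norm_add_le _ _
    _ ≤ Fintype.card (Fin n) * ‖S.C‖ * (C * s.size h) + s.size h := by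
        refine add_le_add ((norm_mulVec_le_card_mul _ _).trans ?_) (s.norms_le_size.2 t ht).2
        gcongr
        exact hb s
    _ = _ := by ring

theorem norm_sumElim_le {ι κ : Type*} [Fintype ι] [Fintype κ] (x : ι → ℝ) (y : κ → ℝ) :
    ‖Sum.elim x y‖ ≤ ‖x‖ + ‖y‖ := by
  refine (pi_norm_le_iff_of_nonneg (by positivity)).2 ?_
  rintro (i | i)
  · exact (norm_le_pi_norm x i).trans (by simp)
  · exact (norm_le_pi_norm y i).trans (by simp)

/-- The constant is chosen before the filters and depends on them only through `R`; this is the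
source of uniformity over the earlier stages. -/
theorem exists_norm_estimate_le (h t : ℕ) (ht : t ≤ h) {R : ℝ} (hR : 0 ≤ R) :
    ∃ C : ℝ, 0 ≤ C ∧ ∀ F : ℕ → Policy n m, (∀ j < t, ‖F j‖ ≤ R) →
      ∀ s : Sample n m, ‖S.estimate h F s t‖ ≤ C * s.size h := by
  induction t with
  | zero =>
    refine ⟨‖S.xbar‖ + 1, by positivity, fun F _ s => ?_⟩
    have h1 : ‖s.inject‖ ≤ s.size h :=
      le_trans (by linarith [norm_nonneg s.init]) s.norms_le_size.1
    calc _ ≤ ‖S.xbar‖ + ‖s.inject‖ :=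
          (norm_add_le _ _).trans (add_le_add le_rfl (norm_ite_inject_le _ s))
      _ ≤ ‖S.xbar‖ * s.size h + s.size h := by
          refine add_le_add (le_mul_of_one_le_right (norm_nonneg _) (s.one_le_size h)) h1
      _ = _ := by ring
  | succ t ih =>
    obtain ⟨C, hC, hb⟩ := ih (by omega)
    obtain ⟨C', hC', hb'⟩ := S.exists_norm_output_le h t (by omega)
    refine ⟨Fintype.card (Fin n ⊕ Fin m) * R * (C + C') + 1, by positivity, fun F hF s => ?_⟩
    have h1 : ‖s.inject‖ ≤ s.size h :=
      le_trans (by linarith [norm_nonneg s.init]) s.norms_le_size.1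
    have h0 := s.one_le_size h
    simp only [estimate, Policy.predict]
    refine ((norm_add_le _ _).trans (add_le_add (norm_mulVec_le_card_mul _ _)
      ((norm_ite_inject_le _ s).trans h1))).trans ?_
    calc Fintype.card (Fin n ⊕ Fin m) * ‖F t‖ *
          ‖Sum.elim (S.estimate h F s t) (S.output h s t)‖ + s.size h
        ≤ Fintype.card (Fin n ⊕ Fin m) * R * (C * s.size h + C' * s.size h) + s.size h := by
          gcongr
          · exact hF t (by omega)
          · exact (norm_sumElim_le _ _).trans
              (add_le_add (hb F (fun j hj => hF j (by omega)) s) (hb' s))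
      _ = _ := by ring

/-- The estimates depend on the filters in a Lipschitz way. -/
theorem exists_norm_estimate_sub_le (h t : ℕ) (ht : t ≤ h) {R : ℝ} (hR : 0 ≤ R) :
    ∃ C : ℝ, 0 ≤ C ∧ ∀ F G : ℕ → Policy n m, (∀ j < t, ‖F j‖ ≤ R) → (∀ j < t, ‖G j‖ ≤ R) →
      ∀ a : ℝ, 0 ≤ a → (∀ j < t, ‖F j - G j‖ ≤ a) →
      ∀ s : Sample n m, ‖S.estimate h F s t - S.estimate h G s t‖ ≤ C * a * s.size h := by
  induction t with
  | zero => exact ⟨0, le_rfl, fun F G _ _ a _ _ s => by simp [estimate]⟩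
  | succ t ih =>
    obtain ⟨C, hC, hb⟩ := ih (by omega)
    obtain ⟨C', hC', hb'⟩ := S.exists_norm_output_le h t (by omega)
    obtain ⟨C'', hC'', hb''⟩ := S.exists_norm_estimate_le h t (by omega) hR
    refine ⟨Fintype.card (Fin n ⊕ Fin m) * (C'' + C') + Fintype.card (Fin n ⊕ Fin m) * R * C,
      by positivity, fun F G hF hG a ha hFG s => ?_⟩
    have h0 := s.one_le_size h
    have hsplit : S.estimate h F s (t + 1) - S.estimate h G s (t + 1) =
        (F t - G t) *ᵥ Sum.elim (S.estimate h F s t) (S.output h s t) +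
          G t *ᵥ Sum.elim (S.estimate h F s t - S.estimate h G s t) 0 := by
      have : Sum.elim (S.estimate h F s t - S.estimate h G s t) (0 : Fin m → ℝ) =
          Sum.elim (S.estimate h F s t) (S.output h s t) -
            Sum.elim (S.estimate h G s t) (S.output h s t) := by
        ext (i | i) <;> simp
      rw [this, Matrix.mulVec_sub, Matrix.sub_mulVec]
      simp only [estimate, Policy.predict]
      abel
    rw [hsplit]
    refine ((norm_add_le _ _).trans (add_le_add (norm_mulVec_le_card_mul _ _)
      (norm_mulVec_le_card_mul _ _))).trans ?_
    calc _ ≤ Fintype.card (Fin n ⊕ Fin m) * a * (C'' * s.size h + C' * s.size h) +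
          Fintype.card (Fin n ⊕ Fin m) * R * (C * a * s.size h) := by
          gcongr
          · exact hFG t (by omega)
          · exact (norm_sumElim_le _ _).trans
              (add_le_add (hb'' F (fun j hj => hF j (by omega)) s) (hb' s))
          · exact hG t (by omega)
          · refine (norm_sumElim_le _ _).trans ?_
            rw [norm_zero, add_zero]
            exact hb F G (fun j hj => hF j (by omega)) (fun j hj => hG j (by omega)) a ha
              (fun j hj => hFG j (by omega)) s
      _ = _ := by ring

theorem exists_norm_regressor_le (h : ℕ) {R : ℝ} (hR : 0 ≤ R) :
    ∃ C : ℝ, 0 ≤ C ∧ (∀ s : Sample n m, ‖S.target h s‖ ≤ C * s.size h) ∧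
      ∀ F : ℕ → Policy n m, (∀ j < h, ‖F j‖ ≤ R) →
      ∀ s : Sample n m, ‖S.regressor h F s‖ ≤ C * s.size h := by
  obtain ⟨C, hC, hb⟩ := S.exists_norm_state_le h (h + 1) le_rfl
  obtain ⟨C', hC', hb'⟩ := S.exists_norm_output_le h h le_rfl
  obtain ⟨C'', hC'', hb''⟩ := S.exists_norm_estimate_le h h le_rfl hR
  refine ⟨C + (C'' + C'), by positivity, fun s => (hb s).trans ?_, fun F hF s => ?_⟩
  · have := s.one_le_size h
    gcongr
    linarith
  · have := s.one_le_size h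
    calc _ ≤ _ := norm_sumElim_le _ _
      _ ≤ C'' * s.size h + C' * s.size h := add_le_add (hb'' F hF s) (hb' s)
      _ = 0 * s.size h + (C'' + C') * s.size h := by ring
      _ ≤ C * s.size h + (C'' + C') * s.size h := by gcongr
      _ = _ := by ring

theorem exists_norm_regressor_sub_le (h : ℕ) {R : ℝ} (hR : 0 ≤ R) :
    ∃ C : ℝ, 0 ≤ C ∧ ∀ F G : ℕ → Policy n m, (∀ j < h, ‖F j‖ ≤ R) → (∀ j < h, ‖G j‖ ≤ R) →
      ∀ a : ℝ, 0 ≤ a → (∀ j < h, ‖F j - G j‖ ≤ a) →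
      ∀ s : Sample n m, ‖S.regressor h F s - S.regressor h G s‖ ≤ C * a * s.size h := by
  obtain ⟨C, hC, hb⟩ := S.exists_norm_estimate_sub_le h h le_rfl hR
  refine ⟨C, hC, fun F G hF hG a ha hFG s => ?_⟩
  have : S.regressor h F s - S.regressor h G s =
      Sum.elim (S.estimate h F s h - S.estimate h G s h) 0 := by
    ext (i | i) <;> simp [regressor]
  rw [this]
  refine (norm_sumElim_le _ _).trans ?_
  rw [norm_zero, add_zero]
  exact hb F G hF hG a ha hFG s

/-! ### Measurability -/

theorem measurable_state (h t : ℕ) : Measurable fun s : Sample n m => S.state h s t := by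
  have hinj : ∀ (p : Prop) [Decidable p],
      Measurable fun s : Sample n m => if p then s.inject else 0 := by
    intro p _
    split_ifs
    · unfold Sample.inject; fun_prop
    · fun_prop
  induction t with
  | zero =>
    exact Measurable.add (by unfold Sample.init; fun_prop) (hinj _)
  | succ t ih =>
    refine Measurable.add (Measurable.add ?_ (by unfold Sample.process; fun_prop)) (hinj _)
    exact (Continuous.matrix_mulVec continuous_const continuous_id).measurable.comp ih

theorem measurable_output (h t : ℕ) : Measurable fun s : Sample n m => S.output h s t := by
  refine Measurable.add ?_ (by unfold Sample.meas; fun_prop)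
  exact (Continuous.matrix_mulVec continuous_const continuous_id).measurable.comp
    (S.measurable_state h t)

/-- Joint measurability in filters and sample is required because in a run the earlier filters are
themselves random. Filters are parametrized by vectors of `DirectionSpace`. -/
theorem measurable_estimate (h t : ℕ) :
    Measurable fun q : (ℕ → DirectionSpace n m) × Sample n m =>
      S.estimate h (fun j => directionMatrix (q.1 j)) q.2 t := by
  have hinj : ∀ (p : Prop) [Decidable p],
      Measurable fun q : (ℕ → DirectionSpace n m) × Sample n m =>
        if p then q.2.inject else 0 := by
    intro p _
    split_ifs
    · unfold Sample.inject; fun_prop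
    · fun_prop
  induction t with
  | zero => exact measurable_const.add (hinj _)
  | succ t ih =>
    refine Measurable.add ?_ (hinj _)
    have hout := (S.measurable_output h t).comp
      (measurable_snd : Measurable (Prod.snd : (ℕ → DirectionSpace n m) × Sample n m → _))
    refine measurable_pi_iff.2 fun i => ?_
    simp only [Policy.predict, Matrix.mulVec, dotProduct, directionMatrix_apply,
      Fintype.sum_sum_type, Sum.elim_inl, Sum.elim_inr]
    refine Measurable.add (Finset.measurable_sum _ fun j _ => ?_)
      (Finset.measurable_sum _ fun j _ => ?_)
    · exact Measurable.mul (by fun_prop) ((measurable_pi_apply j).comp ih)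
    · exact Measurable.mul (by fun_prop) ((measurable_pi_apply j).comp hout)

theorem measurable_regressor (h : ℕ) :
    Measurable fun q : (ℕ → DirectionSpace n m) × Sample n m =>
      S.regressor h (fun j => directionMatrix (q.1 j)) q.2 := by
  refine measurable_pi_iff.2 ?_
  rintro (i | i)
  · exact (measurable_pi_apply i).comp (S.measurable_estimate h h)
  · exact (measurable_pi_apply i).comp ((S.measurable_output h h).comp measurable_snd)

theorem measurable_estimate_right (h t : ℕ) (F : ℕ → Policy n m) :
    Measurable fun s : Sample n m => S.estimate h F s t :=
  (S.measurable_estimate h t).comp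
    (measurable_prodMk_left (x := fun j => directionOf (F j)))

theorem measurable_residualProduct (h : ℕ) :
    Measurable fun q : (ℕ → DirectionSpace n m) × DirectionSpace n m × Sample n m =>
      S.residualProduct h (fun j => directionMatrix (q.1 j)) (directionMatrix q.2.1) q.2.2 := by
  have hreg := (S.measurable_regressor h).comp
    (f := fun q : (ℕ → DirectionSpace n m) × DirectionSpace n m × Sample n m => (q.1, q.2.2))
    (by fun_prop)
  have htar := (S.measurable_state h (h + 1)).comp
    (f := fun q : (ℕ → DirectionSpace n m) × DirectionSpace n m × Sample n m => q.2.2)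
    (by fun_prop)
  refine (WithLp.measurable_toLp 2 _).comp (measurable_pi_iff.2 fun i => ?_)
  simp only [Matrix.vecMulVec_apply, Matrix.mulVec, dotProduct, directionMatrix_apply,
    Pi.sub_apply]
  refine Measurable.mul (Measurable.sub (Finset.measurable_sum _ fun j _ => ?_)
    ((measurable_pi_apply _).comp htar)) ((measurable_pi_apply _).comp hreg)
  exact Measurable.mul (by fun_prop) ((measurable_pi_apply j).comp hreg)

end KFSystem

/-! ### Moments of the trajectories -/

/-- A positive definite quadratic form dominates a multiple of the Euclidean norm. -/
theorem Matrix.PosDef.exists_pos_mul_dotProduct_le {ι : Type*} [Fintype ι]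
    {Q : Matrix ι ι ℝ} (hQ : Q.PosDef) :
    ∃ μ : ℝ, 0 < μ ∧ ∀ a : ι → ℝ, μ * (a ⬝ᵥ a) ≤ a ⬝ᵥ Q *ᵥ a := by
  classical
  rcases isEmpty_or_nonempty ι with hι | hι
  · exact ⟨1, one_pos, fun a => by simp [dotProduct]⟩
  obtain ⟨i⟩ := hι
  have hcont : Continuous fun x : EuclideanSpace ℝ ι => x.ofLp ⬝ᵥ Q *ᵥ x.ofLp := by
    simp only [dotProduct, Matrix.mulVec]
    fun_prop
  obtain ⟨x, hx, hmin⟩ := (isCompact_sphere (0 : EuclideanSpace ℝ ι) 1).exists_isMinOn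
    ⟨EuclideanSpace.single i 1, by simp⟩ hcont.continuousOn
  have hx1 : ‖x‖ = 1 := by simpa using hx
  have hpos : ∀ a : ι → ℝ, a ≠ 0 → 0 < a ⬝ᵥ Q *ᵥ a := fun a ha => by
    simpa using hQ.dotProduct_mulVec_pos ha
  refine ⟨_, hpos x.ofLp ?_, fun a => ?_⟩
  · intro h0
    have : x = 0 := by ext i; simp [h0]
    rw [this] at hx1
    simp at hx1
  · by_cases ha : a = 0
    · simp [ha]
    set v : EuclideanSpace ℝ ι := WithLp.toLp 2 a
    have hv0 : v ≠ 0 := by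
      intro h
      apply ha
      ext i
      exact congrArg (fun w : EuclideanSpace ℝ ι => w i) h
    have hv : 0 < ‖v‖ := norm_pos_iff.2 hv0
    have h1 := hmin (show ‖v‖⁻¹ • v ∈ Metric.sphere (0 : EuclideanSpace ℝ ι) 1 by
      simp [norm_smul, hv.ne'])
    have hav : a ⬝ᵥ a = ‖v‖ ^ 2 := by
      rw [EuclideanSpace.real_norm_sq_eq]
      simp [dotProduct, v, sq]
    have h2 : (‖v‖⁻¹ • v).ofLp ⬝ᵥ Q *ᵥ (‖v‖⁻¹ • v).ofLp = (‖v‖ ^ 2)⁻¹ * (a ⬝ᵥ Q *ᵥ a) := by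
      simp only [WithLp.ofLp_smul, Matrix.mulVec_smul, smul_dotProduct, dotProduct_smul,
        smul_eq_mul, v]
      ring
    simp only [Set.mem_ofPred_eq] at h1
    rw [h2] at h1
    rw [hav]
    calc _ ≤ (‖v‖ ^ 2)⁻¹ * (a ⬝ᵥ Q *ᵥ a) * ‖v‖ ^ 2 := by gcongr
      _ = _ := by field_simp

/-- The growth constant of the oracle has the form `C q²`, so Gaussian tails of `q` give it an
exponential moment. Half of the exponent `c` pays for the polynomial factor and half for the
exponential one. -/
theorem HasSquareExpMoment.exists_integrable {Ω : Type*} [MeasurableSpace Ω] {P : Measure Ω}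
    {q : Ω → ℝ} (h : HasSquareExpMoment P q) {C : ℝ} (hC : 0 ≤ C) :
    ∃ s : ℝ, 0 < s ∧
      Integrable (fun ω => (C * q ω ^ 2) ^ 2 * Real.exp (s * (C * q ω ^ 2))) P := by
  obtain ⟨hm, h0, c, hc, hi⟩ := h
  refine ⟨c / (2 * (C + 1)), by positivity, ?_⟩
  refine (hi.const_mul (C ^ 2 * (8 / c ^ 2))).mono' (by fun_prop) (.of_forall fun ω => ?_)
  rw [Real.norm_of_nonneg (by positivity)]
  have h1 : c / (2 * (C + 1)) * (C * q ω ^ 2) ≤ c / 2 * q ω ^ 2 := by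
    have : C / (C + 1) ≤ 1 := by rw [div_le_one (by positivity)]; linarith
    calc c / (2 * (C + 1)) * (C * q ω ^ 2) = c / 2 * q ω ^ 2 * (C / (C + 1)) := by
          field_simp
      _ ≤ c / 2 * q ω ^ 2 * 1 := by gcongr
      _ = _ := mul_one _
  have h2 : (q ω ^ 2) ^ 2 ≤ 8 / c ^ 2 * Real.exp (c / 2 * q ω ^ 2) := by
    have h3 := Real.quadratic_le_exp_of_nonneg (x := c / 2 * q ω ^ 2) (by positivity)
    have h4 : (c / 2 * q ω ^ 2) ^ 2 / 2 ≤ Real.exp (c / 2 * q ω ^ 2) := by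
      have : 0 ≤ c / 2 * q ω ^ 2 := by positivity
      linarith
    rw [div_mul_eq_mul_div, le_div_iff₀ (by positivity)]
    nlinarith
  calc (C * q ω ^ 2) ^ 2 * Real.exp (c / (2 * (C + 1)) * (C * q ω ^ 2))
      ≤ (C ^ 2 * (8 / c ^ 2 * Real.exp (c / 2 * q ω ^ 2))) * Real.exp (c / 2 * q ω ^ 2) := by
        rw [mul_pow]
        gcongr
    _ = C ^ 2 * (8 / c ^ 2) * (Real.exp (c / 2 * q ω ^ 2 + c / 2 * q ω ^ 2)) := by
        rw [Real.exp_add]; ring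
    _ = _ := by ring_nf

theorem CoordL2.of_norm_le {Ω ι : Type*} [MeasurableSpace Ω] {P : Measure Ω} [IsFiniteMeasure P]
    [Fintype ι] {X : Ω → ι → ℝ} {q : Ω → ℝ} (hq : HasSquareExpMoment P q) (hX : Measurable X)
    {C : ℝ} (h : ∀ ω, ‖X ω‖ ≤ C * q ω) : CoordL2 P X := by
  intro i
  refine (hq.memLp_two.const_mul C).mono' ((measurable_pi_apply i).comp hX).aestronglyMeasurable
    (.of_forall fun ω => ?_)
  exact (norm_le_pi_norm _ i).trans (h ω)

theorem Matrix.trace_mul_mul_transpose {ι κ : Type*} [Fintype ι] [Fintype κ]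
    (D : Matrix ι κ ℝ) (M : Matrix κ κ ℝ) :
    (D * M * Dᵀ).trace = ∑ i, D i ⬝ᵥ M *ᵥ D i := by
  simp only [Matrix.trace, Matrix.diag, Matrix.mul_apply, Matrix.transpose_apply, dotProduct,
    Matrix.mulVec, Finset.mul_sum, Finset.sum_mul]
  refine Finset.sum_congr rfl fun i _ => ?_
  rw [Finset.sum_comm]
  exact Finset.sum_congr rfl fun j _ => Finset.sum_congr rfl fun k _ => by ring

theorem integral_dotProduct {Ω ι : Type*} [MeasurableSpace Ω] {P : Measure Ω} [Fintype ι]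
    {X Z : Ω → ι → ℝ} (hX : CoordL2 P X) (hZ : CoordL2 P Z) :
    ∫ ω, X ω ⬝ᵥ Z ω ∂P = (crossMoment P X Z).trace := by
  simp only [dotProduct]
  rw [integral_finsetSum _ fun i _ => hX.integrable_mul hZ i i]
  rfl

theorem integrable_dotProduct {Ω ι : Type*} [MeasurableSpace Ω] {P : Measure Ω} [Fintype ι]
    {X Z : Ω → ι → ℝ} (hX : CoordL2 P X) (hZ : CoordL2 P Z) :
    Integrable (fun ω => X ω ⬝ᵥ Z ω) P :=
  integrable_finsetSum _ fun i _ => hX.integrable_mul hZ i i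

namespace KFSystem

variable {n m : ℕ} (S : KFSystem n m)

/-! ### Square integrability -/

theorem hasSquareExpMoment_size (hn : 0 < n) (h : ℕ) :
    HasSquareExpMoment S.sampleLaw fun s => s.size h := by
  have := S.isProbabilityMeasure_sampleLaw hn
  have hg : ∀ {k : ℕ} (μ : Fin k → ℝ) (Q : Matrix (Fin k) (Fin k) ℝ),
      HasSquareExpMoment (gaussianVec μ Q) fun x => ‖x‖ := fun μ Q =>
    ⟨measurable_norm, fun _ => norm_nonneg _, exists_integrable_exp_sq_gaussianVec μ Q⟩
  exact (((HasSquareExpMoment.of_const zero_le_one).add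
    ((hg _ _).comp (S.measurePreserving_init hn))).add
    ((hg _ _).comp (S.measurePreserving_inject hn))).add
    (.sum _ fun t => ((hg _ _).comp (S.measurePreserving_process hn t)).add
      ((hg _ _).comp (S.measurePreserving_meas hn t)))

theorem coordL2_inject (hn : 0 < n) : CoordL2 S.sampleLaw (Sample.inject (n := n) (m := m)) :=
  CoordL2.comp (X := id) (S.measurePreserving_inject hn) (memLp_eval_gaussianVec _ _)

theorem coordL2_process (hn : 0 < n) (t : ℕ) :
    CoordL2 S.sampleLaw fun s : Sample n m => s.process t :=
  CoordL2.comp (X := id) (S.measurePreserving_process hn t) (memLp_eval_gaussianVec _ _)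

theorem coordL2_meas (hn : 0 < n) (t : ℕ) :
    CoordL2 S.sampleLaw fun s : Sample n m => s.meas t :=
  CoordL2.comp (X := id) (S.measurePreserving_meas hn t) (memLp_eval_gaussianVec _ _)

theorem coordL2_state (hn : 0 < n) {h t : ℕ} (ht : t ≤ h + 1) :
    CoordL2 S.sampleLaw fun s : Sample n m => S.state h s t := by
  have := S.isProbabilityMeasure_sampleLaw hn
  obtain ⟨C, _, hC⟩ := S.exists_norm_state_le h t ht
  exact .of_norm_le (S.hasSquareExpMoment_size hn h) (S.measurable_state h t) hC

theorem coordL2_estimate (hn : 0 < n) {h t : ℕ} (ht : t ≤ h) (F : ℕ → Policy n m) :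
    CoordL2 S.sampleLaw fun s : Sample n m => S.estimate h F s t := by
  have := S.isProbabilityMeasure_sampleLaw hn
  obtain ⟨C, _, hC⟩ := S.exists_norm_estimate_le h t ht
    (R := ∑ j ∈ Finset.range t, ‖F j‖) (Finset.sum_nonneg fun _ _ => norm_nonneg _)
  exact .of_norm_le (S.hasSquareExpMoment_size hn h) (S.measurable_estimate_right h t F)
    (hC F fun j hj => Finset.single_le_sum (f := fun j => ‖F j‖) (fun _ _ => norm_nonneg _)
      (Finset.mem_range.2 hj))

theorem coordL2_output (hn : 0 < n) {h t : ℕ} (ht : t ≤ h) :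
    CoordL2 S.sampleLaw fun s : Sample n m => S.output h s t :=
  ((S.coordL2_state hn (by omega)).mulVec S.C).add (S.coordL2_meas hn t)

theorem coordL2_regressor (hn : 0 < n) (h : ℕ) (F : ℕ → Policy n m) :
    CoordL2 S.sampleLaw fun s : Sample n m => S.regressor h F s :=
  (S.coordL2_estimate hn le_rfl F).sumElim (S.coordL2_output hn le_rfl)

theorem coordL2_target (hn : 0 < n) (h : ℕ) :
    CoordL2 S.sampleLaw fun s : Sample n m => S.target h s := S.coordL2_state hn le_rfl

theorem integrable_sampleCost (hn : 0 < n) (h : ℕ) (F : ℕ → Policy n m) (π : Policy n m) :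
    Integrable (S.sampleCost h F π) S.sampleLaw := by
  have he : Integrable (S.earlierCost h F) S.sampleLaw := by
    refine integrable_finsetSum _ fun t ht => ?_
    have ht' : t ≤ h := by simpa [Nat.lt_succ_iff] using ht
    have := (S.coordL2_state hn (by omega : t ≤ h + 1)).sub (S.coordL2_estimate hn ht' F)
    exact integrable_dotProduct this this
  have hp := (S.coordL2_target hn h).sub ((S.coordL2_regressor hn h F).mulVec π)
  exact (he.add (integrable_dotProduct hp hp)).congr
    (.of_forall fun s => (S.sampleCost_eq h F π s).symm)

/-! ### Nondegeneracy of the regressors -/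

theorem crossMoment_inject (hn : 0 < n) (hΘ : S.Θ.PosSemidef) :
    crossMoment S.sampleLaw (Sample.inject (n := n) (m := m)) Sample.inject = S.Θ := by
  ext i j
  have h := integral_mul_gaussianVec 0 S.Θ hΘ i j
  rw [← (S.measurePreserving_inject hn).map_eq,
    integral_map (S.measurePreserving_inject hn).aemeasurable (by fun_prop)] at h
  simpa [crossMoment] using h

theorem crossMoment_process (hn : 0 < n) (hW : S.W.PosSemidef) (t : ℕ) :
    crossMoment S.sampleLaw (fun s : Sample n m => s.process t) (fun s => s.process t) = S.W := by
  ext i j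
  have h := integral_mul_gaussianVec 0 S.W hW i j
  rw [← (S.measurePreserving_process hn t).map_eq,
    integral_map (S.measurePreserving_process hn t).aemeasurable (by fun_prop)] at h
  simpa [crossMoment] using h

theorem crossMoment_meas (hn : 0 < n) (hV : S.V.PosSemidef) (t : ℕ) :
    crossMoment S.sampleLaw (fun s : Sample n m => s.meas t) (fun s => s.meas t) = S.V := by
  ext i j
  have h := integral_mul_gaussianVec 0 S.V hV i j
  rw [← (S.measurePreserving_meas hn t).map_eq,
    integral_map (S.measurePreserving_meas hn t).aemeasurable (by fun_prop)] at h
  simpa [crossMoment] using h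

theorem crossMoment_init (hn : 0 < n) (hX : S.X₀.PosSemidef) :
    crossMoment S.sampleLaw (fun s : Sample n m => s.init - S.xbar) (fun s => s.init - S.xbar) =
      S.X₀ := by
  ext i j
  have h := integral_mul_gaussianVec S.xbar S.X₀ hX i j
  rw [← (S.measurePreserving_init hn).map_eq,
    integral_map (S.measurePreserving_init hn).aemeasurable (by fun_prop)] at h
  simpa [crossMoment] using h

/-- Change the sign of the initial deviation. -/
def flipInit (s : Sample n m) : Sample n m := S.reflect (-1) (fun _ => 1) (fun _ => 1) 1 s

/-- Change the sign of one process noise. -/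
def flipDynamics (k : ℕ) (s : Sample n m) : Sample n m :=
  S.reflect 1 (fun t => if t = k then -1 else 1) (fun _ => 1) 1 s

/-- Change the sign of one measurement noise. -/
def flipMeas (k : ℕ) (s : Sample n m) : Sample n m :=
  S.reflect 1 (fun _ => 1) (fun t => if t = k then -1 else 1) 1 s

/-- Change the sign of the injected noise. -/
def flipInject (s : Sample n m) : Sample n m := S.reflect 1 (fun _ => 1) (fun _ => 1) (-1) s

theorem measurePreserving_flipInit (hn : 0 < n) :
    MeasurePreserving S.flipInit S.sampleLaw S.sampleLaw :=
  S.measurePreserving_reflect hn (.inr rfl) (fun _ => .inl rfl) (fun _ => .inl rfl) (.inl rfl)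

theorem measurePreserving_flipDynamics (hn : 0 < n) (k : ℕ) :
    MeasurePreserving (S.flipDynamics k) S.sampleLaw S.sampleLaw :=
  S.measurePreserving_reflect hn (.inl rfl) (fun t => by split_ifs <;> simp) (fun _ => .inl rfl)
    (.inl rfl)

theorem measurePreserving_flipMeas (hn : 0 < n) (k : ℕ) :
    MeasurePreserving (S.flipMeas k) S.sampleLaw S.sampleLaw :=
  S.measurePreserving_reflect hn (.inl rfl) (fun _ => .inl rfl) (fun t => by split_ifs <;> simp)
    (.inl rfl)

theorem measurePreserving_flipInject (hn : 0 < n) :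
    MeasurePreserving S.flipInject S.sampleLaw S.sampleLaw :=
  S.measurePreserving_reflect hn (.inl rfl) (fun _ => .inl rfl) (fun _ => .inl rfl) (.inr rfl)

/-! ### Action of the sign changes on trajectories. -/

section Flips

variable (s : Sample n m) (k t : ℕ)

@[simp] theorem init_flipInit : (S.flipInit s).init = S.xbar - (s.init - S.xbar) := by
  ext i; simp [flipInit, reflect, Sample.init]; ring

@[simp] theorem inject_flipInit : (S.flipInit s).inject = s.inject := by
  ext i; simp [flipInit, reflect, Sample.inject]

@[simp] theorem init_flipDynamics : (S.flipDynamics k s).init = s.init := by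
  ext i; simp [flipDynamics, reflect, Sample.init]

@[simp] theorem process_flipDynamics : (S.flipDynamics k s).process k = -s.process k := by
  ext i; simp [flipDynamics, reflect, Sample.process]

theorem process_flipDynamics_of_ne {t k : ℕ} (htk : t ≠ k) :
    (S.flipDynamics k s).process t = s.process t := by
  ext i; simp [flipDynamics, reflect, Sample.process, htk]

@[simp] theorem meas_flipDynamics : (S.flipDynamics k s).meas t = s.meas t := by
  ext i; simp [flipDynamics, reflect, Sample.meas]

@[simp] theorem inject_flipDynamics : (S.flipDynamics k s).inject = s.inject := by
  ext i; simp [flipDynamics, reflect, Sample.inject]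

@[simp] theorem init_flipMeas : (S.flipMeas k s).init = s.init := by
  ext i; simp [flipMeas, reflect, Sample.init]

@[simp] theorem process_flipMeas : (S.flipMeas k s).process t = s.process t := by
  ext i; simp [flipMeas, reflect, Sample.process]

@[simp] theorem meas_flipMeas : (S.flipMeas k s).meas k = -s.meas k := by
  ext i; simp [flipMeas, reflect, Sample.meas]

theorem meas_flipMeas_of_ne {t k : ℕ} (htk : t ≠ k) : (S.flipMeas k s).meas t = s.meas t := by
  ext i; simp [flipMeas, reflect, Sample.meas, htk]

@[simp] theorem inject_flipMeas : (S.flipMeas k s).inject = s.inject := by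
  ext i; simp [flipMeas, reflect, Sample.inject]

@[simp] theorem init_flipInject : (S.flipInject s).init = s.init := by
  ext i; simp [flipInject, reflect, Sample.init]

@[simp] theorem process_flipInject : (S.flipInject s).process t = s.process t := by
  ext i; simp [flipInject, reflect, Sample.process]

@[simp] theorem meas_flipInject : (S.flipInject s).meas t = s.meas t := by
  ext i; simp [flipInject, reflect, Sample.meas]

@[simp] theorem inject_flipInject : (S.flipInject s).inject = -s.inject := by
  ext i; simp [flipInject, reflect, Sample.inject]

theorem state_flipMeas (h : ℕ) : S.state h (S.flipMeas k s) t = S.state h s t := by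
  induction t with
  | zero => simp [state]
  | succ t ih => simp [state, ih]

theorem output_flipMeas_of_ne (h : ℕ) {t k : ℕ} (htk : t ≠ k) :
    S.output h (S.flipMeas k s) t = S.output h s t := by
  simp [output, state_flipMeas, meas_flipMeas_of_ne, htk]

theorem estimate_flipMeas_of_le (h : ℕ) (F : ℕ → Policy n m) {t k : ℕ} (htk : t ≤ k) :
    S.estimate h F (S.flipMeas k s) t = S.estimate h F s t := by
  induction t with
  | zero => simp [estimate]
  | succ t ih =>
    simp only [estimate, ih (by omega), inject_flipMeas,
      S.output_flipMeas_of_ne s h (show t ≠ k by omega)]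

theorem state_flipInject_of_lt {h t : ℕ} (ht : t < h) :
    S.state h (S.flipInject s) t = S.state h s t := by
  induction t with
  | zero => simp [state, show h ≠ 0 by omega]
  | succ t ih => simp [state, ih (by omega), show h ≠ t + 1 by omega]

theorem output_flipInject_of_lt {h t : ℕ} (ht : t < h) :
    S.output h (S.flipInject s) t = S.output h s t := by
  simp [output, S.state_flipInject_of_lt s ht]

theorem estimate_flipInject_of_lt {h t : ℕ} (F : ℕ → Policy n m) (ht : t < h) :
    S.estimate h F (S.flipInject s) t = S.estimate h F s t := by
  induction t with
  | zero => simp [estimate, show h ≠ 0 by omega]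
  | succ t ih =>
    simp [estimate, ih (by omega), S.output_flipInject_of_lt s (by omega : t < h),
      show h ≠ t + 1 by omega]

/-- The injected noise enters the state at time `h` only as the last summand, so removing it leaves
a vector that does not depend on it. -/
theorem state_flipInject (h : ℕ) :
    S.state h (S.flipInject s) h - (S.flipInject s).inject = S.state h s h - s.inject := by
  cases h with
  | zero => simp [state]
  | succ h => simp [state, S.state_flipInject_of_lt s (Nat.lt_succ_self h)]

theorem estimate_flipInject (h : ℕ) (F : ℕ → Policy n m) :
    S.estimate h F (S.flipInject s) h - (S.flipInject s).inject =
      S.estimate h F s h - s.inject := by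
  cases h with
  | zero => simp [estimate]
  | succ h =>
    simp [estimate, S.estimate_flipInject_of_lt s F (Nat.lt_succ_self h),
      S.output_flipInject_of_lt s (Nat.lt_succ_self h)]

end Flips

end KFSystem

/-! ### Uniform lower bound for the covariance of the regressor. -/

namespace KFSystem

variable {n m : ℕ} (S : KFSystem n m)

/-- The contribution of the injected noise and of the last measurement noise to the covariance of
the regressor. -/
def excitation : Matrix (Fin n ⊕ Fin m) (Fin n ⊕ Fin m) ℝ :=
  Matrix.fromRows (1 : Matrix (Fin n) (Fin n) ℝ) S.C * S.Θ *
    (Matrix.fromRows (1 : Matrix (Fin n) (Fin n) ℝ) S.C)ᵀ +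
    Matrix.fromRows (0 : Matrix (Fin n) (Fin m) ℝ) (1 : Matrix (Fin m) (Fin m) ℝ) * S.V *
      (Matrix.fromRows (0 : Matrix (Fin n) (Fin m) ℝ) (1 : Matrix (Fin m) (Fin m) ℝ))ᵀ

theorem dotProduct_mul_mul_transpose_mulVec {ι κ : Type*} [Fintype ι] [Fintype κ]
    (M : Matrix ι κ ℝ) (Q : Matrix κ κ ℝ) (a : ι → ℝ) :
    a ⬝ᵥ (M * Q * Mᵀ) *ᵥ a = (Mᵀ *ᵥ a) ⬝ᵥ Q *ᵥ (Mᵀ *ᵥ a) := by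
  rw [← Matrix.mulVec_mulVec, ← Matrix.mulVec_mulVec, Matrix.dotProduct_mulVec,
    ← Matrix.mulVec_transpose]

/-- On `a = (a₁, a₂)` the form is `Θ` evaluated at `a₁ + Cᵀ a₂` plus `V` evaluated at `a₂`. If `a₂ =
0`, the first term is positive. -/
theorem posDef_excitation (hV : S.V.PosDef) (hΘ : S.Θ.PosDef) : S.excitation.PosDef := by
  refine Matrix.PosDef.of_dotProduct_mulVec_pos ?_ fun a ha => ?_
  · refine Matrix.IsHermitian.add ?_ ?_
    · simpa using Matrix.isHermitian_mul_mul_conjTranspose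
        (Matrix.fromRows (1 : Matrix (Fin n) (Fin n) ℝ) S.C) hΘ.1
    · simpa using Matrix.isHermitian_mul_mul_conjTranspose
        (Matrix.fromRows (0 : Matrix (Fin n) (Fin m) ℝ) (1 : Matrix (Fin m) (Fin m) ℝ)) hV.1
  · rw [star_trivial, excitation, Matrix.add_mulVec, dotProduct_add,
      dotProduct_mul_mul_transpose_mulVec, dotProduct_mul_mul_transpose_mulVec]
    set b := (Matrix.fromRows (1 : Matrix (Fin n) (Fin n) ℝ) S.C)ᵀ *ᵥ a with hb
    set c := (Matrix.fromRows (0 : Matrix (Fin n) (Fin m) ℝ) (1 : Matrix (Fin m) (Fin m) ℝ))ᵀ *ᵥ a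
      with hc
    have hb0 : 0 ≤ b ⬝ᵥ S.Θ *ᵥ b := by simpa using hΘ.posSemidef.dotProduct_mulVec_nonneg b
    have hc0 : 0 ≤ c ⬝ᵥ S.V *ᵥ c := by simpa using hV.posSemidef.dotProduct_mulVec_nonneg c
    have hcv : c = fun j => a (Sum.inr j) := by
      ext j
      simp [hc, Matrix.mulVec, dotProduct, Matrix.one_apply]
    have hbv : b = (fun j => a (Sum.inl j)) + S.Cᵀ *ᵥ c := by
      ext j
      rw [hcv]
      simp [hb, Matrix.mulVec, dotProduct, Matrix.one_apply]
    by_cases hc' : c = 0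
    · have hb' : b ≠ 0 := by
        intro h
        apply ha
        rw [hc', Matrix.mulVec_zero, add_zero] at hbv
        ext (j | j)
        · exact (congrFun hbv j).symm.trans (congrFun h j)
        · exact (congrFun hcv j).symm.trans (congrFun hc' j)
      have : 0 < b ⬝ᵥ S.Θ *ᵥ b := by simpa using hΘ.dotProduct_mulVec_pos hb'
      linarith
    · have : 0 < c ⬝ᵥ S.V *ᵥ c := by simpa using hV.dotProduct_mulVec_pos hc'
      linarith

/-- The second moment matrix of the regressor of stage `h`. -/
noncomputable def regressorMoment (h : ℕ) (F : ℕ → Policy n m) :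
    Matrix (Fin n ⊕ Fin m) (Fin n ⊕ Fin m) ℝ :=
  crossMoment S.sampleLaw (S.regressor h F) (S.regressor h F)

/-- Split the regressor as `z₀ + M₁ θ + M₂ v_h`. The vector `z₀` is invariant under sign changes of
`θ` and of `v_h`, so all mixed moments vanish and the moment matrix is that of `z₀` plus the
excitation. Without `θ` the estimate of stage 0 would be the constant `xbar`, and the moment matrix
singular in general. -/
theorem dotProduct_excitation_le (hn : 0 < n) (hV : S.V.PosSemidef) (hΘ : S.Θ.PosSemidef) (h : ℕ)
    (F : ℕ → Policy n m) (a : Fin n ⊕ Fin m → ℝ) :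
    a ⬝ᵥ S.excitation *ᵥ a ≤ a ⬝ᵥ S.regressorMoment h F *ᵥ a := by
  set P := S.sampleLaw
  set x : Sample n m → Fin n → ℝ := fun s => S.estimate h F s h - s.inject with hx
  set y : Sample n m → Fin n → ℝ := fun s => S.state h s h - s.inject with hy
  set z₀ : Sample n m → Fin n ⊕ Fin m → ℝ := fun s => Sum.elim (x s) (S.C *ᵥ y s) with hz₀
  set v : Sample n m → Fin m → ℝ := fun s => s.meas h with hv
  set M₁ := Matrix.fromRows (1 : Matrix (Fin n) (Fin n) ℝ) S.C with hM₁
  set M₂ := Matrix.fromRows (0 : Matrix (Fin n) (Fin m) ℝ) (1 : Matrix (Fin m) (Fin m) ℝ) with hM₂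
  have hreg : S.regressor h F = fun s => (z₀ s + M₁ *ᵥ s.inject) + M₂ *ᵥ v s := by
    ext s (i | i)
    · simp [regressor, hz₀, hx, hM₁, hM₂, Matrix.fromRows_mulVec]
    · simp [regressor, hz₀, hy, hM₁, hM₂, Matrix.fromRows_mulVec, output, hv, Matrix.mulVec_sub]
  have lθ := S.coordL2_inject hn
  have lv : CoordL2 P v := S.coordL2_meas hn h
  have lz : CoordL2 P z₀ := ((S.coordL2_estimate hn le_rfl F).sub lθ).sumElim
    (((S.coordL2_state hn (by omega)).sub lθ).mulVec S.C)
  have l1 : CoordL2 P fun s => M₁ *ᵥ s.inject := lθ.mulVec M₁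
  have l2 : CoordL2 P fun s => M₂ *ᵥ v s := lv.mulVec M₂
  have hz₀θ : ∀ s, z₀ (S.flipInject s) = z₀ s := by
    intro s
    simp only [hz₀, hx, hy, state_flipInject, estimate_flipInject]
  have hz₀v : ∀ s, z₀ (S.flipMeas h s) = z₀ s := by
    intro s
    simp only [hz₀, hx, hy, state_flipMeas, S.estimate_flipMeas_of_le s h F le_rfl,
      inject_flipMeas]
  have c1 : crossMoment P z₀ (fun s => M₁ *ᵥ s.inject) = 0 :=
    crossMoment_eq_zero' (S.measurePreserving_flipInject hn) lz l1 hz₀θ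
      fun s => by rw [inject_flipInject, Matrix.mulVec_neg]
  have c1' : crossMoment P (fun s : Sample n m => M₁ *ᵥ s.inject) z₀ = 0 := by
    rw [← crossMoment_transpose, c1, Matrix.transpose_zero]
  have c2 : crossMoment P (fun s => z₀ s + M₁ *ᵥ s.inject) (fun s => M₂ *ᵥ v s) = 0 :=
    crossMoment_eq_zero' (S.measurePreserving_flipMeas hn h) (lz.add l1) l2
      (fun s => by rw [hz₀v, inject_flipMeas])
      fun s => by simp only [hv]; rw [meas_flipMeas, Matrix.mulVec_neg]
  have c2' : crossMoment P (fun s => M₂ *ᵥ v s) (fun s => z₀ s + M₁ *ᵥ s.inject) = 0 := by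
    rw [← crossMoment_transpose, c2, Matrix.transpose_zero]
  have hM : S.regressorMoment h F = crossMoment P z₀ z₀ + S.excitation := by
    rw [regressorMoment, hreg, crossMoment_add_left (lz.add l1) l2 ((lz.add l1).add l2),
      crossMoment_add_right (lz.add l1) (lz.add l1) l2, crossMoment_add_right l2 (lz.add l1) l2,
      c2, c2', crossMoment_add_left lz l1 (lz.add l1), crossMoment_add_right lz lz l1,
      crossMoment_add_right l1 lz l1, c1, c1', crossMoment_mulVec_left M₁ lθ l1,
      crossMoment_mulVec_right M₁ lθ lθ, crossMoment_mulVec_left M₂ lv l2,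
      crossMoment_mulVec_right M₂ lv lv, S.crossMoment_inject hn hΘ, S.crossMoment_meas hn hV,
      excitation, Matrix.mul_assoc, Matrix.mul_assoc]
    abel
  have hp : 0 ≤ a ⬝ᵥ crossMoment P z₀ z₀ *ᵥ a := by
    simpa using (posSemidef_crossMoment lz).dotProduct_mulVec_nonneg a
  rw [hM, Matrix.add_mulVec, dotProduct_add]
  linarith

theorem posDef_regressorMoment (hn : 0 < n) (hV : S.V.PosDef) (hΘ : S.Θ.PosDef) (h : ℕ)
    (F : ℕ → Policy n m) : (S.regressorMoment h F).PosDef := by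
  refine Matrix.PosDef.of_dotProduct_mulVec_pos
    (posSemidef_crossMoment (S.coordL2_regressor hn h F)).1 fun a ha => ?_
  rw [star_trivial]
  refine lt_of_lt_of_le ?_
    (S.dotProduct_excitation_le hn hV.posSemidef hΘ.posSemidef h F a)
  simpa using (S.posDef_excitation hV hΘ).dotProduct_mulVec_pos ha

/-- The excitation is uniform over the stages and the earlier filters. -/
theorem exists_excitation (hn : 0 < n) (hV : S.V.PosDef) (hΘ : S.Θ.PosDef) :
    ∃ μ : ℝ, 0 < μ ∧ ∀ (h : ℕ) (F : ℕ → Policy n m) (D : Policy n m),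
      μ * ‖directionOf D‖ ^ 2 ≤ (D * S.regressorMoment h F * Dᵀ).trace := by
  obtain ⟨μ, hμ, hb⟩ := (S.posDef_excitation hV hΘ).exists_pos_mul_dotProduct_le
  refine ⟨μ, hμ, fun h F D => ?_⟩
  rw [Matrix.trace_mul_mul_transpose, EuclideanSpace.real_norm_sq_eq, Fintype.sum_prod_type,
    Finset.mul_sum]
  refine Finset.sum_le_sum fun i _ => ?_
  have h1 := (hb (D i)).trans
    (S.dotProduct_excitation_le hn hV.posSemidef hΘ.posSemidef h F (D i))
  simpa [dotProduct, sq] using h1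

/-! ### The minimizer of the stage objective -/

/-- The minimizer of the stage objective. -/
noncomputable def optimalFilter (h : ℕ) (F : ℕ → Policy n m) : Policy n m :=
  crossMoment S.sampleLaw (S.target h) (S.regressor h F) * (S.regressorMoment h F)⁻¹

section Optimal

variable {S}

theorem optimalFilter_mul (hn : 0 < n) (hV : S.V.PosDef) (hΘ : S.Θ.PosDef) (h : ℕ)
    (F : ℕ → Policy n m) :
    S.optimalFilter h F * S.regressorMoment h F =
      crossMoment S.sampleLaw (S.target h) (S.regressor h F) := by
  rw [optimalFilter, Matrix.mul_assoc, Matrix.nonsing_inv_mul _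
    ((Matrix.isUnit_iff_isUnit_det _).1 (S.posDef_regressorMoment hn hV hΘ h F).isUnit),
    Matrix.mul_one]

theorem crossMoment_residual (hn : 0 < n) (hV : S.V.PosDef) (hΘ : S.Θ.PosDef) (h : ℕ)
    (F : ℕ → Policy n m) (π : Policy n m) :
    crossMoment S.sampleLaw (fun s => S.target h s - π *ᵥ S.regressor h F s) (S.regressor h F) =
      (S.optimalFilter h F - π) * S.regressorMoment h F := by
  have lz := S.coordL2_regressor hn h F
  rw [crossMoment_sub_left (S.coordL2_target hn h) (lz.mulVec π) lz,
    crossMoment_mulVec_left π lz lz, Matrix.sub_mul, optimalFilter_mul hn hV hΘ]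
  rfl

/-- Pythagoras: the residual at the optimum is orthogonal to the regressor, so the cross term
vanishes. -/
theorem cost_eq (hn : 0 < n) (hV : S.V.PosDef) (hΘ : S.Θ.PosDef) (h : ℕ)
    (F : ℕ → Policy n m) (π : Policy n m) :
    S.cost h F π = S.cost h F (S.optimalFilter h F) +
      ((π - S.optimalFilter h F) * S.regressorMoment h F * (π - S.optimalFilter h F)ᵀ).trace := by
  set p := S.optimalFilter h F with hp
  have lz := S.coordL2_regressor hn h F
  have le : CoordL2 S.sampleLaw fun s => S.target h s - p *ᵥ S.regressor h F s :=
    (S.coordL2_target hn h).sub (lz.mulVec p)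
  have lD : CoordL2 S.sampleLaw fun s => (π - p) *ᵥ S.regressor h F s := lz.mulVec (π - p)
  have hexp : ∀ s, S.sampleCost h F π s = S.sampleCost h F p s +
      (((π - p) *ᵥ S.regressor h F s) ⬝ᵥ ((π - p) *ᵥ S.regressor h F s) -
        2 * ((S.target h s - p *ᵥ S.regressor h F s) ⬝ᵥ ((π - p) *ᵥ S.regressor h F s))) := by
    intro s
    have h1 : S.target h s - π *ᵥ S.regressor h F s =
        (S.target h s - p *ᵥ S.regressor h F s) - (π - p) *ᵥ S.regressor h F s := by
      rw [Matrix.sub_mulVec]; abel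
    have h2 : ∀ e d : Fin n → ℝ, (e - d) ⬝ᵥ (e - d) = e ⬝ᵥ e + (d ⬝ᵥ d - 2 * (e ⬝ᵥ d)) := by
      intro e d
      rw [sub_dotProduct, dotProduct_sub, dotProduct_sub, dotProduct_comm d e]
      ring
    rw [sampleCost_eq, sampleCost_eq, h1, h2, add_assoc]
  have hcm : crossMoment S.sampleLaw (fun s => S.target h s - p *ᵥ S.regressor h F s)
      (fun s => (π - p) *ᵥ S.regressor h F s) = 0 := by
    rw [crossMoment_mulVec_right _ le lz, crossMoment_residual hn hV hΘ, ← hp]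
    simp
  have hDD : crossMoment S.sampleLaw (fun s => (π - p) *ᵥ S.regressor h F s)
      (fun s => (π - p) *ᵥ S.regressor h F s) = (π - p) * S.regressorMoment h F * (π - p)ᵀ := by
    rw [crossMoment_mulVec_right _ lD lz, crossMoment_mulVec_left _ lz lz]
    rfl
  have hint : Integrable (fun s => ((π - p) *ᵥ S.regressor h F s) ⬝ᵥ
      ((π - p) *ᵥ S.regressor h F s) - 2 * ((S.target h s - p *ᵥ S.regressor h F s) ⬝ᵥ
        ((π - p) *ᵥ S.regressor h F s))) S.sampleLaw :=
    (integrable_dotProduct lD lD).sub ((integrable_dotProduct le lD).const_mul 2)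
  unfold cost
  simp only [hexp]
  rw [integral_add (S.integrable_sampleCost hn h F p) hint, integral_sub (integrable_dotProduct lD lD)
    ((integrable_dotProduct le lD).const_mul 2), integral_const_mul, integral_dotProduct lD lD,
    integral_dotProduct le lD, hcm, hDD]
  simp

/-- With `D` the difference of the two filters and `M` the regressor moment, `μ‖D‖² ≤ ⟨D M, D⟩ ≤ ‖D
M‖ ‖D‖`, and `D M` is the residual moment of `K`. Thus a filter that almost solves the normal
equations is close to the minimizer. -/
theorem norm_directionOf_optimalFilter_sub_le (hn : 0 < n) (hV : S.V.PosDef) (hΘ : S.Θ.PosDef)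
    {μ : ℝ} {h : ℕ} {F : ℕ → Policy n m}
    (hb : ∀ D : Policy n m,
      μ * ‖directionOf D‖ ^ 2 ≤ (D * S.regressorMoment h F * Dᵀ).trace) (K : Policy n m) :
    μ * ‖directionOf (S.optimalFilter h F - K)‖ ≤ ‖directionOf (crossMoment S.sampleLaw
      (fun s => S.target h s - K *ᵥ S.regressor h F s) (S.regressor h F))‖ := by
  rw [crossMoment_residual hn hV hΘ]
  set D := S.optimalFilter h F - K
  have htr : (D * S.regressorMoment h F * Dᵀ).trace =
      inner ℝ (directionOf (D * S.regressorMoment h F)) (directionOf D) := by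
    generalize D * S.regressorMoment h F = N
    simp [Matrix.trace, Matrix.mul_apply, PiLp.inner_apply, Fintype.sum_prod_type, mul_comm]
  have h1 := hb D
  rw [htr] at h1
  have h2 := h1.trans (real_inner_le_norm _ _)
  rcases eq_or_lt_of_le (norm_nonneg (directionOf D)) with h0 | h0
  · rw [← h0, mul_zero]; exact norm_nonneg _
  · refine le_of_mul_le_mul_right ?_ h0
    linarith

theorem cost_optimalFilter_lt (hn : 0 < n) (hV : S.V.PosDef) (hΘ : S.Θ.PosDef) (h : ℕ)
    (F : ℕ → Policy n m) {π : Policy n m} (hπ : π ≠ S.optimalFilter h F) :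
    S.cost h F (S.optimalFilter h F) < S.cost h F π := by
  obtain ⟨μ, hμ, hb⟩ := S.exists_excitation hn hV hΘ
  rw [cost_eq hn hV hΘ h F π]
  have h1 := hb h F (π - S.optimalFilter h F)
  have h2 : 0 < ‖directionOf (π - S.optimalFilter h F)‖ := by
    refine lt_of_lt_of_le ?_ (norm_le_norm_directionOf _)
    exact norm_pos_iff.2 (sub_ne_zero.2 hπ)
  have h3 : 0 < μ * ‖directionOf (π - S.optimalFilter h F)‖ ^ 2 := by positivity
  linarith

end Optimal

end KFSystem

namespace KFSystem

variable {n m : ℕ} (S : KFSystem n m)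

/-! ### The oracle of one stage -/

theorem state_dir (h t : ℕ) (u u' : DirectionSpace n m)
    (ω : (Fin n → ℝ) × (ℕ → Fin n → ℝ) × (ℕ → Fin m → ℝ) × (Fin n → ℝ)) :
    S.state h ((u, ω) : Sample n m) t = S.state h ((u', ω) : Sample n m) t := by
  induction t with
  | zero => rfl
  | succ t ih => simp only [state, ih]; rfl

theorem output_dir (h t : ℕ) (u u' : DirectionSpace n m)
    (ω : (Fin n → ℝ) × (ℕ → Fin n → ℝ) × (ℕ → Fin m → ℝ) × (Fin n → ℝ)) :
    S.output h ((u, ω) : Sample n m) t = S.output h ((u', ω) : Sample n m) t := by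
  simp only [output, S.state_dir h t u u' ω]; rfl

theorem estimate_dir (h t : ℕ) (F : ℕ → Policy n m) (u u' : DirectionSpace n m)
    (ω : (Fin n → ℝ) × (ℕ → Fin n → ℝ) × (ℕ → Fin m → ℝ) × (Fin n → ℝ)) :
    S.estimate h F ((u, ω) : Sample n m) t = S.estimate h F ((u', ω) : Sample n m) t := by
  induction t with
  | zero => rfl
  | succ t ih => simp only [estimate, ih, S.output_dir h t u u' ω]; rfl

/-- The direction does not influence the simulated trajectory, so it can be averaged out with the
trajectory held fixed. -/
theorem residualProduct_dir (h : ℕ) (F : ℕ → Policy n m) (π : Policy n m)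
    (u u' : DirectionSpace n m)
    (ω : (Fin n → ℝ) × (ℕ → Fin n → ℝ) × (ℕ → Fin m → ℝ) × (Fin n → ℝ)) :
    S.residualProduct h F π ((u, ω) : Sample n m) =
      S.residualProduct h F π ((u', ω) : Sample n m) := by
  simp only [residualProduct, regressor, target, S.estimate_dir h h F u u' ω,
    S.output_dir h h u u' ω, S.state_dir h (h + 1) u u' ω]

theorem ae_norm_dir (hn : 0 < n) : ∀ᵐ s ∂S.sampleLaw, ‖s.1‖ = 1 := by
  have := isProbabilityMeasure_unitSphereLaw (m := m) hn
  exact (measurePreserving_fst (μ := unitSphereLaw n m)).quasiMeasurePreserving.ae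
    ae_unitSphereLaw_norm

/-- Averaging over the random direction. -/
theorem integral_inner_dir_mul_inner_dir (hn : 0 < n) {G : Sample n m → DirectionSpace n m}
    (hG : Integrable G S.sampleLaw) (hdir : ∀ u u' ω, G (u, ω) = G (u', ω))
    (D : DirectionSpace n m) :
    ∫ s, inner ℝ (G s) s.1 * inner ℝ D s.1 ∂S.sampleLaw =
      ((n * (m + n) : ℕ) : ℝ)⁻¹ * ∫ s, inner ℝ (G s) D ∂S.sampleLaw := by
  have := isProbabilityMeasure_unitSphereLaw (m := m) hn
  have hi1 : Integrable (fun s => (inner ℝ (G s) s.1 * inner ℝ D s.1 : ℝ)) S.sampleLaw := by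
    refine (hG.norm.mul_const ‖D‖).mono' ?_ ?_
    · exact (hG.aestronglyMeasurable.inner measurable_fst.aestronglyMeasurable).mul
        (aestronglyMeasurable_const.inner measurable_fst.aestronglyMeasurable)
    · filter_upwards [S.ae_norm_dir hn] with s hs
      rw [norm_mul]
      have h1 := norm_inner_le_norm (𝕜 := ℝ) (G s) s.1
      have h2 := norm_inner_le_norm (𝕜 := ℝ) D s.1
      rw [hs, mul_one] at h1 h2
      exact mul_le_mul h1 h2 (norm_nonneg _) (norm_nonneg _)
  have hi2 : Integrable (fun s => (inner ℝ (G s) D : ℝ)) S.sampleLaw := hG.inner_const D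
  unfold sampleLaw at hi1 hi2 ⊢
  rw [integral_prod_symm _ hi1, integral_prod_symm _ hi2, ← integral_const_mul]
  congr 1
  ext ω
  have hx : ∀ u, G (u, ω) = G (0, ω) := fun u => hdir u 0 ω
  simp only [hx]
  rw [integral_unitSphereLaw_inner_mul_inner hn]
  simp

/-- The stochastic gradient produced by the two-point oracle. -/
noncomputable def stochasticGradient (h : ℕ) (F : ℕ → Policy n m) (x : DirectionSpace n m)
    (s : Sample n m) : DirectionSpace n m :=
  (2 * ((n * (m + n) : ℕ) : ℝ) *
    inner ℝ (S.residualProduct h F (directionMatrix x) s) s.1) • s.1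

theorem measurable_stochasticGradient (h : ℕ) :
    Measurable fun q : (ℕ → DirectionSpace n m) × DirectionSpace n m × Sample n m =>
      S.stochasticGradient h (fun j => directionMatrix (q.1 j)) q.2.1 q.2.2 := by
  have h1 := S.measurable_residualProduct h
  have h2 : Measurable fun q : (ℕ → DirectionSpace n m) × DirectionSpace n m × Sample n m =>
    q.2.2.1 := by fun_prop
  exact ((h1.inner (𝕜 := ℝ) h2).const_mul _).smul h2

theorem directionOf_zerothOrderPG_succ (h : ℕ) (F : ℕ → Policy n m) {r : ℝ} (hr : r ≠ 0) (η : ℝ)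
    (π₀ : Policy n m) (s : ℕ → Sample n m) (k : ℕ) :
    directionOf (S.zerothOrderPG h F r η π₀ s (k + 1)) =
      directionOf (S.zerothOrderPG h F r η π₀ s k) -
        η • S.stochasticGradient h F (directionOf (S.zerothOrderPG h F r η π₀ s k)) (s k) := by
  rw [zerothOrderPG, directionOf_sub, directionOf_smul, S.directionOf_twoPointOracle h F hr]
  rfl

/-- Residual and regressor are each linear in the size of the sample. The residual is also affine in
the filter, which is written as `xs + (x - xs)` to obtain the factor `1 + ‖x - xs‖`. -/
theorem norm_residualProduct_le (h : ℕ) (F : ℕ → Policy n m) {C Ropt : ℝ}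
    (hC : 0 ≤ C) (hRopt : 0 ≤ Ropt) {xs : DirectionSpace n m} (hxs : ‖xs‖ ≤ Ropt) {s : Sample n m}
    (htar : ‖S.target h s‖ ≤ C * s.size h) (hreg : ‖S.regressor h F s‖ ≤ C * s.size h)
    (x : DirectionSpace n m) :
    ‖S.residualProduct h F (directionMatrix x) s‖ ≤ ((n * (m + n) : ℕ) : ℝ) *
      ((((Fintype.card (Fin n ⊕ Fin m) : ℕ) : ℝ) * (1 + Ropt) + 1) * C * C) * s.size h ^ 2 *
        (1 + ‖x - xs‖) := by
  generalize hN : ((Fintype.card (Fin n ⊕ Fin m) : ℕ) : ℝ) = N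
  have hN0 : 0 ≤ N := by rw [← hN]; positivity
  have hs0 : 0 ≤ s.size h := zero_le_one.trans (s.one_le_size h)
  generalize hρ : ‖x - xs‖ = ρ
  have hρ0 : 0 ≤ ρ := by rw [← hρ]; exact norm_nonneg _
  have hx : ‖directionMatrix x‖ ≤ ρ + Ropt := by
    refine (norm_directionMatrix_le x).trans ?_
    have := norm_add_le (x - xs) xs
    rw [sub_add_cancel] at this
    linarith
  have he : ‖directionMatrix x *ᵥ S.regressor h F s - S.target h s‖ ≤
      (N * (1 + Ropt) + 1) * C * s.size h * (1 + ρ) := by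
    calc _ ≤ N * ‖directionMatrix x‖ * ‖S.regressor h F s‖ + ‖S.target h s‖ :=
          (norm_sub_le _ _).trans (add_le_add (hN ▸ norm_mulVec_le_card_mul _ _) le_rfl)
      _ ≤ N * (ρ + Ropt) * (C * s.size h) + C * s.size h := by gcongr
      _ ≤ N * ((1 + Ropt) * (1 + ρ)) * (C * s.size h) + C * s.size h * (1 + ρ) := by
          have h1 : ρ + Ropt ≤ (1 + Ropt) * (1 + ρ) := by nlinarith
          have h2 : C * s.size h ≤ C * s.size h * (1 + ρ) :=
            le_mul_of_one_le_right (by positivity) (by linarith)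
          gcongr
      _ = _ := by ring
  have hc : 0 ≤ (N * (1 + Ropt) + 1) * C * s.size h * (1 + ρ) := (norm_nonneg _).trans he
  have hz : 0 ≤ C * s.size h := by positivity
  have := norm_directionOf_le_of_abs_le (π := Matrix.vecMulVec
    (directionMatrix x *ᵥ S.regressor h F s - S.target h s) (S.regressor h F s))
    (mul_nonneg hc hz) (fun i j => by
      rw [Matrix.vecMulVec_apply, abs_mul]
      exact mul_le_mul ((norm_le_pi_norm _ i).trans he) ((norm_le_pi_norm _ j).trans hreg)
        (abs_nonneg _) hc)
  refine this.trans (le_of_eq ?_)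
  ring

/-- Mixed second moments of vectors dominated by the size of the sample. -/
theorem norm_directionOf_crossMoment_le (hn : 0 < n) (h : ℕ) {X : Sample n m → Fin n → ℝ}
    {Z : Sample n m → Fin n ⊕ Fin m → ℝ} {a b : ℝ} (ha : 0 ≤ a) (hb : 0 ≤ b)
    (hX : ∀ s, ‖X s‖ ≤ a * s.size h) (hZ : ∀ s, ‖Z s‖ ≤ b * s.size h) :
    ‖directionOf (crossMoment S.sampleLaw X Z)‖ ≤
      (n * (m + n) : ℕ) * (a * b * ∫ s, s.size h ^ 2 ∂S.sampleLaw) := by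
  have := S.isProbabilityMeasure_sampleLaw hn
  have hI : 0 ≤ ∫ s : Sample n m, s.size h ^ 2 ∂S.sampleLaw :=
    integral_nonneg fun s => sq_nonneg _
  refine norm_directionOf_le_of_abs_le (by positivity) fun i j => ?_
  rw [← integral_const_mul]
  change ‖∫ s, X s i * Z s j ∂S.sampleLaw‖ ≤ _
  refine norm_integral_le_of_norm_le
    (((S.hasSquareExpMoment_size hn h).memLp_two.integrable_sq).const_mul _)
    (.of_forall fun s => ?_)
  rw [norm_mul]
  calc ‖X s i‖ * ‖Z s j‖ ≤ (a * s.size h) * (b * s.size h) :=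
        mul_le_mul ((norm_le_pi_norm _ i).trans (hX s)) ((norm_le_pi_norm _ j).trans (hZ s))
          (norm_nonneg _) (mul_nonneg ha (zero_le_one.trans (s.one_le_size h)))
    _ = _ := by ring

variable {S}

/-- The dimensional factor of the oracle cancels the covariance `1/d` of the direction; the normal
equations then evaluate the remaining moment. -/
theorem integral_inner_stochasticGradient (hn : 0 < n) (hV : S.V.PosDef) (hΘ : S.Θ.PosDef)
    (h : ℕ) (F : ℕ → Policy n m) (x : DirectionSpace n m)
    (hint : Integrable (S.residualProduct h F (directionMatrix x)) S.sampleLaw) :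
    ∫ s, inner ℝ (x - directionOf (S.optimalFilter h F)) (S.stochasticGradient h F x s)
        ∂S.sampleLaw =
      2 * ((directionMatrix x - S.optimalFilter h F) * S.regressorMoment h F *
        (directionMatrix x - S.optimalFilter h F)ᵀ).trace := by
  set D := directionMatrix x - S.optimalFilter h F with hD
  have hd : ((n * (m + n) : ℕ) : ℝ) ≠ 0 := by
    have : 0 < n * (m + n) := by positivity
    exact_mod_cast this.ne'
  have lz := S.coordL2_regressor hn h F
  have le := (S.coordL2_target hn h).sub (lz.mulVec (directionMatrix x))
  have lD : CoordL2 S.sampleLaw fun s => D *ᵥ S.regressor h F s := lz.mulVec D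
  have h1 : ∀ s, (inner ℝ (x - directionOf (S.optimalFilter h F))
      (S.stochasticGradient h F x s) : ℝ) = 2 * ((n * (m + n) : ℕ) : ℝ) *
        (inner ℝ (S.residualProduct h F (directionMatrix x) s) s.1 *
          inner ℝ (directionOf D) s.1) := by
    intro s
    rw [stochasticGradient, inner_smul_right, mul_assoc]
    rfl
  have h2 : ∀ s, (inner ℝ (S.residualProduct h F (directionMatrix x) s) (directionOf D) : ℝ) =
      -((S.target h s - directionMatrix x *ᵥ S.regressor h F s) ⬝ᵥ
        (D *ᵥ S.regressor h F s)) := by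
    intro s
    rw [residualProduct, inner_directionOf_vecMulVec, directionMatrix_directionOf,
      ← neg_dotProduct, neg_sub]
  simp only [h1]
  rw [integral_const_mul, S.integral_inner_dir_mul_inner_dir hn hint
    (fun u u' ω => S.residualProduct_dir h F _ u u' ω)]
  simp only [h2]
  rw [integral_neg, integral_dotProduct le lD, crossMoment_mulVec_right _ le lz,
    crossMoment_residual hn hV hΘ, ← neg_sub, ← hD, Matrix.neg_mul, Matrix.neg_mul,
    Matrix.trace_neg, neg_neg]
  field_simp

/-- The growth bound is demanded for every sample, whereas `‖U‖ = 1` holds only almost surely. Hence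
the factor `‖s.1‖ ^ 2` in the random constant, which disappears under the integral. -/
theorem isGradientOracle_stochasticGradient (hn : 0 < n) (hV : S.V.PosDef) (hΘ : S.Θ.PosDef)
    {h : ℕ} {F : ℕ → Policy n m} {μ σ c : ℝ} (hc : 0 ≤ c)
    (hexc : ∀ D : Policy n m, μ * ‖directionOf D‖ ^ 2 ≤ (D * S.regressorMoment h F * Dᵀ).trace)
    (hres : ∀ x s, ‖S.residualProduct h F (directionMatrix x) s‖ ≤
      c * s.size h ^ 2 * (1 + ‖x - directionOf (S.optimalFilter h F)‖))
    (hint : Integrable (fun s => (2 * ((n * (m + n) : ℕ) : ℝ) * c * s.size h ^ 2) ^ 2 *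
      Real.exp (σ * (2 * ((n * (m + n) : ℕ) : ℝ) * c * s.size h ^ 2))) S.sampleLaw) :
    IsGradientOracle S.sampleLaw (S.stochasticGradient h F) (directionOf (S.optimalFilter h F))
      (fun s => 2 * ((n * (m + n) : ℕ) : ℝ) * c * s.size h ^ 2 * ‖s.1‖ ^ 2) σ
      (∫ s, (2 * ((n * (m + n) : ℕ) : ℝ) * c * s.size h ^ 2) ^ 2 *
        Real.exp (σ * (2 * ((n * (m + n) : ℕ) : ℝ) * c * s.size h ^ 2)) ∂S.sampleLaw) (2 * μ) := by
  have := S.isProbabilityMeasure_sampleLaw hn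
  have hsizem := (S.hasSquareExpMoment_size hn h).1
  have hd0 : 0 ≤ 2 * ((n * (m + n) : ℕ) : ℝ) := by positivity
  have hgrad : ∀ x s, ‖S.stochasticGradient h F x s‖ ≤
      2 * ((n * (m + n) : ℕ) : ℝ) * ‖S.residualProduct h F (directionMatrix x) s‖ *
        ‖s.1‖ ^ 2 := by
    intro x s
    rw [stochasticGradient, norm_smul, norm_mul, Real.norm_of_nonneg hd0]
    have h1 := norm_inner_le_norm (𝕜 := ℝ) (S.residualProduct h F (directionMatrix x) s) s.1
    refine (mul_le_mul_of_nonneg_right (mul_le_mul_of_nonneg_left h1 hd0)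
      (norm_nonneg _)).trans (le_of_eq ?_)
    ring
  generalize 2 * ((n * (m + n) : ℕ) : ℝ) = d at *
  have hae' : (fun s : Sample n m => (d * c * s.size h ^ 2 * ‖s.1‖ ^ 2) ^ 2 *
      Real.exp (σ * (d * c * s.size h ^ 2 * ‖s.1‖ ^ 2))) =ᵐ[S.sampleLaw]
      fun s => (d * c * s.size h ^ 2) ^ 2 * Real.exp (σ * (d * c * s.size h ^ 2)) := by
    filter_upwards [S.ae_norm_dir hn] with s hs
    rw [hs, one_pow, mul_one]
  refine ⟨?_, ?_, fun s => by positivity, fun x s => ?_, hint.congr hae'.symm,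
    (integral_congr_ae hae').le, fun x => ?_⟩
  · have h1 := (S.measurable_stochasticGradient h).comp
      (measurable_prodMk_left (x := fun j => directionOf (F j)))
    simpa only [Function.comp_def, directionMatrix_directionOf, Function.uncurry_def] using h1
  · exact (measurable_const.mul (hsizem.pow_const 2)).mul (measurable_fst.norm.pow_const 2)
  · calc _ ≤ _ := hgrad x s
      _ ≤ d * (c * s.size h ^ 2 * (1 + ‖x - directionOf (S.optimalFilter h F)‖)) * ‖s.1‖ ^ 2 := by
          gcongr
          exact hres x s
      _ = _ := by ring
  · rw [integral_inner_stochasticGradient hn hV hΘ h F x]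
    · have := hexc (directionMatrix x - S.optimalFilter h F)
      rw [directionOf_sub, directionOf_directionMatrix] at this
      linarith
    · refine (((S.hasSquareExpMoment_size hn h).memLp_two.integrable_sq.const_mul c).mul_const
        (1 + ‖x - directionOf (S.optimalFilter h F)‖)).mono' ?_ (.of_forall fun s => hres x s)
      have h1 := ((S.measurable_residualProduct h).comp (measurable_prodMk_left
        (x := fun j => directionOf (F j)))).comp (measurable_prodMk_left (x := x))
      simp only [Function.comp_def, directionMatrix_directionOf] at h1
      exact h1.aestronglyMeasurable

/-- The stochastic gradients satisfy the assumptions on gradient oracles, uniformly over the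
filters of the earlier stages. -/
theorem exists_isGradientOracle (hn : 0 < n) (hV : S.V.PosDef) (hΘ : S.Θ.PosDef) (h : ℕ) {R : ℝ}
    (hR : 0 ≤ R) :
    ∃ s B μ Ropt : ℝ, 0 < s ∧ 0 ≤ B ∧ 0 < μ ∧ 0 ≤ Ropt ∧
      ∀ F : ℕ → Policy n m, (∀ j < h, ‖F j‖ ≤ R) →
        ‖directionOf (S.optimalFilter h F)‖ ≤ Ropt ∧
        ∃ Y, IsGradientOracle S.sampleLaw (S.stochasticGradient h F)
          (directionOf (S.optimalFilter h F)) Y s B μ := by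
  have := S.isProbabilityMeasure_sampleLaw hn
  obtain ⟨μ, hμ, hexc⟩ := S.exists_excitation hn hV hΘ
  obtain ⟨C, hC, htar, hreg⟩ := S.exists_norm_regressor_le h hR
  have hI0 : 0 ≤ ∫ s : Sample n m, s.size h ^ 2 ∂S.sampleLaw :=
    integral_nonneg fun s => sq_nonneg _
  -- This radius comes from comparing the minimizer with the zero filter, whose residual is the
  -- target itself.
  obtain ⟨Ropt, hRopt0, hRopt⟩ : ∃ Ropt : ℝ, 0 ≤ Ropt ∧ ((n * (m + n) : ℕ) : ℝ) *
      (C * C * ∫ s : Sample n m, s.size h ^ 2 ∂S.sampleLaw) / μ ≤ Ropt := ⟨_, by positivity, le_rfl⟩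
  obtain ⟨c, hc, hcdef⟩ : ∃ c : ℝ, 0 ≤ c ∧ c = ((n * (m + n) : ℕ) : ℝ) *
      ((((Fintype.card (Fin n ⊕ Fin m) : ℕ) : ℝ) * (1 + Ropt) + 1) * C * C) :=
    ⟨_, by positivity, rfl⟩
  obtain ⟨σ, hσ, hint⟩ := (S.hasSquareExpMoment_size hn h).exists_integrable
    (C := 2 * ((n * (m + n) : ℕ) : ℝ) * c) (by positivity)
  refine ⟨σ, ∫ s, (2 * ((n * (m + n) : ℕ) : ℝ) * c * s.size h ^ 2) ^ 2 *
    Real.exp (σ * (2 * ((n * (m + n) : ℕ) : ℝ) * c * s.size h ^ 2)) ∂S.sampleLaw, 2 * μ, Ropt, hσ,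
    integral_nonneg fun s => ?_, mul_pos two_pos hμ, hRopt0, fun F hF => ?_⟩
  rotate_left
  · have hopt : ‖directionOf (S.optimalFilter h F)‖ ≤ Ropt := by
      have h1 := norm_directionOf_optimalFilter_sub_le hn hV hΘ (hexc h F) 0
      simp only [sub_zero, Matrix.zero_mulVec] at h1
      refine le_trans ?_ hRopt
      rw [le_div_iff₀ hμ, mul_comm]
      exact h1.trans (S.norm_directionOf_crossMoment_le hn h hC hC htar (hreg F hF))
    refine ⟨hopt, _, isGradientOracle_stochasticGradient hn hV hΘ hc (hexc h F) (fun x s => ?_)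
      hint⟩
    rw [hcdef]
    exact S.norm_residualProduct_le h F hC hRopt0 hopt (htar s) (hreg F hF s) x
  · exact mul_nonneg (sq_nonneg _) (Real.exp_pos _).le

/-- Convergence of zeroth-order policy gradient at one stage, to accuracy `β * ε`. -/
theorem exists_stage_constants (hn : 0 < n) (hV : S.V.PosDef) (hΘ : S.Θ.PosDef) (h : ℕ) {R β : ℝ}
    (hR : 0 ≤ R) (hβ : 0 < β) (hβ1 : β ≤ 1) :
    ∃ c₀ : ℝ, 0 < c₀ ∧ ∀ c : ℝ, 0 < c → c ≤ c₀ → ∃ K : ℝ, 0 < K ∧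
      ∀ F : ℕ → Policy n m, (∀ j < h, ‖F j‖ ≤ R) → ∀ π₀ : Policy n m, ‖π₀‖ ≤ R →
      ∀ ε δ r : ℝ, 0 < ε → ε ≤ 1 / 2 → 0 < δ → δ < 1 → r ≠ 0 →
      ∀ T : ℕ, K / ε ^ 2 * Real.log (1 / (δ * ε ^ 2)) * Real.log (1 / ε) ≤ (T : ℝ) →
        S.stageLaw.real {s | β * ε < ‖directionOf (S.zerothOrderPG h F r
          (c * ε ^ 2 / Real.log (1 / (δ * ε ^ 2))) π₀ s T) -
            directionOf (S.optimalFilter h F)‖} ≤ δ := by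
  have := S.isProbabilityMeasure_sampleLaw hn
  obtain ⟨s, B, μ, Ropt, hs, hB, hμ, hRopt, hor⟩ := exists_isGradientOracle hn hV hΘ h hR
  -- Here `D` bounds the initial squared distance: the Frobenius norm of the initialization is at
  -- most `n(m+n) R` and that of the minimizer at most `Ropt`.
  obtain ⟨c₀, hc₀, hc⟩ := IsGradientOracle.exists_constants (E := DirectionSpace n m) S.sampleLaw
    (D := (((n * (m + n) : ℕ) : ℝ) * R + Ropt) ^ 2) hs hμ hB (sq_nonneg _) hβ hβ1
  refine ⟨c₀, hc₀, fun c hc0 hcc => ?_⟩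
  obtain ⟨K, hK, hall⟩ := hc c hc0 hcc
  refine ⟨K, hK, fun F hF π₀ hπ₀ ε δ r hε hε2 hδ hδ1 hr T hT => ?_⟩
  obtain ⟨hopt, Y, hY⟩ := hor F hF
  refine hall _ _ (directionOf π₀) Y hY ?_ (fun k ω => directionOf (S.zerothOrderPG h F r
    (c * ε ^ 2 / Real.log (1 / (δ * ε ^ 2))) π₀ ω k)) (fun ω => rfl) ε δ
    (fun k ω => S.directionOf_zerothOrderPG_succ h F hr _ π₀ ω k) hε hε2 hδ hδ1 T hT
  refine pow_le_pow_left₀ (norm_nonneg _) ?_ 2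
  refine (norm_sub_le _ _).trans (add_le_add ((norm_directionOf_le π₀).trans ?_) hopt)
  gcongr

end KFSystem

theorem crossMoment_sumElim {Ω ι κ l : Type*} [MeasurableSpace Ω] {P : Measure Ω}
    {X : Ω → ι → ℝ} {Z : Ω → κ → ℝ} {Z' : Ω → l → ℝ} :
    crossMoment P X (fun ω => Sum.elim (Z ω) (Z' ω)) =
      Matrix.fromCols (crossMoment P X Z) (crossMoment P X Z') := by
  ext i (j | j) <;> rfl

namespace KFSystem

variable {n m : ℕ} {S : KFSystem n m}

/-! ### The Kalman filter -/

theorem state_flipDynamics_of_le (h : ℕ) {t k : ℕ} (htk : t ≤ k) (s : Sample n m) :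
    S.state h (S.flipDynamics k s) t = S.state h s t := by
  induction t with
  | zero => simp [state]
  | succ t ih =>
    simp [state, ih (by omega), S.process_flipDynamics_of_ne s (show t ≠ k by omega)]

theorem estimate_flipDynamics_of_le (h : ℕ) (F : ℕ → Policy n m) {t k : ℕ} (htk : t ≤ k)
    (s : Sample n m) : S.estimate h F (S.flipDynamics k s) t = S.estimate h F s t := by
  induction t with
  | zero => simp [estimate]
  | succ t ih =>
    simp [estimate, ih (by omega), output, state_flipDynamics_of_le h (show t ≤ k by omega)]

theorem kalmanFilter_mulVec (S : KFSystem n m) (t : ℕ) (x : Fin n → ℝ) (v : Fin m → ℝ)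
    (e : Fin n → ℝ) :
    S.kalmanFilter t *ᵥ Sum.elim x (S.C *ᵥ (x + e) + v) =
      S.A *ᵥ x + (S.kalmanGain t * S.C) *ᵥ e + S.kalmanGain t *ᵥ v := by
  rw [kalmanFilter, Matrix.fromCols_mulVec_sumElim, Matrix.sub_mulVec, Matrix.mulVec_add,
    Matrix.mulVec_add, Matrix.mulVec_add, Matrix.mulVec_mulVec, Matrix.mulVec_mulVec]
  abel

/-- The estimation error at time `t` in stage `h`, for the Kalman filters. -/
noncomputable def kalmanError (S : KFSystem n m) (h t : ℕ) (s : Sample n m) : Fin n → ℝ :=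
  S.state h s t - S.estimate h S.kalmanFilter s t

/-- The noise driving the estimation error of the Kalman filters. -/
noncomputable def kalmanNoise (S : KFSystem n m) (t : ℕ) (s : Sample n m) : Fin n → ℝ :=
  s.process t - S.kalmanGain t *ᵥ s.meas t

theorem output_eq_kalmanError (h t : ℕ) (s : Sample n m) :
    S.output h s t =
      S.C *ᵥ (S.estimate h S.kalmanFilter s t + S.kalmanError h t s) + s.meas t := by
  rw [output, kalmanError, add_sub_cancel]

/-- This identity serves twice: as the recursion of the estimation error and as the residual of the
regression problem at stage `h`. -/
theorem state_sub_kalmanFilter_mulVec (h t : ℕ) (s : Sample n m) :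
    S.A *ᵥ S.state h s t + s.process t -
      S.kalmanFilter t *ᵥ Sum.elim (S.estimate h S.kalmanFilter s t) (S.output h s t) =
      (S.A - S.kalmanGain t * S.C) *ᵥ S.kalmanError h t s + S.kalmanNoise t s := by
  rw [output_eq_kalmanError, kalmanFilter_mulVec,
    show S.state h s t = S.estimate h S.kalmanFilter s t + S.kalmanError h t s by
      rw [kalmanError, add_sub_cancel], Matrix.mulVec_add, Matrix.sub_mulVec, kalmanNoise]
  abel

theorem kalmanError_succ (h t : ℕ) (s : Sample n m) :
    S.kalmanError h (t + 1) s =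
      (S.A - S.kalmanGain t * S.C) *ᵥ S.kalmanError h t s + S.kalmanNoise t s := by
  rw [← state_sub_kalmanFilter_mulVec, kalmanError, state, estimate, Policy.predict]
  abel

theorem kalmanError_zero (h : ℕ) (s : Sample n m) :
    S.kalmanError h 0 s = s.init - S.xbar := by
  rw [kalmanError, state, estimate]
  abel

/-- The same `θ` is added to state and estimate, so it cancels in the error. -/
theorem kalmanError_flipInject (h t : ℕ) (s : Sample n m) :
    S.kalmanError h t (S.flipInject s) = S.kalmanError h t s := by
  induction t with
  | zero => simp [kalmanError_zero]
  | succ t ih => simp [kalmanError_succ, ih, kalmanNoise]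

theorem kalmanError_flipDynamics_of_le (h : ℕ) {t k : ℕ} (htk : t ≤ k) (s : Sample n m) :
    S.kalmanError h t (S.flipDynamics k s) = S.kalmanError h t s := by
  rw [kalmanError, state_flipDynamics_of_le h htk, estimate_flipDynamics_of_le h _ htk]; rfl

theorem kalmanError_flipMeas_of_le (h : ℕ) {t k : ℕ} (htk : t ≤ k) (s : Sample n m) :
    S.kalmanError h t (S.flipMeas k s) = S.kalmanError h t s := by
  rw [kalmanError, state_flipMeas, S.estimate_flipMeas_of_le s h _ htk]; rfl

theorem coordL2_kalmanError (hn : 0 < n) {h t : ℕ} (ht : t ≤ h) :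
    CoordL2 S.sampleLaw (S.kalmanError h t) :=
  (S.coordL2_state hn (by omega)).sub (S.coordL2_estimate hn ht _)

theorem coordL2_kalmanNoise (hn : 0 < n) (t : ℕ) : CoordL2 S.sampleLaw (S.kalmanNoise t) :=
  (S.coordL2_process hn t).sub ((S.coordL2_meas hn t).mulVec _)

/-- The driving noise is uncorrelated with everything that does not depend on the noises at time
`t`. -/
theorem crossMoment_kalmanNoise_left (hn : 0 < n) {κ : Type*} (t : ℕ) {Z : Sample n m → κ → ℝ}
    (hZ : CoordL2 S.sampleLaw Z) (h1 : ∀ s, Z (S.flipDynamics t s) = Z s)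
    (h2 : ∀ s, Z (S.flipMeas t s) = Z s) :
    crossMoment S.sampleLaw (S.kalmanNoise t) Z = 0 := by
  have lw := S.coordL2_process hn t
  have lv := S.coordL2_meas hn t
  have e1 : crossMoment S.sampleLaw (fun s : Sample n m => s.process t) Z = 0 :=
    crossMoment_eq_zero (S.measurePreserving_flipDynamics hn t) lw hZ
      (fun s => S.process_flipDynamics s t) h1
  have e2 : crossMoment S.sampleLaw (fun s : Sample n m => s.meas t) Z = 0 :=
    crossMoment_eq_zero (S.measurePreserving_flipMeas hn t) lv hZ
      (fun s => S.meas_flipMeas s t) h2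
  unfold kalmanNoise
  rw [crossMoment_sub_left lw (lv.mulVec _) hZ, crossMoment_mulVec_left _ lv hZ, e1, e2]
  simp

theorem crossMoment_kalmanNoise_meas (hn : 0 < n) (hV : S.V.PosSemidef) (t : ℕ) :
    crossMoment S.sampleLaw (S.kalmanNoise t) (fun s => s.meas t) = -(S.kalmanGain t * S.V) := by
  have lw := S.coordL2_process hn t
  have lv := S.coordL2_meas hn t
  have e1 : crossMoment S.sampleLaw (fun s : Sample n m => s.process t) (fun s => s.meas t) = 0 :=
    crossMoment_eq_zero (S.measurePreserving_flipDynamics hn t) lw lv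
      (fun s => S.process_flipDynamics s t) (fun s => S.meas_flipDynamics s t t)
  unfold kalmanNoise
  rw [crossMoment_sub_left lw (lv.mulVec _) lv, crossMoment_mulVec_left _ lv lv, e1,
    S.crossMoment_meas hn hV, zero_sub]

theorem crossMoment_kalmanNoise_self (hn : 0 < n) (hW : S.W.PosSemidef) (hV : S.V.PosSemidef)
    (t : ℕ) : crossMoment S.sampleLaw (S.kalmanNoise t) (S.kalmanNoise t) =
      S.W + S.kalmanGain t * S.V * (S.kalmanGain t)ᵀ := by
  have lw := S.coordL2_process hn t
  have lv := S.coordL2_meas hn t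
  have lη := S.coordL2_kalmanNoise hn t
  have e1 : crossMoment S.sampleLaw (fun s : Sample n m => s.meas t) (fun s => s.process t) = 0 :=
    crossMoment_eq_zero' (S.measurePreserving_flipDynamics hn t) lv lw
      (fun s => S.meas_flipDynamics s t t) (fun s => S.process_flipDynamics s t)
  have e2 : crossMoment S.sampleLaw (S.kalmanNoise t) (fun s => s.process t) = S.W := by
    unfold kalmanNoise
    rw [crossMoment_sub_left lw (lv.mulVec _) lw, crossMoment_mulVec_left _ lv lw, e1,
      S.crossMoment_process hn hW, Matrix.mul_zero, sub_zero]
  have h : S.kalmanNoise t = fun s => s.process t - S.kalmanGain t *ᵥ s.meas t := rfl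
  conv_lhs => rw [show crossMoment S.sampleLaw (S.kalmanNoise t) (S.kalmanNoise t) =
    crossMoment S.sampleLaw (S.kalmanNoise t)
      (fun s => s.process t - S.kalmanGain t *ᵥ s.meas t) from rfl]
  rw [crossMoment_sub_right lη lw (lv.mulVec _), crossMoment_mulVec_right _ lη lv, e2,
    crossMoment_kalmanNoise_meas hn hV, Matrix.neg_mul, sub_neg_eq_add]

/-- The defining property of the Kalman gain. -/
theorem kalmanGain_mul (S : KFSystem n m) (hV : S.V.PosDef) {t : ℕ}
    (hric : (S.riccati t).PosSemidef) :
    S.kalmanGain t * (S.V + S.C * S.riccati t * S.Cᵀ) = S.A * S.riccati t * S.Cᵀ := by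
  have hpd : (S.V + S.C * S.riccati t * S.Cᵀ).PosDef := by
    refine hV.add_posSemidef ?_
    simpa using hric.mul_mul_conjTranspose_same S.C
  rw [kalmanGain, Matrix.mul_assoc _ _ (S.V + _), Matrix.nonsing_inv_mul _
    ((Matrix.isUnit_iff_isUnit_det _).1 hpd.isUnit), Matrix.mul_one]

/-- The Joseph form of the recursion, recognizable as the covariance of the next error. It follows
from the gain equation `L (V + C Q Cᵀ) = A Q Cᵀ`. -/
theorem riccati_succ (S : KFSystem n m) (hV : S.V.PosDef) {t : ℕ}
    (hric : (S.riccati t).PosSemidef) :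
    S.riccati (t + 1) = (S.A - S.kalmanGain t * S.C) * S.riccati t *
      (S.A - S.kalmanGain t * S.C)ᵀ + (S.W + S.kalmanGain t * S.V * (S.kalmanGain t)ᵀ) := by
  have hL := S.kalmanGain_mul hV hric
  have h1 : S.riccati (t + 1) = S.A * S.riccati t * S.Aᵀ -
      S.kalmanGain t * S.C * S.riccati t * S.Aᵀ + S.W := rfl
  rw [h1]
  generalize S.kalmanGain t = L at *
  generalize S.riccati t = Q at *
  have h2 : L * S.V * Lᵀ = S.A * Q * S.Cᵀ * Lᵀ - L * (S.C * Q * S.Cᵀ) * Lᵀ := by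
    rw [← hL, Matrix.mul_add, Matrix.add_mul]; abel
  rw [h2, Matrix.transpose_sub, Matrix.transpose_mul]
  simp only [Matrix.sub_mul, Matrix.mul_sub, Matrix.mul_assoc]
  abel

/-- The errors of the Kalman filters have the covariance given by the Riccati equation and are
orthogonal to the estimates. -/
theorem crossMoment_kalmanError (hn : 0 < n) (hW : S.W.PosSemidef) (hV : S.V.PosDef)
    (hX₀ : S.X₀.PosSemidef) {h t : ℕ} (ht : t ≤ h) :
    crossMoment S.sampleLaw (S.kalmanError h t) (S.kalmanError h t) = S.riccati t ∧
      crossMoment S.sampleLaw (S.kalmanError h t)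
        (fun s => S.estimate h S.kalmanFilter s t) = 0 := by
  have := S.isProbabilityMeasure_sampleLaw hn
  induction t with
  | zero =>
    have h0 : S.kalmanError h 0 = fun s => s.init - S.xbar := funext (kalmanError_zero h)
    refine ⟨by rw [h0, S.crossMoment_init hn hX₀, riccati], ?_⟩
    refine crossMoment_eq_zero (S.measurePreserving_flipInit hn) (coordL2_kalmanError hn ht)
      (S.coordL2_estimate hn ht _) (fun s => ?_) fun s => ?_
    · rw [h0]
      simp only [init_flipInit]
      abel
    · simp [estimate]
  | succ t ih =>
    obtain ⟨ih1, ih2⟩ := ih (by omega)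
    have le : CoordL2 S.sampleLaw (S.kalmanError h t) := coordL2_kalmanError hn (by omega)
    have le' : CoordL2 S.sampleLaw (S.kalmanError h (t + 1)) := coordL2_kalmanError hn ht
    have lη : CoordL2 S.sampleLaw (S.kalmanNoise t) := coordL2_kalmanNoise hn t
    have lx : CoordL2 S.sampleLaw fun s => S.estimate h S.kalmanFilter s t :=
      S.coordL2_estimate hn (by omega) _
    have lv := S.coordL2_meas hn t
    -- Positive semidefiniteness is read off from the probabilistic meaning given by the induction
    -- hypothesis, not from the recursion.
    have hric : (S.riccati t).PosSemidef := ih1 ▸ posSemidef_crossMoment le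
    have cηe : crossMoment S.sampleLaw (S.kalmanNoise t) (S.kalmanError h t) = 0 :=
      crossMoment_kalmanNoise_left hn t le (kalmanError_flipDynamics_of_le h le_rfl)
        (kalmanError_flipMeas_of_le h le_rfl)
    have ceη : crossMoment S.sampleLaw (S.kalmanError h t) (S.kalmanNoise t) = 0 := by
      rw [← crossMoment_transpose, cηe, Matrix.transpose_zero]
    have cηx : crossMoment S.sampleLaw (S.kalmanNoise t)
        (fun s => S.estimate h S.kalmanFilter s t) = 0 :=
      crossMoment_kalmanNoise_left hn t lx (fun s => estimate_flipDynamics_of_le h _ le_rfl s)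
        (fun s => S.estimate_flipMeas_of_le s h _ le_rfl)
    have cev : crossMoment S.sampleLaw (S.kalmanError h t) (fun s => s.meas t) = 0 :=
      crossMoment_eq_zero' (S.measurePreserving_flipMeas hn t) le lv
        (kalmanError_flipMeas_of_le h le_rfl) (fun s => S.meas_flipMeas s t)
    set M := S.A - S.kalmanGain t * S.C with hM
    have hsucc : S.kalmanError h (t + 1) = fun s => M *ᵥ S.kalmanError h t s + S.kalmanNoise t s :=
      funext (kalmanError_succ h t)
    have lMe : CoordL2 S.sampleLaw fun s => M *ᵥ S.kalmanError h t s := le.mulVec M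
    have left : ∀ {κ : Type} {Z : Sample n m → κ → ℝ}, CoordL2 S.sampleLaw Z →
        crossMoment S.sampleLaw (S.kalmanError h (t + 1)) Z =
          M * crossMoment S.sampleLaw (S.kalmanError h t) Z +
            crossMoment S.sampleLaw (S.kalmanNoise t) Z := by
      intro κ Z hZ
      rw [hsucc, crossMoment_add_left lMe lη hZ, crossMoment_mulVec_left M le hZ]
    constructor
    · rw [left le', S.riccati_succ hV hric, hsucc, crossMoment_add_right le lMe lη,
        crossMoment_add_right lη lMe lη, crossMoment_mulVec_right M le le,
        crossMoment_mulVec_right M lη le, ceη, cηe, ih1,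
        crossMoment_kalmanNoise_self hn hW hV.posSemidef]
      simp only [Matrix.zero_mul, add_zero, zero_add, Matrix.mul_assoc, ← hM]
    · have hinj : CoordL2 S.sampleLaw fun s : Sample n m => if h = t + 1 then s.inject else 0 := by
        split_ifs
        · exact S.coordL2_inject hn
        · exact CoordL2.of_const 0
      have hest : (fun s => S.estimate h S.kalmanFilter s (t + 1)) = fun s =>
          ((S.A *ᵥ S.estimate h S.kalmanFilter s t +
            (S.kalmanGain t * S.C) *ᵥ S.kalmanError h t s) + S.kalmanGain t *ᵥ s.meas t) +
            if h = t + 1 then s.inject else 0 := by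
        ext1 s
        rw [estimate, Policy.predict, output_eq_kalmanError, kalmanFilter_mulVec]
      have cinj : crossMoment S.sampleLaw (S.kalmanError h (t + 1))
          (fun s : Sample n m => if h = t + 1 then s.inject else 0) = 0 :=
        crossMoment_eq_zero' (S.measurePreserving_flipInject hn) le' hinj
          (kalmanError_flipInject h (t + 1)) (fun s => by split_ifs <;> simp)
      have lAx := lx.mulVec S.A
      have lLe := le.mulVec (S.kalmanGain t * S.C)
      have lLv := lv.mulVec (S.kalmanGain t)
      rw [hest, crossMoment_add_right le' ((lAx.add lLe).add lLv) hinj, cinj, add_zero,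
        crossMoment_add_right le' (lAx.add lLe) lLv, crossMoment_add_right le' lAx lLe,
        crossMoment_mulVec_right _ le' lx, crossMoment_mulVec_right _ le' le,
        crossMoment_mulVec_right _ le' lv, left lx, left le, left lv, ih1, ih2, cηx, cηe, cev,
        crossMoment_kalmanNoise_meas hn hV.posSemidef]
      -- What remains of the moment is `(A - L C) Q Cᵀ Lᵀ - L V Lᵀ`, which vanishes because the gain
      -- equation says `(A - L C) Q Cᵀ = L V`.
      have hL := S.kalmanGain_mul hV hric
      generalize S.kalmanGain t = L at *
      generalize S.riccati t = Q at *
      have h2 : L * S.V * Lᵀ = S.A * Q * S.Cᵀ * Lᵀ - L * (S.C * Q * S.Cᵀ) * Lᵀ := by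
        rw [← hL, Matrix.mul_add, Matrix.add_mul]; abel
      simp only [Matrix.mul_zero, Matrix.zero_mul, add_zero, zero_add, Matrix.neg_mul,
        Matrix.transpose_mul, hM]
      rw [h2]
      simp only [Matrix.sub_mul, Matrix.mul_assoc]
      abel

/-- The normal equations hold for the Kalman filter when the earlier filters are the Kalman
filters. -/
theorem crossMoment_kalman_residual (hn : 0 < n) (hW : S.W.PosSemidef) (hV : S.V.PosDef)
    (hX₀ : S.X₀.PosSemidef) (h : ℕ) :
    crossMoment S.sampleLaw
      (fun s => S.target h s - S.kalmanFilter h *ᵥ S.regressor h S.kalmanFilter s)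
      (S.regressor h S.kalmanFilter) = 0 := by
  obtain ⟨h1, h2⟩ := crossMoment_kalmanError hn hW hV hX₀ (le_refl h)
  have le : CoordL2 S.sampleLaw (S.kalmanError h h) := coordL2_kalmanError hn le_rfl
  have lη : CoordL2 S.sampleLaw (S.kalmanNoise h) := coordL2_kalmanNoise hn h
  have lx : CoordL2 S.sampleLaw fun s => S.estimate h S.kalmanFilter s h :=
    S.coordL2_estimate hn le_rfl _
  have lv := S.coordL2_meas hn h
  have hric : (S.riccati h).PosSemidef := h1 ▸ posSemidef_crossMoment le
  set M := S.A - S.kalmanGain h * S.C with hM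
  have hres : (fun s => S.target h s - S.kalmanFilter h *ᵥ S.regressor h S.kalmanFilter s) =
      fun s => M *ᵥ S.kalmanError h h s + S.kalmanNoise h s := by
    ext1 s
    rw [hM, ← state_sub_kalmanFilter_mulVec, target, state, regressor]
    simp
  have lMe : CoordL2 S.sampleLaw fun s => M *ᵥ S.kalmanError h h s := le.mulVec M
  have left : ∀ {κ : Type} {Z : Sample n m → κ → ℝ}, CoordL2 S.sampleLaw Z →
      crossMoment S.sampleLaw (fun s => M *ᵥ S.kalmanError h h s + S.kalmanNoise h s) Z =
        M * crossMoment S.sampleLaw (S.kalmanError h h) Z +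
          crossMoment S.sampleLaw (S.kalmanNoise h) Z := by
    intro κ Z hZ
    rw [crossMoment_add_left lMe lη hZ, crossMoment_mulVec_left M le hZ]
  have lr : CoordL2 S.sampleLaw fun s => M *ᵥ S.kalmanError h h s + S.kalmanNoise h s :=
    lMe.add lη
  have cηe : crossMoment S.sampleLaw (S.kalmanNoise h) (S.kalmanError h h) = 0 :=
    crossMoment_kalmanNoise_left hn h le (kalmanError_flipDynamics_of_le h le_rfl)
      (kalmanError_flipMeas_of_le h le_rfl)
  have cηx : crossMoment S.sampleLaw (S.kalmanNoise h)
      (fun s => S.estimate h S.kalmanFilter s h) = 0 :=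
    crossMoment_kalmanNoise_left hn h lx (fun s => estimate_flipDynamics_of_le h _ le_rfl s)
      (fun s => S.estimate_flipMeas_of_le s h _ le_rfl)
  have cev : crossMoment S.sampleLaw (S.kalmanError h h) (fun s => s.meas h) = 0 :=
    crossMoment_eq_zero' (S.measurePreserving_flipMeas hn h) le lv
      (kalmanError_flipMeas_of_le h le_rfl) (fun s => S.meas_flipMeas s h)
  have hreg : S.regressor h S.kalmanFilter = fun s =>
      Sum.elim (S.estimate h S.kalmanFilter s h)
        ((S.C *ᵥ S.estimate h S.kalmanFilter s h + S.C *ᵥ S.kalmanError h h s) + s.meas h) := by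
    ext1 s
    rw [regressor, output_eq_kalmanError, Matrix.mulVec_add]
  have lCx := lx.mulVec S.C
  have lCe := le.mulVec S.C
  rw [hres, hreg, crossMoment_sumElim, crossMoment_add_right lr (lCx.add lCe) lv,
    crossMoment_add_right lr lCx lCe, crossMoment_mulVec_right _ lr lx,
    crossMoment_mulVec_right _ lr le, left lx, left le, left lv, h1, h2, cηx, cηe, cev,
    crossMoment_kalmanNoise_meas hn hV.posSemidef]
  have hL := S.kalmanGain_mul hV hric
  generalize S.kalmanGain h = L at *
  generalize S.riccati h = Q at *
  -- The gain equation again: the residual is uncorrelated with the measurement.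
  have h3 : (S.A - L * S.C) * Q * S.Cᵀ + -(L * S.V) = 0 := by
    rw [Matrix.sub_mul, Matrix.sub_mul, ← hL, Matrix.mul_add]
    simp only [Matrix.mul_assoc]
    abel
  simp only [Matrix.mul_zero, Matrix.zero_mul, add_zero, zero_add, hM, h3]
  ext i (j | j) <;> rfl

/-- The minimizer of the stage objective is a Lipschitz function of the earlier filters at the
Kalman filters. -/
theorem exists_norm_optimalFilter_sub_kalmanFilter_le (hn : 0 < n) (hW : S.W.PosSemidef)
    (hV : S.V.PosDef) (hΘ : S.Θ.PosDef) (hX₀ : S.X₀.PosSemidef) (h : ℕ) {R : ℝ} (hR : 0 ≤ R)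
    (hK : ∀ j < h, ‖S.kalmanFilter j‖ ≤ R) :
    ∃ C : ℝ, 0 ≤ C ∧ ∀ F : ℕ → Policy n m, (∀ j < h, ‖F j‖ ≤ R) → ∀ a : ℝ, 0 ≤ a →
      (∀ j < h, ‖F j - S.kalmanFilter j‖ ≤ a) →
      ‖directionOf (S.optimalFilter h F - S.kalmanFilter h)‖ ≤ C * a := by
  obtain ⟨μ, hμ, hexc⟩ := S.exists_excitation hn hV hΘ
  obtain ⟨C, hC, htar, hreg⟩ := S.exists_norm_regressor_le h hR
  obtain ⟨C', hC', hlip⟩ := S.exists_norm_regressor_sub_le h hR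
  obtain ⟨k, hk, hkdef⟩ : ∃ k : ℝ, 0 ≤ k ∧
      ((Fintype.card (Fin n ⊕ Fin m) : ℕ) : ℝ) * ‖S.kalmanFilter h‖ = k :=
    ⟨_, by positivity, rfl⟩
  obtain ⟨I, hI, hIdef⟩ : ∃ I : ℝ, 0 ≤ I ∧
      ∫ s : Sample n m, s.size h ^ 2 ∂S.sampleLaw = I :=
    ⟨_, integral_nonneg fun s => sq_nonneg _, rfl⟩
  refine ⟨(((n * (m + n) : ℕ) : ℝ) * ((C + k * C) * C' * I) +
    ((n * (m + n) : ℕ) : ℝ) * ((k * C') * C * I)) / μ, by positivity, fun F hF a ha hFK => ?_⟩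
  have lz := S.coordL2_regressor hn h F
  have lzK := S.coordL2_regressor hn h S.kalmanFilter
  have lt := S.coordL2_target hn h
  have hsize : ∀ s : Sample n m, 0 ≤ s.size h := fun s => zero_le_one.trans (s.one_le_size h)
  -- Both regressors are compared so that each remaining term contains their difference, which is of
  -- order `a`; the term with the Kalman regressor alone vanishes by the normal equations.
  have hsplit : crossMoment S.sampleLaw
      (fun s => S.target h s - S.kalmanFilter h *ᵥ S.regressor h F s) (S.regressor h F) =
      crossMoment S.sampleLaw (fun s => S.target h s - S.kalmanFilter h *ᵥ S.regressor h F s)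
        (fun s => S.regressor h F s - S.regressor h S.kalmanFilter s) -
      crossMoment S.sampleLaw (fun s => S.kalmanFilter h *ᵥ
        (S.regressor h F s - S.regressor h S.kalmanFilter s)) (S.regressor h S.kalmanFilter) := by
    have h0 := crossMoment_kalman_residual hn hW hV hX₀ h
    rw [crossMoment_sub_left lt (lzK.mulVec _) lzK, crossMoment_mulVec_left _ lzK lzK] at h0
    have l1 := lt.sub (lz.mulVec (S.kalmanFilter h))
    rw [crossMoment_sub_right l1 lz lzK, crossMoment_sub_left lt (lz.mulVec _) lzK,
      crossMoment_mulVec_left _ lz lzK, crossMoment_mulVec_left _ (lz.sub lzK) lzK,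
      crossMoment_sub_left lz lzK lzK, Matrix.mul_sub, sub_eq_zero.1 h0]
    abel_nf
  have hb := norm_directionOf_optimalFilter_sub_le hn hV hΘ (hexc h F) (S.kalmanFilter h)
  have hdiff := hlip F S.kalmanFilter hF hK a ha hFK
  rw [hsplit, directionOf_sub] at hb
  have b1 := S.norm_directionOf_crossMoment_le hn h
    (X := fun s => S.target h s - S.kalmanFilter h *ᵥ S.regressor h F s)
    (Z := fun s => S.regressor h F s - S.regressor h S.kalmanFilter s) (a := C + k * C)
    (b := C' * a) (by positivity) (by positivity) (fun s => by
      refine (norm_sub_le _ _).trans ?_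
      rw [add_mul, mul_assoc k]
      refine add_le_add (htar s) ((norm_mulVec_le_card_mul _ _).trans ?_)
      rw [hkdef]
      exact mul_le_mul_of_nonneg_left (hreg F hF s) hk) hdiff
  have b2 := S.norm_directionOf_crossMoment_le hn h
    (X := fun s => S.kalmanFilter h *ᵥ (S.regressor h F s - S.regressor h S.kalmanFilter s))
    (Z := S.regressor h S.kalmanFilter) (a := k * C' * a) (b := C) (by positivity) hC
    (fun s => by
      refine (norm_mulVec_le_card_mul _ _).trans ?_
      rw [hkdef]
      refine (mul_le_mul_of_nonneg_left (hdiff s) hk).trans (le_of_eq ?_)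
      ring) (hreg _ hK)
  rw [hIdef] at b1 b2
  have h5 := hb.trans ((norm_sub_le _ _).trans (add_le_add b1 b2))
  rw [div_mul_eq_mul_div, le_div_iff₀ hμ]
  refine le_trans (le_of_eq (mul_comm _ _)) (h5.trans (le_of_eq ?_))
  ring

end KFSystem

/-! ### Convergence of the run -/

/-- If the failure probability given the coordinates that determine `X` is at most `p`, then so is
the unconditional one. -/
theorem measure_infinitePi_resample_le {Ω α : Type*} [MeasurableSpace Ω] [MeasurableSpace α]
    (μ : Measure Ω) [IsProbabilityMeasure μ] (k : ℕ) {X : (ℕ → Ω) → α} (hX : Measurable X)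
    (hXk : ∀ s y, X (Function.update s k y) = X s) {A : Set (α × Ω)} (hA : MeasurableSet A)
    {p : ENNReal} (hp : ∀ s, μ {y | (X s, y) ∈ A} ≤ p) :
    (Measure.infinitePi fun _ : ℕ => μ) {s | (X s, s k) ∈ A} ≤ p := by
  have hf : Measurable (Function.uncurry fun x y => A.indicator (fun _ => (1 : ENNReal)) (x, y)) :=
    measurable_const.indicator hA
  have h := lintegral_infinitePi_resample μ k hX hXk hf
  have h1 : ∫⁻ s, A.indicator (fun _ => (1 : ENNReal)) (X s, s k)
      ∂(Measure.infinitePi fun _ : ℕ => μ) =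
      (Measure.infinitePi fun _ : ℕ => μ) {s | (X s, s k) ∈ A} := by
    exact lintegral_indicator_one (hA.preimage (hX.prodMk (measurable_pi_apply k)))
  have h2 : ∀ s, ∫⁻ y, A.indicator (fun _ => (1 : ENNReal)) (X s, y) ∂μ =
      μ {y | (X s, y) ∈ A} := by
    intro s
    exact lintegral_indicator_one (hA.preimage measurable_prodMk_left)
  rw [← h1, h]
  simp only [h2]
  exact (lintegral_mono hp).trans (by simp)

theorem measurableSet_forall_lt {α : Type*} [MeasurableSpace α] {N : ℕ} {p : ℕ → α → Prop}
    (hp : ∀ j < N, MeasurableSet {a | p j a}) : MeasurableSet {a | ∀ j < N, p j a} := by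
  simp only [Set.ofPred_forall]
  exact MeasurableSet.iInter fun j => MeasurableSet.iInter fun hj => hp j hj

/-- Over finitely many stages the smallest `c₀` works, and then, for each `c`, the largest `K`. -/
theorem exists_uniform_constants {p : ℕ → ℝ → ℝ → Prop}
    (hmono : ∀ h c K K', K ≤ K' → p h c K → p h c K') (N : ℕ)
    (hp : ∀ h < N, ∃ c₀ : ℝ, 0 < c₀ ∧ ∀ c : ℝ, 0 < c → c ≤ c₀ → ∃ K : ℝ, 0 < K ∧ p h c K) :
    ∃ c₀ : ℝ, 0 < c₀ ∧ ∀ c : ℝ, 0 < c → c ≤ c₀ → ∃ K : ℝ, 0 < K ∧ ∀ h < N, p h c K := by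
  induction N with
  | zero => exact ⟨1, one_pos, fun c _ _ => ⟨1, one_pos, fun h hh => by omega⟩⟩
  | succ N ih =>
    obtain ⟨c₁, hc₁, h₁⟩ := ih fun h hh => hp h (by omega)
    obtain ⟨c₂, hc₂, h₂⟩ := hp N (by omega)
    refine ⟨min c₁ c₂, lt_min hc₁ hc₂, fun c hc hcc => ?_⟩
    obtain ⟨K₁, hK₁, h₁⟩ := h₁ c hc (hcc.trans (min_le_left _ _))
    obtain ⟨K₂, hK₂, h₂⟩ := h₂ c hc (hcc.trans (min_le_right _ _))
    refine ⟨max K₁ K₂, hK₁.trans_le (le_max_left _ _), fun h hh => ?_⟩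
    rcases Nat.lt_succ_iff_lt_or_eq.1 hh with hh | rfl
    · exact hmono _ _ _ _ (le_max_left _ _) (h₁ h hh)
    · exact hmono _ _ _ _ (le_max_right _ _) h₂

namespace KFSystem

variable {n m : ℕ} (S : KFSystem n m)

theorem isProbabilityMeasure_stageLaw (hn : 0 < n) : IsProbabilityMeasure S.stageLaw := by
  have := S.isProbabilityMeasure_sampleLaw hn
  unfold stageLaw
  infer_instance

theorem isProbabilityMeasure_runLaw (hn : 0 < n) : IsProbabilityMeasure S.runLaw := by
  have := S.isProbabilityMeasure_stageLaw hn
  unfold runLaw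
  infer_instance

theorem measurable_zerothOrderPG (h : ℕ) {r : ℝ} (hr : r ≠ 0) (η : ℝ) (T : ℕ) :
    Measurable fun q : (ℕ → DirectionSpace n m) × DirectionSpace n m × (ℕ → Sample n m) =>
      directionOf (S.zerothOrderPG h (fun j => directionMatrix (q.1 j)) r η
        (directionMatrix q.2.1) q.2.2 T) := by
  induction T with
  | zero => exact measurable_snd.fst
  | succ T ih =>
    simp only [S.directionOf_zerothOrderPG_succ h _ hr]
    have hs : Measurable fun q : (ℕ → DirectionSpace n m) × DirectionSpace n m × (ℕ → Sample n m) =>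
        q.2.2 T := (measurable_pi_apply T).comp measurable_snd.snd
    exact ih.sub (((S.measurable_stochasticGradient h).comp
      (measurable_fst.prodMk (ih.prodMk hs))).const_smul η)

theorem measurable_zerothOrderPG_right (h : ℕ) (F : ℕ → Policy n m) {r : ℝ} (hr : r ≠ 0) (η : ℝ)
    (π₀ : Policy n m) (T : ℕ) :
    Measurable fun s : ℕ → Sample n m => directionOf (S.zerothOrderPG h F r η π₀ s T) :=
  ((S.measurable_zerothOrderPG h hr η T).comp (measurable_prodMk_left
    (x := fun j => directionOf (F j)))).comp (measurable_prodMk_left (x := directionOf π₀))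

theorem measurable_directionOf_warmStart (h : ℕ) :
    Measurable fun x : ℕ → DirectionSpace n m =>
      directionOf (warmStart (fun j => directionMatrix (x j)) h) := by
  cases h with
  | zero => exact measurable_const (a := directionOf 0)
  | succ h => exact measurable_pi_apply h

/-- The filter returned by a stage is a measurable function of the earlier filters and of the
samples of the stage. -/
theorem measurable_stage (h : ℕ) {r : ℝ} (hr : r ≠ 0) (η : ℝ) (T : ℕ) :
    Measurable fun q : (ℕ → DirectionSpace n m) × (ℕ → Sample n m) =>
      directionOf (S.zerothOrderPG h (fun j => directionMatrix (q.1 j)) r η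
        (warmStart (fun j => directionMatrix (q.1 j)) h) q.2 T) :=
  (S.measurable_zerothOrderPG h hr η T).comp (measurable_fst.prodMk
    (((measurable_directionOf_warmStart h).comp measurable_fst).prodMk measurable_snd))

theorem measurable_rhpg {r : ℝ} (hr : r ≠ 0) (η : ℝ) (T h : ℕ) :
    Measurable fun (s : ℕ → ℕ → Sample n m) j => directionOf (S.rhpg r η T s h j) := by
  induction h with
  | zero => exact measurable_const (a := fun _ => directionOf 0)
  | succ h ih =>
    refine measurable_pi_iff.2 fun j => ?_
    by_cases hj : j = h
    · subst hj
      simp only [rhpg, Function.update_self]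
      exact (S.measurable_stage j hr η T).comp (ih.prodMk (measurable_pi_apply j))
    · simp only [rhpg, Function.update_of_ne hj]
      exact measurable_pi_iff.1 ih j

/-- The filters after `h` stages do not use the samples of stage `k ≥ h`, which may therefore be
resampled. -/
theorem rhpg_update (r η : ℝ) (T : ℕ) (s : ℕ → ℕ → Sample n m) {h k : ℕ} (hk : h ≤ k)
    (y : ℕ → Sample n m) : S.rhpg r η T (Function.update s k y) h = S.rhpg r η T s h := by
  induction h with
  | zero => rfl
  | succ h ih => rw [rhpg, rhpg, ih (by omega), Function.update_of_ne (by omega)]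

theorem norm_warmStart_le {F : ℕ → Policy n m} {R : ℝ} (hR : 0 ≤ R) {h : ℕ}
    (hF : ∀ j < h, ‖F j‖ ≤ R) : ‖warmStart F h‖ ≤ R := by
  cases h with
  | zero => simpa [warmStart] using hR
  | succ h => exact hF h (by omega)

/-- Accumulation over the stages of the failure probabilities of the single stages. -/
theorem measure_rhpg_le (hn : 0 < n) {r : ℝ} (hr : r ≠ 0) (η : ℝ) (T : ℕ) (G : ℕ → Policy n m)
    (e : ℕ → ℝ) {p : ENNReal} (N : ℕ)
    (hstage : ∀ h < N, ∀ F : ℕ → Policy n m,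
      (∀ j < h, ‖directionOf (F j) - directionOf (G j)‖ ≤ e j) →
      S.stageLaw {y | e h < ‖directionOf (S.zerothOrderPG h F r η (warmStart F h) y T) -
        directionOf (G h)‖} ≤ p) :
    S.runLaw {s | ∀ j < N, ‖directionOf (S.rhpg r η T s N j) - directionOf (G j)‖ ≤ e j}ᶜ ≤
      N * p := by
  have := S.isProbabilityMeasure_stageLaw hn
  induction N with
  | zero => simp
  | succ N ih =>
    -- First failure at stage `N`. Including the accuracy of the earlier filters in the event makes
    -- `hstage` applicable for every value of the earlier samples: where they are inaccurate, the
    -- section is empty.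
    let A : Set ((ℕ → DirectionSpace n m) × (ℕ → Sample n m)) :=
      {q | (∀ j < N, ‖q.1 j - directionOf (G j)‖ ≤ e j) ∧
        e N < ‖directionOf (S.zerothOrderPG N (fun j => directionMatrix (q.1 j)) r η
          (warmStart (fun j => directionMatrix (q.1 j)) N) q.2 T) - directionOf (G N)‖}
    have hA : MeasurableSet A := by
      refine MeasurableSet.inter (measurableSet_forall_lt fun j _ => ?_) ?_
      · exact measurableSet_le
          ((((measurable_pi_apply j).comp measurable_fst).sub_const _).norm) measurable_const
      · exact measurableSet_lt measurable_const
          (((S.measurable_stage N hr η T).sub_const _).norm)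
    have hb := measure_infinitePi_resample_le S.stageLaw N (S.measurable_rhpg hr η T N)
      (fun s y => by simp only [S.rhpg_update r η T s le_rfl y]) hA (p := p) fun s => by
        by_cases hs : ∀ j < N, ‖directionOf (S.rhpg r η T s N j) - directionOf (G j)‖ ≤ e j
        · exact (measure_mono fun y hy => hy.2).trans (hstage N (by omega) _ hs)
        · refine (le_of_eq ?_).trans zero_le
          convert measure_empty (μ := S.stageLaw)
          exact Set.eq_empty_of_forall_notMem fun y hy => hs hy.1
    have hsub : {s | ∀ j < N + 1,
        ‖directionOf (S.rhpg r η T s (N + 1) j) - directionOf (G j)‖ ≤ e j}ᶜ ⊆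
        {s | ∀ j < N, ‖directionOf (S.rhpg r η T s N j) - directionOf (G j)‖ ≤ e j}ᶜ ∪
          {s | ((fun j => directionOf (S.rhpg r η T s N j)), s N) ∈ A} := by
      intro s hs
      by_contra hcon
      simp only [Set.mem_union, Set.mem_compl_iff, Set.mem_ofPred_eq, not_or, not_not] at hcon
      refine hs fun j hj => ?_
      rcases Nat.lt_succ_iff_lt_or_eq.1 hj with hj | rfl
      · rw [rhpg, Function.update_of_ne hj.ne]
        exact hcon.1 j hj
      · rw [rhpg, Function.update_self]
        by_contra hlt
        exact hcon.2 ⟨hcon.1, not_le.1 hlt⟩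
    calc _ ≤ _ := measure_mono hsub
      _ ≤ _ := measure_union_le _ _
      _ ≤ N * p + p := add_le_add (ih fun h hh => hstage h (by omega)) hb
      _ = _ := by push_cast; ring

variable {S}

/-- The minimizers stay near the Kalman filter, with one constant for all stages. -/
theorem exists_uniform_norm_optimalFilter_sub_kalmanFilter_le (hn : 0 < n) (hW : S.W.PosSemidef)
    (hV : S.V.PosDef) (hΘ : S.Θ.PosDef) (hX₀ : S.X₀.PosSemidef) (N : ℕ) {R : ℝ} (hR : 0 ≤ R)
    (hK : ∀ j < N, ‖S.kalmanFilter j‖ ≤ R) :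
    ∃ C : ℝ, 0 ≤ C ∧ ∀ h < N, ∀ F : ℕ → Policy n m, (∀ j < h, ‖F j‖ ≤ R) → ∀ a : ℝ, 0 ≤ a →
      (∀ j < h, ‖F j - S.kalmanFilter j‖ ≤ a) →
      ‖directionOf (S.optimalFilter h F - S.kalmanFilter h)‖ ≤ C * a := by
  have hC : ∀ h : ℕ, ∃ C : ℝ, 0 ≤ C ∧ (h < N → ∀ F : ℕ → Policy n m, (∀ j < h, ‖F j‖ ≤ R) →
      ∀ a : ℝ, 0 ≤ a → (∀ j < h, ‖F j - S.kalmanFilter j‖ ≤ a) →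
      ‖directionOf (S.optimalFilter h F - S.kalmanFilter h)‖ ≤ C * a) := by
    intro h
    by_cases hh : h < N
    · obtain ⟨C, hC, hall⟩ := exists_norm_optimalFilter_sub_kalmanFilter_le hn hW hV hΘ hX₀ h hR
        fun j hj => hK j (by omega)
      exact ⟨C, hC, fun _ => hall⟩
    · exact ⟨0, le_rfl, fun hh' => absurd hh' hh⟩
  choose C hC0 hC using hC
  refine ⟨∑ h ∈ Finset.range N, C h, Finset.sum_nonneg fun h _ => hC0 h,
    fun h hh F hF a ha hFK => (hC h hh F hF a ha hFK).trans ?_⟩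
  exact mul_le_mul_of_nonneg_right
    (Finset.single_le_sum (fun j _ => hC0 j) (Finset.mem_range.2 hh)) ha

/-- Only the Frobenius event is shown to be measurable; its complement lies in the spectral event,
and monotonicity of the measure suffices. -/
theorem one_sub_le_stageLaw_real (hn : 0 < n) {h : ℕ} {F : ℕ → Policy n m} {r η ε δ : ℝ}
    (hr : r ≠ 0) {π₀ π : Policy n m} {T : ℕ}
    (hbad : S.stageLaw.real {s | ε < ‖directionOf (S.zerothOrderPG h F r η π₀ s T) -
      directionOf π‖} ≤ δ) :
    1 - δ ≤ S.stageLaw.real {s | ‖S.zerothOrderPG h F r η π₀ s T - π‖ ≤ ε} := by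
  have := S.isProbabilityMeasure_stageLaw hn
  have hm : MeasurableSet {s | ε < ‖directionOf (S.zerothOrderPG h F r η π₀ s T) -
      directionOf π‖} :=
    measurableSet_lt measurable_const
      (((S.measurable_zerothOrderPG_right h F hr η π₀ T).sub_const _).norm)
  have h1 := probReal_compl_eq_one_sub (μ := S.stageLaw) hm
  have h2 : S.stageLaw.real {s | ε < ‖directionOf (S.zerothOrderPG h F r η π₀ s T) -
      directionOf π‖}ᶜ ≤ S.stageLaw.real {s | ‖S.zerothOrderPG h F r η π₀ s T - π‖ ≤ ε} :=
    measureReal_mono fun s hs => (norm_le_norm_directionOf _).trans (not_lt.1 hs)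
  linarith

/-- Accuracy of all stages of a run with respect to the Kalman filters. -/
theorem exists_run_constants (hn : 0 < n) (hW : S.W.PosSemidef) (hV : S.V.PosDef)
    (hΘ : S.Θ.PosDef) (hX₀ : S.X₀.PosSemidef) (N : ℕ) :
    ∃ c₀ : ℝ, 0 < c₀ ∧ ∀ c : ℝ, 0 < c → c ≤ c₀ → ∃ K : ℝ, 0 < K ∧
      ∀ ε δ r : ℝ, 0 < ε → ε ≤ 1 / 2 → 0 < δ → δ < 1 → r ≠ 0 →
      ∀ T : ℕ, K / ε ^ 2 * Real.log (1 / (δ * ε ^ 2)) * Real.log (1 / ε) ≤ (T : ℝ) →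
        ∃ G : Set (ℕ → ℕ → Sample n m), 1 - N * δ ≤ S.runLaw.real G ∧ ∀ s ∈ G, ∀ h < N,
          ‖S.rhpg r (c * ε ^ 2 / Real.log (1 / (δ * ε ^ 2))) T s N h -
            S.optimalFilter h (S.rhpg r (c * ε ^ 2 / Real.log (1 / (δ * ε ^ 2))) T s N)‖ ≤ ε ∧
          ‖S.rhpg r (c * ε ^ 2 / Real.log (1 / (δ * ε ^ 2))) T s N h - S.kalmanFilter h‖ ≤ ε := by
  have := S.isProbabilityMeasure_stageLaw hn
  have := S.isProbabilityMeasure_runLaw hn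
  -- A ball containing every filter within distance 1 of one of the Kalman filters.
  set R : ℝ := ∑ j ∈ Finset.range N, ‖S.kalmanFilter j‖ + 1 with hRdef
  have hKR : ∀ j < N, ‖S.kalmanFilter j‖ + 1 ≤ R := fun j hj =>
    add_le_add_left (Finset.single_le_sum (f := fun j => ‖S.kalmanFilter j‖)
      (fun j _ => norm_nonneg _) (Finset.mem_range.2 hj)) 1
  have hR : 0 ≤ R := by positivity
  obtain ⟨C, hC, hlip⟩ := exists_uniform_norm_optimalFilter_sub_kalmanFilter_le hn hW hV hΘ hX₀ N
    hR fun j hj => (le_add_of_nonneg_right zero_le_one).trans (hKR j hj)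
  -- In units of `ε`, a stage adds its own error `β` to `C` times the inherited error. The sequence
  -- `e k = (1 + C)^k β` dominates this recursion, and `β` is normalized by `e N = 1/2`.
  set β : ℝ := 1 / (2 * (1 + C) ^ N) with hβdef
  have hpow : ∀ k, 1 ≤ (1 + C) ^ k := fun k => one_le_pow₀ (by linarith)
  have hβ : 0 < β := by positivity
  set e : ℕ → ℝ := fun k => (1 + C) ^ k * β with hedef
  have hemono : Monotone e := fun i j hij =>
    mul_le_mul_of_nonneg_right (pow_le_pow_right₀ (by linarith) hij) hβ.le
  have heN : e N = 1 / 2 := by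
    simp only [hedef, hβdef]
    have := (hpow N).trans_lt' one_pos
    field_simp
  have he0 : ∀ k, 0 ≤ e k := fun k => by positivity
  have hesucc : ∀ k, β + C * e k ≤ e (k + 1) := fun k => by
    have : β ≤ e k := le_mul_of_one_le_left hβ.le (hpow k)
    have h2 : e (k + 1) = e k + C * e k := by simp only [hedef, pow_succ]; ring
    linarith
  have hβ1 : β ≤ 1 := by
    have h1 : β ≤ e N := le_mul_of_one_le_left hβ.le (hpow N)
    linarith
  obtain ⟨c₀, hc₀, hall⟩ := exists_uniform_constants (p := fun h c K =>
      ∀ F : ℕ → Policy n m, (∀ j < h, ‖F j‖ ≤ R) → ∀ π₀ : Policy n m, ‖π₀‖ ≤ R →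
      ∀ ε δ r : ℝ, 0 < ε → ε ≤ 1 / 2 → 0 < δ → δ < 1 → r ≠ 0 →
      ∀ T : ℕ, K / ε ^ 2 * Real.log (1 / (δ * ε ^ 2)) * Real.log (1 / ε) ≤ (T : ℝ) →
        S.stageLaw.real {s | β * ε < ‖directionOf (S.zerothOrderPG h F r
          (c * ε ^ 2 / Real.log (1 / (δ * ε ^ 2))) π₀ s T) -
            directionOf (S.optimalFilter h F)‖} ≤ δ)
    (fun h c K K' hKK hp F hF π₀ hπ₀ ε δ r hε hε2 hδ hδ1 hr T hT => by
      refine hp F hF π₀ hπ₀ ε δ r hε hε2 hδ hδ1 hr T (le_trans ?_ hT)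
      have h1 : 0 ≤ Real.log (1 / ε) :=
        Real.log_nonneg ((one_le_div hε).2 (by linarith))
      have h2 : 0 ≤ Real.log (1 / (δ * ε ^ 2)) :=
        Real.log_nonneg ((one_le_div (by positivity)).2 (by nlinarith))
      gcongr) N (fun h _ => exists_stage_constants hn hV hΘ h hR hβ hβ1)
  refine ⟨c₀, hc₀, fun c hc hcc => ?_⟩
  obtain ⟨K, hK, hall⟩ := hall c hc hcc
  refine ⟨K, hK, fun ε δ r hε hε2 hδ hδ1 hr T hT => ?_⟩
  -- Filter `j` is allowed the error `e (j + 1) * ε`, so all filters before stage `h` are within `e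
  -- h * ε ≤ 1` and stay in the ball of radius `R`.
  have hbounds : ∀ h ≤ N, ∀ F : ℕ → Policy n m,
      (∀ j < h, ‖directionOf (F j) - directionOf (S.kalmanFilter j)‖ ≤ e (j + 1) * ε) →
      (∀ j < h, ‖F j - S.kalmanFilter j‖ ≤ e h * ε) ∧ (∀ j < h, ‖F j‖ ≤ R) := by
    intro h hh F hF
    have h1 : ∀ j < h, ‖F j - S.kalmanFilter j‖ ≤ e h * ε := fun j hj =>
      (norm_le_norm_directionOf _).trans ((hF j hj).trans
        (mul_le_mul_of_nonneg_right (hemono hj) hε.le))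
    refine ⟨h1, fun j hj => ?_⟩
    have h2 := norm_add_le (F j - S.kalmanFilter j) (S.kalmanFilter j)
    rw [sub_add_cancel] at h2
    have h3 : e h * ε ≤ 1 := by
      have := hemono hh
      nlinarith [he0 h]
    have := hKR j (by omega)
    have := h1 j hj
    linarith
  have hrun := S.measure_rhpg_le hn hr (c * ε ^ 2 / Real.log (1 / (δ * ε ^ 2))) T S.kalmanFilter
    (fun j => e (j + 1) * ε) (p := ENNReal.ofReal δ) N fun h hh F hF => by
      obtain ⟨hFK, hFR⟩ := hbounds h hh.le F hF
      have h1 := hall h hh F hFR (warmStart F h) (norm_warmStart_le hR hFR) ε δ r hε hε2 hδ hδ1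
        hr T hT
      have h2 := hlip h hh F hFR (e h * ε) (mul_nonneg (he0 h) hε.le) hFK
      rw [directionOf_sub] at h2
      refine (measure_mono fun y hy => ?_).trans
        ((ENNReal.le_ofReal_iff_toReal_le (measure_ne_top _ _) hδ.le).2 h1)
      have h3 := norm_sub_le_norm_sub_add_norm_sub (directionOf (S.zerothOrderPG h F r
          (c * ε ^ 2 / Real.log (1 / (δ * ε ^ 2))) (warmStart F h) y T))
        (directionOf (S.optimalFilter h F)) (directionOf (S.kalmanFilter h))
      have h4 := mul_le_mul_of_nonneg_right (hesucc h) hε.le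
      simp only [Set.mem_ofPred_eq] at hy ⊢
      linarith
  refine ⟨{s | ∀ j < N, ‖directionOf (S.rhpg r (c * ε ^ 2 / Real.log (1 / (δ * ε ^ 2))) T s N j) -
      directionOf (S.kalmanFilter j)‖ ≤ e (j + 1) * ε}, ?_, fun s hs h hh => ?_⟩
  · have h1 := ENNReal.toReal_mono (by finiteness) hrun
    rw [ENNReal.toReal_mul, ENNReal.toReal_natCast, ENNReal.toReal_ofReal hδ.le] at h1
    have h2 : MeasurableSet {s | ∀ j < N, ‖directionOf (S.rhpg r
        (c * ε ^ 2 / Real.log (1 / (δ * ε ^ 2))) T s N j) -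
        directionOf (S.kalmanFilter j)‖ ≤ e (j + 1) * ε} :=
      measurableSet_forall_lt fun j _ => measurableSet_le
        (((measurable_pi_iff.1 (S.measurable_rhpg hr _ T N) j).sub_const _).norm) measurable_const
    have h3 := probReal_compl_eq_one_sub (μ := S.runLaw) h2
    rw [measureReal_def] at h3
    linarith
  · have hs' : ∀ j < N, ‖directionOf (S.rhpg r (c * ε ^ 2 / Real.log (1 / (δ * ε ^ 2))) T s N j) -
      directionOf (S.kalmanFilter j)‖ ≤ e (j + 1) * ε := hs
    generalize S.rhpg r (c * ε ^ 2 / Real.log (1 / (δ * ε ^ 2))) T s N = F at *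
    obtain ⟨hFK, hFR⟩ := hbounds h hh.le F fun j hj => hs' j (by omega)
    have h1 := (norm_le_norm_directionOf (F h - S.kalmanFilter h)).trans (hs' h hh)
    have h2 := (norm_le_norm_directionOf _).trans
      (hlip h hh F hFR (e h * ε) (mul_nonneg (he0 h) hε.le) hFK)
    -- The distance to the stage minimizer is recovered through the Kalman filter. It costs `(e (h +
    -- 1) + C * e h) * ε`, at most `2 * e N * ε = ε`, which explains the value `1/2`.
    have h3 := norm_sub_le_norm_sub_add_norm_sub (F h) (S.kalmanFilter h) (S.optimalFilter h F)
    rw [norm_sub_rev (S.kalmanFilter h)] at h3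
    have h4 := mul_le_mul_of_nonneg_right (hemono hh) hε.le
    have h5 := mul_le_mul_of_nonneg_right (hesucc h) hε.le
    rw [Nat.succ_eq_add_one, heN] at h4
    have h6 := mul_pos hβ hε
    constructor <;> linarith

end KFSystem

/-! ### The main theorem. -/

theorem proposition2 {n m : ℕ} (hn : 0 < n) (S : KFSystem n m)
    (hW : S.W.PosDef) (hV : S.V.PosDef) (hX₀ : S.X₀.PosDef) (hΘ : S.Θ.PosDef) :
    -- one stage, uniformly over the filters of the earlier stages and over the initialization
    (∀ (h : ℕ) (R ρ : ℝ), 0 < R → 0 < ρ →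
      ∃ c₀ : ℝ, 0 < c₀ ∧ ∀ c : ℝ, 0 < c → c ≤ c₀ →
      ∃ K : ℝ, 0 < K ∧
      ∀ F : ℕ → Policy n m, (∀ t < h, ‖F t‖ ≤ R) →
        (∀ π : Policy n m, Integrable (S.sampleCost h F π) S.sampleLaw) ∧
        ∃ πopt : Policy n m, (∀ π : Policy n m, π ≠ πopt → S.cost h F πopt < S.cost h F π) ∧
          ∀ π₀ : Policy n m, ‖π₀‖ ≤ R →
          ∀ ε δ r : ℝ, 0 < ε → ε ≤ 1 / 2 → 0 < δ → δ < 1 → 0 < r → r ≤ ρ * ε →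
          ∀ T : ℕ, K / ε ^ 2 * Real.log (1 / (δ * ε ^ 2)) * Real.log (1 / ε) ≤ (T : ℝ) →
            1 - δ ≤ S.stageLaw.real {s : ℕ → Sample n m |
              ‖S.zerothOrderPG h F r (c * ε ^ 2 / Real.log (1 / (δ * ε ^ 2))) π₀ s T - πopt‖
                ≤ ε}) ∧
    -- all stages of an `N`-stage run, in terms of the total number `N * T` of samples
    (∀ (N : ℕ) (ρ : ℝ), 0 < ρ →
      ∃ c₀ : ℝ, 0 < c₀ ∧ ∀ c : ℝ, 0 < c → c ≤ c₀ →
      ∃ K : ℝ, 0 < K ∧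
      ∀ ε δ r : ℝ, 0 < ε → ε ≤ 1 / 2 → 0 < δ → δ < 1 → 0 < r → r ≤ ρ * ε →
      ∀ T : ℕ, K / ε ^ 2 * Real.log (1 / (δ * ε ^ 2)) * Real.log (1 / ε) ≤ ((N * T : ℕ) : ℝ) →
        1 - N * δ ≤ S.runLaw.real {s : ℕ → ℕ → Sample n m |
          let F := S.rhpg r (c * ε ^ 2 / Real.log (1 / (δ * ε ^ 2))) T s N
          ∀ h < N,
            (∀ πopt : Policy n m, (∀ π : Policy n m, S.cost h F πopt ≤ S.cost h F π) →
              ‖F h - πopt‖ ≤ ε) ∧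
            ‖F h - S.kalmanFilter h‖ ≤ ε}) := by
  refine ⟨fun h R ρ hR _ => ?_, fun N ρ _ => ?_⟩
  -- A single stage has no propagated error, so `β = 1`.
  · obtain ⟨c₀, hc₀, hall⟩ := S.exists_stage_constants hn hV hΘ h hR.le one_pos le_rfl
    refine ⟨c₀, hc₀, fun c hc hcc => ?_⟩
    obtain ⟨K, hK, hall⟩ := hall c hc hcc
    refine ⟨K, hK, fun F hF => ⟨S.integrable_sampleCost hn h F, S.optimalFilter h F,
      fun π hπ => S.cost_optimalFilter_lt hn hV hΘ h F hπ,
      fun π₀ hπ₀ ε δ r hε hε2 hδ hδ1 hr _ T hT => ?_⟩⟩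
    have h1 := hall F hF π₀ hπ₀ ε δ r hε hε2 hδ hδ1 hr.ne' T hT
    rw [one_mul] at h1
    exact KFSystem.one_sub_le_stageLaw_real hn hr.ne' h1
  · obtain ⟨c₀, hc₀, hall⟩ :=
      S.exists_run_constants hn hW.posSemidef hV hΘ hX₀.posSemidef N
    refine ⟨c₀, hc₀, fun c hc hcc => ?_⟩
    obtain ⟨K, hK, hall⟩ := hall c hc hcc
    have := S.isProbabilityMeasure_runLaw hn
    -- The empty run is treated apart, because `N * K` would not be positive.
    rcases N.eq_zero_or_pos with rfl | hN
    · refine ⟨1, one_pos, fun ε δ r _ _ _ _ _ _ T _ => ?_⟩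
      simp
    have hN0 : (0 : ℝ) < N := by exact_mod_cast hN
    -- The factor `N` converts the total number of samples into iterations per stage.
    refine ⟨N * K, by positivity, fun ε δ r hε hε2 hδ hδ1 hr _ T hT => ?_⟩
    have hT' : K / ε ^ 2 * Real.log (1 / (δ * ε ^ 2)) * Real.log (1 / ε) ≤ (T : ℝ) := by
      refine le_of_mul_le_mul_left ?_ hN0
      push_cast at hT
      refine le_trans (le_of_eq ?_) hT
      ring
    obtain ⟨G, hG, hacc⟩ := hall ε δ r hε hε2 hδ hδ1 hr.ne' T hT'
    refine hG.trans (measureReal_mono fun s hs h hh => ⟨fun πopt hopt => ?_, (hacc s hs h hh).2⟩)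
    have heq : πopt = S.optimalFilter h (S.rhpg r (c * ε ^ 2 / Real.log (1 / (δ * ε ^ 2))) T s N) :=
      by_contra fun hne => (hopt _).not_gt (S.cost_optimalFilter_lt hn hV hΘ h _ hne)
    rw [heq]
    exact (hacc s hs h hh).1
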